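/- **Notation.** For $f=f(x,\xi)$ on $\mathbb R^3_x\times\mathbb R^3_\xi$ let $\|f\|_{L^{q,p}}=\big\|\,\|f(\cdot,\xi)\|_{L^p(\mathbb R^3_x)}\big\|_{L^q(\mathbb R^3_\xi)}$, $n_f(x)=\int f(x,\xi)\,d\xi$, and $V_f=\frac1{4\pi|\cdot|}*n_f$. Let $\check V(\xi)=(2\pi)^{-3}\int V(x)e^{ix\cdot\xi}dx$ be the inverse Fourier transform in the sense of tempered distributions, and $$(\Theta[V]f)(x,\xi)=\int_{\mathbb R^3}H(x,\xi-\xi')f(x,\xi')\,d\xi',\qquad H(x,\zeta)=16\,\mathrm{Re}\{i\,e^{2ix\cdot\zeta}\,\check V(-2\zeta)\},$$ so that, formally, $\Theta[V]f=\frac{i}{(2\pi)^3}\iint (V(x+\frac\eta2)-V(x-\frac\eta2))f(x,\xi')e^{-i(\xi-\xi')\cdot\eta}\,d\xi'\,d\eta$. **Propagators.** Given $A,B,C,\kappa,\nu,\tilde\kappa,\tilde\nu$ depending on $t>0$, let $D=4AC-B^2$ and, where $D(t)>0$, $d=(2\pi)^{-3}D^{-3/2}$, $a=4\pi^2d^{2/3}C$,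 $b=4\pi^2d^{2/3}B$, $c=4\pi^2d^{2/3}A$, $G_0(t,x,\xi)=d\,e^{-a|x|^2+b\,x\cdot\xi-c|\xi|^2}$ and $$G(t,x,\xi,z,v)=G_0\big(t,\;x-\nu v-\kappa z,\;\xi-\tilde\nu v-\tilde\kappa z\big).$$ *Unruh–Zurek (free particle, zero temperature, small cutoff), $\gamma,\Gamma>0$:* with $I=\frac12\ln(1+\frac{\Gamma^2}{4\gamma^2})$, $A=\frac2\pi I F_1$, $B=-\frac2\pi IF_2$, $C=\frac{2\gamma}\pi Ie^{-4\gamma t}(e^{2\gamma t}-1)^2$, where $F_1=\frac1{4\gamma}\big(10e^{-2\gamma t}+e^{-4\gamma t}-11+4\gamma t(3e^{-2\gamma t}+3-\gamma t)\big)$ and $F_2=2e^{-2\gamma t}+e^{-4\gamma t}-3+2\gamma t(3e^{-2\gamma t}+1)$; $\kappa=1$, $\nu=\frac1{2\gamma}(1-e^{-2\gamma t})$, $\tilde\kappa=0$, $\tilde\nu=e^{-2\gamma t}$. *Hu–Paz–Zhang (small frequencies, high temperature), $\delta,\Gamma,\Omega,\beta>0$:* $A=\frac{\delta\pi\Gamma}{2\beta}t^4\frac{F_A}{\chi}$,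 $B=\frac{\delta\pi\Gamma}{2\beta}t^3\frac{F_B}{\chi}$, $C=\frac{\delta\pi\Gamma}{2\beta}t^2\frac{F_C}{\chi}$, where $$F_A=\tfrac14-\tfrac\Gamma{15}t+\tfrac{\Gamma^2-3\Omega^2}{72}t^2+\tfrac{\delta\pi\Gamma^2}{12}t^3,\qquad F_B=1-\tfrac\Gamma3t+\tfrac{\Gamma^2-3\Omega^2}{12}t^2+\tfrac{\delta\pi\Gamma^2}3t^3,$$ $$F_C=1-\tfrac\Gamma3t+\tfrac{\Gamma^2-4\Omega^2}{12}t^2+\tfrac{\delta\pi\Gamma^2}3t^3,\qquad \chi=\big(1+\tfrac{\delta\pi\Gamma^2}{12}t^3(2-\Gamma t)\big)^2;$$ $$\kappa=\tilde\nu=1-\tfrac{\Omega^2}2t^2+\tfrac{\delta\pi\Gamma^2}6t^3-\tfrac{\delta\pi\Gamma^3}{24}t^4,\qquad \nu=t-\tfrac{\Omega^2}6t^3+\tfrac{\delta\pi\Gamma^2}{24}t^4-\tfrac{\delta\pi\Gamma^3}{120}t^5,$$ $$\tilde\kappa=-\Omega^2t+\tfrac{\delta\pi\Gamma^2}2t^2-\tfrac{\delta\pi\Gamma^3}6t^3.$$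 **Mild solutions.** Fix one of the two equations and $w_0\in L^{1,1}\cap L^{1,2}$. A *mild solution on $[0,T]$*, $T>0$, is a function $w\in C([0,T];L^{1,1}\cap L^{1,2})$ with $w(0)=w_0$ such that, for every $t\in(0,T]$ and almost every $(x,\xi)$, $$w(t,x,\xi)=\int_{\mathbb R^6} G(t,x,\xi,z,v)\,w_0(z,v)\,d(z,v)-\int_0^t\!\int_{\mathbb R^6} G(t-s,x,\xi,z,v)\,\big(\Theta[V_{w(s)}]w(s)\big)(z,v)\,d(z,v)\,ds ;$$ it is understood that the propagator is defined up to time $T$, i.e. ($\chi\ne0$ and) $D>0$ on $(0,T]$. Let $T_{max}\in[0,\infty]$ be the supremum of the $T$ for which a mild solution on $[0,T]$ exists. **Proposition (Regularity).** Let $0<T<T_{max}$ and let $w$ be a mild solution on $[0,T]$. Then (i) $w\in C((0,T);L^{\infty,\infty})\cap C((0,T);L^{1,p})$ for all $1\le p<\infty$; (ii) for every $t\in(0,T)$ the potential $V(t)=V_{w(t)}$ is differentiable and $\nabla_xV(t)\in L^2(\mathbb R^3)\cap L^\infty(\mathbb R^3)$. -/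

import Mathlib

open MeasureTheory Set Filter Topology
open scoped ENNReal

namespace WignerPoisson

noncomputable section

/-- Position space and momentum space `ℝ³`, with the Euclidean norm. -/
abbrev E3 : Type := EuclideanSpace ℝ (Fin 3)

/-- Phase space `ℝ³_x × ℝ³_ξ`; a point is a pair `(x, ξ)`. -/
abbrev Phase : Type := E3 × E3

/-! ### The mixed Lebesgue spaces `L^{q,p} = L^q(ℝ³_ξ; L^p(ℝ³_x))` -/

/-- The norm of `L^q(ℝ³_ξ; L^p(ℝ³_x))`, with values in `[0, ∞]`. -/
def mixedNorm (q p : ℝ≥0∞) (f : Phase → ℝ) : ℝ≥0∞ :=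
  eLpNorm (fun ξ : E3 => eLpNorm (fun x : E3 => f (x, ξ)) p volume) q volume

/-- `f ∈ L^{q,p}`. -/
def MemMixed (q p : ℝ≥0∞) (f : Phase → ℝ) : Prop :=
  AEStronglyMeasurable f volume ∧ mixedNorm q p f < ∞

/-- `w ∈ C(I; L^{q,p})`. Only the almost everywhere class of each `w t` matters. -/
def ContinuousInMixed (q p : ℝ≥0∞) (I : Set ℝ) (w : ℝ → Phase → ℝ) : Prop :=
  ∀ t ∈ I, MemMixed q p (w t) ∧
    Tendsto (fun s => mixedNorm q p (fun X => w s X - w t X)) (𝓝[I] t) (𝓝 0)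

/-! ### Density, Poisson potential and the pseudo-differential operator -/

/-- The position density `n(x) = ∫ f(x, ξ) dξ`. -/
def density (f : Phase → ℝ) (x : E3) : ℝ := ∫ ξ : E3, f (x, ξ)

/-- The Poisson potential `V = (1 / (4π|x|)) ∗ n`. -/
def potential (f : Phase → ℝ) (x : E3) : ℝ :=
  ∫ y : E3, 1 / (4 * Real.pi * ‖x - y‖) * density f y

/-- The inverse Fourier integral `(2π)⁻³ ∫ φ(ξ) e^{i x·ξ} dξ` of a Schwartz function. -/
def invFourierSchwartz (φ : SchwartzMap E3 ℂ) (x : E3) : ℂ :=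
  (((2 * Real.pi) ^ 3)⁻¹ : ℝ) *
    ∫ ξ : E3, φ ξ * Complex.exp (Complex.I * ((inner ℝ x ξ : ℝ) : ℂ))

/-- The locally integrable function `g` is the inverse Fourier transform
`V̌(ξ) = (2π)⁻³ ∫ V(x) e^{i x·ξ} dx` of `V`, in the sense of tempered distributions
(a Poisson potential decays like `1/|x|` and is not integrable). -/
def IsInvFourierTransform (V : E3 → ℝ) (g : E3 → ℂ) : Prop :=
  LocallyIntegrable g volume ∧
    ∀ φ : SchwartzMap E3 ℂ,
      ∫ x : E3, (V x : ℂ) * invFourierSchwartz φ x = ∫ ξ : E3, g ξ * φ ξ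

open Classical in
/-- The inverse Fourier transform `V̌` of `V`, unique up to null sets (and `0` if the distributional
transform is not a locally integrable function). -/
def invFourier (V : E3 → ℝ) : E3 → ℂ :=
  if h : ∃ g : E3 → ℂ, IsInvFourierTransform V g then h.choose else 0

/-- The kernel `H(x, ζ) = 16 Re (i e^{2i x·ζ} V̌(-2ζ))`, that is,
`(i/(2π)³) ∫ (V(x + η/2) - V(x - η/2)) e^{-i ζ·η} dη` for real `V`, with `ħ = m = 1`. -/
def wignerKernel (V : E3 → ℝ) (x ζ : E3) : ℝ :=
  16 * (Complex.I * Complex.exp (2 * Complex.I * ((inner ℝ x ζ : ℝ) : ℂ)) *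
    invFourier V ((-2 : ℝ) • ζ)).re

/-- The operator `Θ[V] f = H ∗_ξ f`. -/
def theta (V : E3 → ℝ) (f : Phase → ℝ) (X : Phase) : ℝ :=
  ∫ ξ' : E3, wignerKernel V X.1 (X.2 - ξ') * f (X.1, ξ')

/-! ### The propagators -/

/-- The two equations with their physical parameters: the Unruh-Zurek equation (free particle at
zero temperature) with damping coefficient `γ` and cutoff frequency `Γ`, and the Hu-Paz-Zhang
equation with coupling `δ`, cutoff `Γ`, frequency `Ω` and inverse temperature `β`. -/
inductive MasterEquation : Type
  | unruhZurek (γ Γ : ℝ) (hγ : 0 < γ) (hΓ : 0 < Γ) : MasterEquation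
  | huPazZhang (δ Γ Ω β : ℝ) (hδ : 0 < δ) (hΓ : 0 < Γ) (hΩ : 0 < Ω) (hβ : 0 < β) : MasterEquation

namespace MasterEquation

/-- The number `I₁'(0) = (1/2) log (1 + Γ²/(4γ²))` of the Unruh-Zurek model. -/
def uzI (γ Γ : ℝ) : ℝ := 1 / 2 * Real.log (1 + Γ ^ 2 / (4 * γ ^ 2))

def uzF₁ (γ t : ℝ) : ℝ :=
  1 / (4 * γ) * (10 * Real.exp (-2 * γ * t) + Real.exp (-4 * γ * t) - 11
    + 4 * γ * t * (3 * Real.exp (-2 * γ * t) + 3 - γ * t))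

def uzF₂ (γ t : ℝ) : ℝ :=
  2 * Real.exp (-2 * γ * t) + Real.exp (-4 * γ * t) - 3
    + 2 * γ * t * (3 * Real.exp (-2 * γ * t) + 1)

def hpzFA (δ Γ Ω t : ℝ) : ℝ :=
  1 / 4 - Γ / 15 * t + (Γ ^ 2 - 3 * Ω ^ 2) / 72 * t ^ 2 + δ * Real.pi * Γ ^ 2 / 12 * t ^ 3

def hpzFB (δ Γ Ω t : ℝ) : ℝ :=
  1 - Γ / 3 * t + (Γ ^ 2 - 3 * Ω ^ 2) / 12 * t ^ 2 + δ * Real.pi * Γ ^ 2 / 3 * t ^ 3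

def hpzFC (δ Γ Ω t : ℝ) : ℝ :=
  1 - Γ / 3 * t + (Γ ^ 2 - 4 * Ω ^ 2) / 12 * t ^ 2 + δ * Real.pi * Γ ^ 2 / 3 * t ^ 3

def hpzChi (δ Γ t : ℝ) : ℝ :=
  (1 + δ * Real.pi * Γ ^ 2 / 12 * t ^ 3 * (2 - Γ * t)) ^ 2

/-- The Fourier transform of the Gaussian `G₀(t)` is `exp (-(A |z|² + B z·v + C |v|²))`, with
`A = coeffA`, `B = coeffB`, `C = coeffC` at time `t`. -/
def coeffA : MasterEquation → ℝ → ℝ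
  | unruhZurek γ Γ _ _, t => 2 / Real.pi * uzI γ Γ * uzF₁ γ t
  | huPazZhang δ Γ Ω β _ _ _ _, t =>
      δ * Real.pi * Γ / (2 * β) * t ^ 4 * (hpzFA δ Γ Ω t / hpzChi δ Γ t)

def coeffB : MasterEquation → ℝ → ℝ
  | unruhZurek γ Γ _ _, t => -(2 / Real.pi * uzI γ Γ * uzF₂ γ t)
  | huPazZhang δ Γ Ω β _ _ _ _, t =>
      δ * Real.pi * Γ / (2 * β) * t ^ 3 * (hpzFB δ Γ Ω t / hpzChi δ Γ t)

def coeffC : MasterEquation → ℝ → ℝ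
  | unruhZurek γ Γ _ _, t =>
      2 * γ / Real.pi * uzI γ Γ * Real.exp (-4 * γ * t) * (Real.exp (2 * γ * t) - 1) ^ 2
  | huPazZhang δ Γ Ω β _ _ _ _, t =>
      δ * Real.pi * Γ / (2 * β) * t ^ 2 * (hpzFC δ Γ Ω t / hpzChi δ Γ t)

/-- The characteristics issued from `(z, v)` reach
`(κ(t) z + ν(t) v, kappaTilde(t) z + nuTilde(t) v)` at time `t`. -/
def kappa : MasterEquation → ℝ → ℝ
  | unruhZurek _ _ _ _, _ => 1
  | huPazZhang δ Γ Ω _ _ _ _ _, t =>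
      1 - Ω ^ 2 / 2 * t ^ 2 + δ * Real.pi * Γ ^ 2 / 6 * t ^ 3 - δ * Real.pi * Γ ^ 3 / 24 * t ^ 4

def nu : MasterEquation → ℝ → ℝ
  | unruhZurek γ _ _ _, t => 1 / (2 * γ) * (1 - Real.exp (-2 * γ * t))
  | huPazZhang δ Γ Ω _ _ _ _ _, t =>
      t - Ω ^ 2 / 6 * t ^ 3 + δ * Real.pi * Γ ^ 2 / 24 * t ^ 4 - δ * Real.pi * Γ ^ 3 / 120 * t ^ 5

def kappaTilde : MasterEquation → ℝ → ℝ
  | unruhZurek _ _ _ _, _ => 0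
  | huPazZhang δ Γ Ω _ _ _ _ _, t =>
      -Ω ^ 2 * t + δ * Real.pi * Γ ^ 2 / 2 * t ^ 2 - δ * Real.pi * Γ ^ 3 / 6 * t ^ 3

def nuTilde : MasterEquation → ℝ → ℝ
  | unruhZurek γ _ _ _, t => Real.exp (-2 * γ * t)
  | huPazZhang δ Γ Ω _ _ _ _ _, t =>
      1 - Ω ^ 2 / 2 * t ^ 2 + δ * Real.pi * Γ ^ 2 / 6 * t ^ 3 - δ * Real.pi * Γ ^ 3 / 24 * t ^ 4

/-- The discriminant `4 A C - B²`, whose positivity gives sense to the propagator. -/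
def disc (M : MasterEquation) (t : ℝ) : ℝ :=
  4 * M.coeffA t * M.coeffC t - M.coeffB t ^ 2

/-- The normalising factor `d(t) = (2π)⁻³ (4 A C - B²)^{-3/2}`. -/
def gaussD (M : MasterEquation) (t : ℝ) : ℝ :=
  1 / (2 * Real.pi) ^ 3 * M.disc t ^ (-(3 / 2) : ℝ)

def gaussA (M : MasterEquation) (t : ℝ) : ℝ :=
  4 * Real.pi ^ 2 * M.gaussD t ^ (2 / 3 : ℝ) * M.coeffC t

def gaussB (M : MasterEquation) (t : ℝ) : ℝ :=
  4 * Real.pi ^ 2 * M.gaussD t ^ (2 / 3 : ℝ) * M.coeffB t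

def gaussC (M : MasterEquation) (t : ℝ) : ℝ :=
  4 * Real.pi ^ 2 * M.gaussD t ^ (2 / 3 : ℝ) * M.coeffA t

/-- The Gaussian `G₀(t, x, ξ) = d e^{-a |x|² + b x·ξ - c |ξ|²}`. -/
def gaussian (M : MasterEquation) (t : ℝ) (x ξ : E3) : ℝ :=
  M.gaussD t * Real.exp (-M.gaussA t * ‖x‖ ^ 2 + M.gaussB t * inner ℝ x ξ - M.gaussC t * ‖ξ‖ ^ 2)

/-- The propagator `G(t, x, ξ, z, v)`, with `X = (x, ξ)` and `Z = (z, v)`. -/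
def propagator (M : MasterEquation) (t : ℝ) (X Z : Phase) : ℝ :=
  M.gaussian t (X.1 - M.nu t • Z.2 - M.kappa t • Z.1)
    (X.2 - M.nuTilde t • Z.2 - M.kappaTilde t • Z.1)

end MasterEquation

/-! ### Mild solutions -/

/-- `w` is a mild solution on `[0, T]` with initial datum `w₀`: the propagator is defined up to
time `T`, `w ∈ C([0, T]; L^{1,1} ∩ L^{1,2})`, `w(0) = w₀`, and the integral equation holds. -/
structure IsMildSolution (M : MasterEquation) (w₀ : Phase → ℝ) (T : ℝ) (w : ℝ → Phase → ℝ) :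
    Prop where
  propagator_defined : ∀ t ∈ Ioc 0 T, 0 < M.disc t
  continuous_one_one : ContinuousInMixed 1 1 (Icc 0 T) w
  continuous_one_two : ContinuousInMixed 1 2 (Icc 0 T) w
  initial : w 0 =ᵐ[volume] w₀
  integral_equation : ∀ t ∈ Ioc 0 T, ∀ᵐ X : Phase,
    w t X = (∫ Z : Phase, M.propagator t X Z * w₀ Z)
      - ∫ s in (0 : ℝ)..t, ∫ Z : Phase,
          M.propagator (t - s) X Z * theta (potential (w s)) (w s) Z

/-- The maximal time of existence `T_max ∈ [0, ∞]`. -/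
def maximalTime (M : MasterEquation) (w₀ : Phase → ℝ) : ℝ≥0∞ :=
  sSup {τ : ℝ≥0∞ | ∃ T : ℝ, 0 < T ∧ τ = ENNReal.ofReal T ∧ ∃ w, IsMildSolution M w₀ T w}

end

end WignerPoisson

/-! The regularity is a smoothing effect of the Gaussian propagator, obtained by duality and a
Gronwall argument that tolerates any power singularity at time zero. On `(0, T]` the discriminant is
positive and it is analytic at `0`, so it vanishes there to finite order and the propagator is
bounded by `c t⁻ᴺ` times an integrable weight, composed with the flow (`exists_gauss_le_weight`).
The exponent `N` may be far too large for a direct estimate of the Duhamel integral.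

This is overcome by testing against functions `g` whose weighted mass `∫ weight(X - Y) g(X) dX` is
bounded uniformly in `Y`. The adjoint propagator is bounded for this seminorm uniformly up to time
zero (`exists_weightedSup_backProp_le`), and it maps the seminorm into the sup norm at the cost
`t⁻ᴺ`. The nonlinearity is harmless: `n ∈ L¹ ∩ L²` makes `V̌ = (2π)⁻³ |ξ|⁻² ∫ n(y) e^{iy·ξ} dy`
integrable, so `Θ[V]` is dominated by a convolution in `ξ` with an `L¹` kernel, and its transpose
preserves the seminorm. In the Duhamel formula the part `s ≤ t/2` sees the propagator at times at
least `t/2`; the part `s > t/2` is absorbed through an exponential weight in time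
(`exists_lintegral_mul_le`). The outcome is a bound of `∫ |w(t)| g` by the seminorm of `g`, uniform
for `t` away from `0`.

Suitable choices of `g` turn this one bound into bounds of `w(t)` in `L^∞`, of its density in `L^∞`,
and of `w(t)` in `L^{1,p}` for `1 < p < ∞`. Continuity in `L^{1,p}` follows by interpolating between
`L^{1,1}`, where it is given, and a bounded `L^{1,2p-1}` norm. For continuity in `L^∞`, the recent
part of the Duhamel integral is small and the rest is Lipschitz, so the solutions are equicontinuous
in phase space away from `t = 0` (`exists_modulus`); an equicontinuous difference that is small in
`L¹` is small in `L^∞`.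

Finally, a density in `L¹ ∩ L² ∩ L^∞` has a Coulomb potential whose gradient is the convolution with
a kernel of size `|z|⁻²`. Differentiability comes from the uniform limit of regularised fields, and
the kernel is integrable near `0` and square integrable at infinity, which gives the `L^∞` and `L²`
bounds. -/

namespace WignerPoisson

/-! ### Signs, bounds and order of vanishing of the Gaussian coefficients -/

namespace MasterEquation

variable {M : MasterEquation} {T : ℝ}

theorem uzI_pos {γ Γ : ℝ} (hγ : 0 < γ) (hΓ : 0 < Γ) : 0 < uzI γ Γ := by
  have : 0 < Real.log (1 + Γ ^ 2 / (4 * γ ^ 2)) := Real.log_pos (by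
    have : 0 < Γ ^ 2 / (4 * γ ^ 2) := by positivity
    linarith)
  unfold uzI; positivity

/-- Division by zero gives zero, so at a zero of `χ` all three coefficients, and with them the
discriminant, vanish. Positivity of the discriminant therefore already contains the requirement `χ ≠
0`. -/
theorem hpzChi_ne_zero {δ Γ Ω β : ℝ} {hδ : 0 < δ} {hΓ : 0 < Γ} {hΩ : 0 < Ω} {hβ : 0 < β} {t : ℝ}
    (h : 0 < (huPazZhang δ Γ Ω β hδ hΓ hΩ hβ).disc t) : hpzChi δ Γ t ≠ 0 := by
  intro h0
  simp [disc, coeffA, coeffB, coeffC, h0] at h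

theorem hpzChi_zero (δ Γ : ℝ) : hpzChi δ Γ 0 = 1 := by simp [hpzChi]

theorem analyticAt_coeff (M : MasterEquation) :
    AnalyticAt ℝ M.coeffA 0 ∧ AnalyticAt ℝ M.coeffB 0 ∧ AnalyticAt ℝ M.coeffC 0 := by
  cases M with
  | unruhZurek γ Γ hγ hΓ =>
    refine ⟨?_, ?_, ?_⟩
    · change AnalyticAt ℝ (fun t : ℝ =>
        2 / Real.pi * uzI γ Γ * uzF₁ γ t) 0
      unfold uzF₁; fun_prop
    · change AnalyticAt ℝ (fun t : ℝ =>
        -(2 / Real.pi * uzI γ Γ * uzF₂ γ t)) 0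
      unfold uzF₂; fun_prop
    · change AnalyticAt ℝ (fun t : ℝ =>
        2 * γ / Real.pi * uzI γ Γ * Real.exp (-4 * γ * t) * (Real.exp (2 * γ * t) - 1) ^ 2) 0
      fun_prop
  | huPazZhang δ Γ Ω β hδ hΓ hΩ hβ =>
    have h0 : hpzChi δ Γ 0 ≠ 0 := by simp [hpzChi_zero]
    have hχ : AnalyticAt ℝ (hpzChi δ Γ) 0 := by unfold hpzChi; fun_prop
    have hA : AnalyticAt ℝ (hpzFA δ Γ Ω) 0 := by unfold hpzFA; fun_prop
    have hB : AnalyticAt ℝ (hpzFB δ Γ Ω) 0 := by unfold hpzFB; fun_prop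
    have hC : AnalyticAt ℝ (hpzFC δ Γ Ω) 0 := by unfold hpzFC; fun_prop
    refine ⟨?_, ?_, ?_⟩
    · have := hA.div hχ h0
      exact (by fun_prop : AnalyticAt ℝ (fun t : ℝ => δ * Real.pi * Γ / (2 * β) * t ^ 4) 0).mul this
    · have := hB.div hχ h0
      exact (by fun_prop : AnalyticAt ℝ (fun t : ℝ => δ * Real.pi * Γ / (2 * β) * t ^ 3) 0).mul this
    · have := hC.div hχ h0
      exact (by fun_prop : AnalyticAt ℝ (fun t : ℝ => δ * Real.pi * Γ / (2 * β) * t ^ 2) 0).mul this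

theorem continuousOn_coeff (hD : ∀ t ∈ Ioc 0 T, 0 < M.disc t) :
    ContinuousOn M.coeffA (Icc 0 T) ∧ ContinuousOn M.coeffB (Icc 0 T) ∧
      ContinuousOn M.coeffC (Icc 0 T) := by
  cases M with
  | unruhZurek γ Γ hγ hΓ =>
    refine ⟨?_, ?_, ?_⟩ <;> apply Continuous.continuousOn
    · change Continuous (fun t : ℝ =>
        2 / Real.pi * uzI γ Γ * uzF₁ γ t)
      unfold uzF₁; fun_prop
    · change Continuous (fun t : ℝ =>
        -(2 / Real.pi * uzI γ Γ * uzF₂ γ t))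
      unfold uzF₂; fun_prop
    · change Continuous (fun t : ℝ =>
        2 * γ / Real.pi * uzI γ Γ * Real.exp (-4 * γ * t) * (Real.exp (2 * γ * t) - 1) ^ 2)
      fun_prop
  | huPazZhang δ Γ Ω β hδ hΓ hΩ hβ =>
    have h0 : ∀ t ∈ Icc 0 T, hpzChi δ Γ t ≠ 0 := by
      rintro t ⟨ht0, htT⟩
      rcases ht0.eq_or_lt with rfl | h
      · simp [hpzChi_zero]
      · exact hpzChi_ne_zero (hD t ⟨h, htT⟩)
    have hχ : ContinuousOn (hpzChi δ Γ) (Icc 0 T) := by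
      apply Continuous.continuousOn; unfold hpzChi; fun_prop
    have hA : ContinuousOn (hpzFA δ Γ Ω) (Icc 0 T) := by
      apply Continuous.continuousOn; unfold hpzFA; fun_prop
    have hB : ContinuousOn (hpzFB δ Γ Ω) (Icc 0 T) := by
      apply Continuous.continuousOn; unfold hpzFB; fun_prop
    have hC : ContinuousOn (hpzFC δ Γ Ω) (Icc 0 T) := by
      apply Continuous.continuousOn; unfold hpzFC; fun_prop
    refine ⟨?_, ?_, ?_⟩
    · have := hA.div hχ h0
      exact (by fun_prop : ContinuousOn
        (fun t : ℝ => δ * Real.pi * Γ / (2 * β) * t ^ 4) (Icc 0 T)).mul this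
    · have := hB.div hχ h0
      exact (by fun_prop : ContinuousOn
        (fun t : ℝ => δ * Real.pi * Γ / (2 * β) * t ^ 3) (Icc 0 T)).mul this
    · have := hC.div hχ h0
      exact (by fun_prop : ContinuousOn
        (fun t : ℝ => δ * Real.pi * Γ / (2 * β) * t ^ 2) (Icc 0 T)).mul this

/-- A zero of `C` would make the discriminant `-B² ≤ 0`, so only the sign has to be settled. For
Unruh–Zurek it is visible; for Hu–Paz–Zhang, `F_C(0) = 1` and `F_C` has no zero on `[0, T]`, so the
intermediate value theorem applies. -/
theorem coeffC_pos (hD : ∀ t ∈ Ioc 0 T, 0 < M.disc t) {t : ℝ} (ht : t ∈ Ioc 0 T) :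
    0 < M.coeffC t := by
  have hne : ∀ s ∈ Ioc 0 T, M.coeffC s ≠ 0 := by
    intro s hs h
    have := hD s hs
    simp only [disc, h, mul_zero, zero_sub] at this
    nlinarith [sq_nonneg (M.coeffB s)]
  cases M with
  | unruhZurek γ Γ hγ hΓ =>
    have h1 := uzI_pos hγ hΓ
    refine lt_of_le_of_ne ?_ (hne t ht).symm
    simp only [coeffC]
    positivity
  | huPazZhang δ Γ Ω β hδ hΓ hΩ hβ =>
    have hF : ∀ s ∈ Icc 0 T, hpzFC δ Γ Ω s ≠ 0 := by
      rintro s ⟨hs0, hsT⟩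
      rcases hs0.eq_or_lt with rfl | h
      · simp [hpzFC]
      · intro h1
        exact hne s ⟨h, hsT⟩ (by simp [coeffC, h1])
    have hpos : 0 < hpzFC δ Γ Ω t := by
      by_contra! hle
      have hc : ContinuousOn (hpzFC δ Γ Ω) (Icc 0 t) := by
        apply Continuous.continuousOn; unfold hpzFC; fun_prop
      have h0 : (0 : ℝ) ≤ hpzFC δ Γ Ω 0 := by simp [hpzFC]
      obtain ⟨s, hs, hs0⟩ := intermediate_value_Icc' ht.1.le hc ⟨hle, h0⟩
      exact hF s ⟨hs.1, hs.2.trans ht.2⟩ hs0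
    have hχ : 0 < hpzChi δ Γ t :=
      lt_of_le_of_ne (by unfold hpzChi; positivity) (hpzChi_ne_zero (hD t ht)).symm
    have ht0 : 0 < t := ht.1
    simp only [coeffC]
    positivity

theorem coeffA_pos (hD : ∀ t ∈ Ioc 0 T, 0 < M.disc t) {t : ℝ} (ht : t ∈ Ioc 0 T) :
    0 < M.coeffA t := by
  have h1 := hD t ht
  have h2 := coeffC_pos hD ht
  by_contra! h
  simp only [disc] at h1
  nlinarith [sq_nonneg (M.coeffB t), mul_nonneg (neg_nonneg.2 h) h2.le]

/-- `A + C` is the trace of the covariance form. The exponent of the Gaussian is the inverse form up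
to scaling, so this upper bound becomes a uniform rate of Gaussian decay. -/
theorem exists_coeff_add_le (hD : ∀ t ∈ Ioc 0 T, 0 < M.disc t) :
    ∃ K : ℝ, 0 < K ∧ ∀ t ∈ Ioc 0 T, M.coeffA t + M.coeffC t ≤ K := by
  obtain ⟨hA, -, hC⟩ := continuousOn_coeff hD
  obtain ⟨K, hK⟩ := isCompact_Icc.exists_bound_of_continuousOn (hA.add hC)
  refine ⟨max K 1, by positivity, fun t ht => ?_⟩
  exact (le_abs_self _).trans ((hK t ⟨ht.1.le, ht.2⟩).trans (le_max_left _ _))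

/-- The discriminant vanishes at most to finite order at `t = 0`. -/
theorem exists_pow_le_disc (hT : 0 < T) (hD : ∀ t ∈ Ioc 0 T, 0 < M.disc t) :
    ∃ (n : ℕ) (c : ℝ), 0 < c ∧ ∀ t ∈ Ioc 0 T, c * t ^ n ≤ M.disc t := by
  obtain ⟨hA, hB, hC⟩ := analyticAt_coeff M
  have han : AnalyticAt ℝ M.disc 0 := by
    have : M.disc = fun t => 4 * M.coeffA t * M.coeffC t - M.coeffB t ^ 2 := rfl
    rw [this]; fun_prop
  -- Positivity to the right of `0` excludes identical vanishing near `0`, so the analytic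
  -- discriminant factors as `tⁿ g(t)` with `g(0) ≠ 0`.
  have hnz : ¬∀ᶠ z in 𝓝 (0 : ℝ), M.disc z = 0 := by
    intro h
    have h1 : ∀ᶠ z in 𝓝[>] (0 : ℝ), M.disc z = 0 := h.filter_mono nhdsWithin_le_nhds
    have h2 : ∀ᶠ z in 𝓝[>] (0 : ℝ), z ∈ Ioc 0 T := Ioc_mem_nhdsGT hT
    obtain ⟨z, hz, hz'⟩ := (h1.and h2).exists
    exact (hD z hz').ne' hz
  obtain ⟨n, g, hg, hg0, hfg⟩ := han.exists_eventuallyEq_pow_smul_nonzero_iff.2 hnz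
  have hev : ∀ᶠ t in 𝓝[>] (0 : ℝ), |g 0| / 2 * t ^ n ≤ M.disc t := by
    have h1 : ∀ᶠ z in 𝓝 (0 : ℝ), |g 0| / 2 < |g z| :=
      (hg.continuousAt.abs).eventually_const_lt (by
        have := abs_pos.2 hg0
        linarith)
    filter_upwards [h1.filter_mono nhdsWithin_le_nhds, hfg.filter_mono nhdsWithin_le_nhds,
      Ioc_mem_nhdsGT hT] with t h1 h2 h3
    have h4 := hD t h3
    have : M.disc t = t ^ n * |g t| := by
      rw [← abs_of_pos h4, h2]
      simp [abs_mul, abs_of_pos h3.1]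
    rw [this, mul_comm]
    have := pow_pos h3.1 n
    nlinarith
  obtain ⟨ε, hε, hev⟩ := mem_nhdsGT_iff_exists_Ioc_subset.1 hev
  obtain ⟨hA, hB, hC⟩ := continuousOn_coeff hD
  have hcont : ContinuousOn M.disc (Icc ε T) := by
    have h : ContinuousOn (fun t => 4 * M.coeffA t * M.coeffC t - M.coeffB t ^ 2) (Icc 0 T) := by
      fun_prop
    exact h.mono (Icc_subset_Icc_left (mem_Ioi.1 hε).le)
  have hε0 : 0 < ε := hε
  obtain ⟨m, hm, hmle⟩ : ∃ m, 0 < m ∧ ∀ t ∈ Icc ε T, m ≤ M.disc t := by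
    rcases (Icc ε T).eq_empty_or_nonempty with h | h
    · exact ⟨1, one_pos, by simp [h]⟩
    · obtain ⟨x, hx, hmin⟩ := isCompact_Icc.exists_isMinOn h hcont
      exact ⟨M.disc x, hD x ⟨hε0.trans_le hx.1, hx.2⟩, hmin⟩
  refine ⟨n, min (|g 0| / 2) (m / T ^ n), lt_min (by positivity) (by positivity), ?_⟩
  intro t ht
  have htn := pow_pos ht.1 n
  rcases le_or_gt t ε with h | h
  · exact (mul_le_mul_of_nonneg_right (min_le_left _ _) htn.le).trans (hev ⟨ht.1, h⟩)
  · refine (mul_le_mul_of_nonneg_right (min_le_right _ _) htn.le).trans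
      (le_trans ?_ (hmle t ⟨h.le, ht.2⟩))
    have : t ^ n ≤ T ^ n := pow_le_pow_left₀ ht.1.le ht.2 n
    rw [div_mul_eq_mul_div, div_le_iff₀ (by positivity)]
    nlinarith

end MasterEquation

end WignerPoisson

namespace WignerPoisson

/-! ### The amalgam weight -/

instance : (volume : Measure Phase).IsAddHaarMeasure :=
  inferInstanceAs ((volume : Measure E3).prod (volume : Measure E3)).IsAddHaarMeasure

instance : (volume : Measure Phase).IsNegInvariant :=
  Measure.IsAddHaarMeasure.isNegInvariant_of_regular _

/-- The weight `(1 + ‖Y‖)⁻⁸` on phase space. -/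
noncomputable def weight (Y : Phase) : ℝ≥0∞ := ENNReal.ofReal ((1 + ‖Y‖) ^ (-8 : ℝ))

/-- The largest weighted mass of `g`; it is dual to an amalgam norm. -/
noncomputable def weightedSup (g : Phase → ℝ≥0∞) : ℝ≥0∞ :=
  ⨆ Y : Phase, ∫⁻ X : Phase, weight (X - Y) * g X

theorem measurable_weight : Measurable weight := by unfold weight; fun_prop

theorem weight_le_one (Y : Phase) : weight Y ≤ 1 := by
  unfold weight
  rw [ENNReal.ofReal_le_one]
  exact Real.rpow_le_one_of_one_le_of_nonpos (by linarith [norm_nonneg Y]) (by norm_num)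

/-- The exponent `8` exceeds the dimension `6` of phase space. -/
theorem lintegral_weight_lt_top : ∫⁻ Y : Phase, weight Y < ∞ := by
  have h : Integrable (fun Y : Phase => (1 + ‖Y‖) ^ (-8 : ℝ)) volume :=
    integrable_one_add_norm (by simp; norm_num)
  exact h.lintegral_lt_top

/-- Here `1 + ‖L Y‖ ≤ 2 (1 + ‖Y‖)`, and `256 = 2⁸`. -/
theorem weight_le_weight_map {L : Phase →L[ℝ] Phase} (hL : ‖L‖ ≤ 2) (Y : Phase) :
    weight Y ≤ 256 * weight (L Y) := by
  have h1 : 1 + ‖L Y‖ ≤ 2 * (1 + ‖Y‖) := by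
    have := L.le_of_opNorm_le hL Y
    linarith [norm_nonneg Y]
  have h2 : (2 * (1 + ‖Y‖)) ^ (-8 : ℝ) ≤ (1 + ‖L Y‖) ^ (-8 : ℝ) :=
    Real.rpow_le_rpow_of_nonpos (by linarith [norm_nonneg (L Y)]) h1 (by norm_num)
  rw [Real.mul_rpow (by norm_num) (by linarith [norm_nonneg Y])] at h2
  have h3 : (2 : ℝ) ^ (-8 : ℝ) = 1 / 256 := by
    rw [Real.rpow_neg (by norm_num)]; norm_num
  rw [h3] at h2
  unfold weight
  rw [show (256 : ℝ≥0∞) = ENNReal.ofReal 256 by simp, ← ENNReal.ofReal_mul (by norm_num)]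
  exact ENNReal.ofReal_le_ofReal (by linarith)

theorem lintegral_weight_sub_mul_le (g : Phase → ℝ≥0∞) (Y : Phase) :
    ∫⁻ X : Phase, weight (X - Y) * g X ≤ weightedSup g :=
  le_iSup (fun Y : Phase => ∫⁻ X : Phase, weight (X - Y) * g X) Y

/-- Convexity gives `(1 + y)⁸ ≤ 2⁷ (1 + y⁸)`, and `y⁸` is controlled by the fourth term of the
series of `e^{c y²}`, whence `24 = 4!`. -/
theorem exp_neg_mul_sq_le_weight {c : ℝ} (hc : 0 < c) (Y : Phase) :
    ENNReal.ofReal (Real.exp (-(c * ‖Y‖ ^ 2))) ≤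
      ENNReal.ofReal (128 * (1 + 24 / c ^ 4)) * weight Y := by
  unfold weight
  rw [← ENNReal.ofReal_mul (by positivity)]
  apply ENNReal.ofReal_le_ofReal
  set y := ‖Y‖
  have hy : 0 ≤ y := norm_nonneg Y
  rw [Real.rpow_neg (by positivity), Real.exp_neg,
    show (1 + y) ^ (8 : ℝ) = (1 + y) ^ (8 : ℕ) from by exact_mod_cast Real.rpow_natCast (1 + y) 8,
    ← div_eq_mul_inv, inv_eq_one_div, div_le_div_iff₀ (Real.exp_pos _) (by positivity), one_mul]
  have h1 : (1 + y) ^ 8 ≤ 128 * (1 + y ^ 8) := by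
    have := add_pow_le (zero_le_one) hy 8
    norm_num at this
    linarith
  have h2 := Real.pow_div_factorial_le_exp (c * y ^ 2) (by positivity) 4
  have h3 := Real.one_le_exp (show 0 ≤ c * y ^ 2 by positivity)
  have h4 : y ^ 8 = 24 / c ^ 4 * ((c * y ^ 2) ^ 4 / (Nat.factorial 4 : ℕ)) := by
    norm_num [Nat.factorial]; field_simp
  have h5 : y ^ 8 ≤ 24 / c ^ 4 * Real.exp (c * y ^ 2) := by
    rw [h4]; gcongr
  nlinarith

theorem lintegral_exp_neg_mul_sq_norm {b : ℝ} (hb : 0 < b) (x₀ : E3) :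
    ∫⁻ x : E3, ENNReal.ofReal (Real.exp (-b * ‖x - x₀‖ ^ 2)) =
      ENNReal.ofReal ((Real.pi / b) ^ (3 / 2 : ℝ)) := by
  rw [lintegral_sub_right_eq_self (fun x : E3 => ENNReal.ofReal (Real.exp (-b * ‖x‖ ^ 2)))]
  have hint := GaussianFourier.integral_rexp_neg_mul_sq_norm (V := E3) hb
  rw [← ofReal_integral_eq_lintegral_ofReal, hint]
  · simp
  -- A non-integrable function would have integral `0`, whereas the known value of the Gaussian
  -- integral is positive.
  · by_contra h
    rw [integral_undef h] at hint
    have : 0 < (Real.pi / b) ^ ((Module.finrank ℝ E3 : ℝ) / 2) := by positivity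
    exact this.ne hint
  · exact Eventually.of_forall fun x => (Real.exp_pos _).le

namespace MasterEquation

variable {M : MasterEquation} {T : ℝ}

/-! ### The Gaussian and the flow -/

/-- The Gaussian `G₀(t)` as a function on phase space. -/
noncomputable def gauss (M : MasterEquation) (t : ℝ) (Y : Phase) : ℝ := M.gaussian t Y.1 Y.2

/-- The linear flow `(z, v) ↦ (κ z + ν v, kappaTilde z + nuTilde v)`. -/
noncomputable def flow (M : MasterEquation) (t : ℝ) : Phase →L[ℝ] Phase :=
  (M.kappa t • ContinuousLinearMap.fst ℝ E3 E3 + M.nu t • ContinuousLinearMap.snd ℝ E3 E3).prod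
    (M.kappaTilde t • ContinuousLinearMap.fst ℝ E3 E3 +
      M.nuTilde t • ContinuousLinearMap.snd ℝ E3 E3)

theorem propagator_eq (M : MasterEquation) (t : ℝ) (X Z : Phase) :
    M.propagator t X Z = M.gauss t (X - M.flow t Z) := by
  simp [propagator, gauss, flow, sub_sub, add_comm]

/-- With this identity `a = C/D`, `b = B/D`, `c = A/D`: the exponent is the inverse quadratic form,
without fractional powers. -/
theorem gaussD_rpow {t : ℝ} (h : 0 < M.disc t) :
    4 * Real.pi ^ 2 * M.gaussD t ^ (2 / 3 : ℝ) = 1 / M.disc t := by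
  have hpi := Real.pi_pos
  unfold gaussD
  rw [Real.mul_rpow (by positivity) (by positivity), ← Real.rpow_mul h.le,
    Real.div_rpow (by norm_num) (by positivity), Real.one_rpow,
    ← Real.rpow_natCast (2 * Real.pi) 3, ← Real.rpow_mul (by positivity)]
  norm_num
  rw [Real.rpow_neg_one]
  field_simp
  ring

theorem gaussD_pos {t : ℝ} (h : 0 < M.disc t) : 0 < M.gaussD t := by
  have hpi := Real.pi_pos
  unfold gaussD; positivity

theorem gaussian_eq {t : ℝ} (h : 0 < M.disc t) (x ξ : E3) :
    M.gaussian t x ξ = M.gaussD t * Real.exp (-(1 / M.disc t *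
      (M.coeffC t * ‖x‖ ^ 2 - M.coeffB t * inner ℝ x ξ + M.coeffA t * ‖ξ‖ ^ 2))) := by
  unfold gaussian gaussA gaussB gaussC
  rw [gaussD_rpow h]
  congr 2
  ring

theorem gauss_nonneg {t : ℝ} (h : 0 < M.disc t) (Y : Phase) : 0 ≤ M.gauss t Y :=
  mul_nonneg (gaussD_pos h).le (Real.exp_pos _).le

/-- The quadratic form of the Gaussian is bounded below by determinant over trace. -/
theorem quadratic_lower (hD : ∀ t ∈ Ioc 0 T, 0 < M.disc t) {t : ℝ} (ht : t ∈ Ioc 0 T) {K : ℝ}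
    (hK : M.coeffA t + M.coeffC t ≤ K) (x ξ : E3) :
    1 / (4 * K) * (‖x‖ ^ 2 + ‖ξ‖ ^ 2) ≤ 1 / M.disc t *
      (M.coeffC t * ‖x‖ ^ 2 - M.coeffB t * inner ℝ x ξ + M.coeffA t * ‖ξ‖ ^ 2) := by
  have hd := hD t ht
  have hA := coeffA_pos hD ht
  have hC := coeffC_pos hD ht
  set A := M.coeffA t
  set B := M.coeffB t
  set C := M.coeffC t
  have hdef : M.disc t = 4 * A * C - B ^ 2 := rfl
  rw [hdef] at hd ⊢
  have h1 : 1 / (4 * K) * (‖x‖ ^ 2 + ‖ξ‖ ^ 2) ≤ 1 / (4 * (A + C)) * (‖x‖ ^ 2 + ‖ξ‖ ^ 2) := by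
    gcongr
  refine h1.trans ?_
  have hcs := abs_real_inner_le_norm x ξ
  set p := ‖x‖
  set q := ‖ξ‖
  have hp : 0 ≤ p := norm_nonneg _
  have hq : 0 ≤ q := norm_nonneg _
  set i := inner ℝ x ξ
  have hBi : B * i ≤ |B| * (p * q) :=
    (le_abs_self _).trans (by rw [abs_mul]; gcongr)
  rw [div_mul_eq_mul_div, div_mul_eq_mul_div, div_le_div_iff₀ (by positivity) hd, one_mul, one_mul]
  have h2 : B ^ 2 = |B| ^ 2 := (sq_abs B).symm
  rw [h2]
  have hB := abs_nonneg B
  -- With `B i` replaced by its upper bound `|B| p q`, the difference of the two sides is exactly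
  -- the sum of these two squares.
  nlinarith [sq_nonneg (2 * C * p - |B| * q), sq_nonneg (2 * A * q - |B| * p),
    mul_le_mul_of_nonneg_left hBi (by positivity : 0 ≤ 4 * (A + C))]

theorem gauss_le_exp (hD : ∀ t ∈ Ioc 0 T, 0 < M.disc t) {t : ℝ} (ht : t ∈ Ioc 0 T) {K : ℝ}
    (hK0 : 0 < K) (hK : M.coeffA t + M.coeffC t ≤ K) (Y : Phase) :
    M.gauss t Y ≤ M.gaussD t * Real.exp (-(1 / (4 * K) * ‖Y‖ ^ 2)) := by
  unfold gauss
  rw [gaussian_eq (hD t ht)]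
  have h0 := (gaussD_pos (hD t ht)).le
  have h1 := quadratic_lower hD ht hK Y.1 Y.2
  have h2 : ‖Y‖ ^ 2 ≤ ‖Y.1‖ ^ 2 + ‖Y.2‖ ^ 2 := by
    rw [Prod.norm_def]
    rcases max_cases ‖Y.1‖ ‖Y.2‖ with h | h <;> rw [h.1] <;>
      nlinarith [sq_nonneg ‖Y.1‖, sq_nonneg ‖Y.2‖]
  refine mul_le_mul_of_nonneg_left (Real.exp_le_exp.2 (neg_le_neg (le_trans ?_ h1))) h0
  gcongr

/-- The power `-3/2` is traded for the integer power `-2`, so that the lower bound `c tⁿ` of the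
discriminant can be inserted; the `1` covers large discriminants. -/
theorem gaussD_le {t : ℝ} (h : 0 < M.disc t) : M.gaussD t ≤ 1 + (M.disc t ^ 2)⁻¹ := by
  have hpi := Real.pi_gt_three
  unfold gaussD
  have h1 : 1 / (2 * Real.pi) ^ 3 ≤ 1 := by
    rw [div_le_one (by positivity)]
    exact one_le_pow₀ (by linarith)
  have h2 : M.disc t ^ (-(3 / 2) : ℝ) ≤ 1 + (M.disc t ^ 2)⁻¹ := by
    have h4 : (0 : ℝ) < (M.disc t ^ 2)⁻¹ := by positivity
    rcases le_or_gt 1 (M.disc t) with h3 | h3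
    · have := Real.rpow_le_one_of_one_le_of_nonpos h3 (show (-(3 / 2) : ℝ) ≤ 0 by norm_num)
      linarith
    · have := Real.rpow_le_rpow_of_exponent_ge h h3.le (show (-2 : ℝ) ≤ -(3 / 2) by norm_num)
      rw [Real.rpow_neg h.le 2] at this
      norm_cast at this
      linarith
  calc _ ≤ 1 * M.disc t ^ (-(3 / 2) : ℝ) := by gcongr
    _ ≤ _ := by rw [one_mul]; exact h2

/-- Near the initial time the propagator is singular at most like a power of time. -/
theorem exists_gauss_le_weight (hT : 0 < T) (hD : ∀ t ∈ Ioc 0 T, 0 < M.disc t) :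
    ∃ (N : ℕ) (c : ℝ), 0 < c ∧ ∀ t ∈ Ioc 0 T, ∀ Y,
      ENNReal.ofReal (M.gauss t Y) ≤ ENNReal.ofReal (c / t ^ N) * weight Y := by
  obtain ⟨n, c, hc, hcD⟩ := exists_pow_le_disc hT hD
  obtain ⟨K, hK0, hK⟩ := exists_coeff_add_le hD
  set c₁ := 128 * (1 + 24 / (1 / (4 * K)) ^ 4) with hc₁
  refine ⟨n * 2, (T ^ (n * 2) + (c ^ 2)⁻¹) * c₁, by positivity, fun t ht Y => ?_⟩
  have hd := hD t ht
  have ht0 := ht.1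
  have h1 : M.gaussD t ≤ (T ^ (n * 2) + (c ^ 2)⁻¹) / t ^ (n * 2) := by
    refine (gaussD_le hd).trans ?_
    rw [add_div]
    gcongr
    · rw [le_div_iff₀ (by positivity), one_mul]
      exact pow_le_pow_left₀ ht0.le ht.2 _
    · rw [inv_eq_one_div, inv_eq_one_div, div_div]
      apply one_div_le_one_div_of_le (by positivity)
      have := pow_le_pow_left₀ (by positivity) (hcD t ht) 2
      rwa [mul_pow, ← pow_mul] at this
  calc ENNReal.ofReal (M.gauss t Y)
      ≤ ENNReal.ofReal (M.gaussD t * Real.exp (-(1 / (4 * K) * ‖Y‖ ^ 2))) :=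
        ENNReal.ofReal_le_ofReal (gauss_le_exp hD ht hK0 (hK t ht) Y)
    _ ≤ ENNReal.ofReal (M.gaussD t) * (ENNReal.ofReal c₁ * weight Y) := by
        rw [ENNReal.ofReal_mul (gaussD_pos hd).le]
        gcongr
        exact exp_neg_mul_sq_le_weight (by positivity) Y
    _ ≤ ENNReal.ofReal ((T ^ (n * 2) + (c ^ 2)⁻¹) / t ^ (n * 2)) *
          (ENNReal.ofReal c₁ * weight Y) := by gcongr
    _ = _ := by
        rw [← mul_assoc, ← ENNReal.ofReal_mul (by positivity)]
        congr 2
        ring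

theorem measurable_coeff (M : MasterEquation) :
    Measurable M.coeffA ∧ Measurable M.coeffB ∧ Measurable M.coeffC := by
  cases M with
  | unruhZurek γ Γ hγ hΓ =>
    refine ⟨?_, ?_, ?_⟩
    · change Measurable (fun t : ℝ => 2 / Real.pi * uzI γ Γ * uzF₁ γ t)
      unfold uzF₁; fun_prop
    · change Measurable (fun t : ℝ => -(2 / Real.pi * uzI γ Γ * uzF₂ γ t))
      unfold uzF₂; fun_prop
    · change Measurable (fun t : ℝ =>
        2 * γ / Real.pi * uzI γ Γ * Real.exp (-4 * γ * t) * (Real.exp (2 * γ * t) - 1) ^ 2)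
      fun_prop
  | huPazZhang δ Γ Ω β hδ hΓ hΩ hβ =>
    refine ⟨?_, ?_, ?_⟩
    · change Measurable (fun t : ℝ =>
        δ * Real.pi * Γ / (2 * β) * t ^ 4 * (hpzFA δ Γ Ω t / hpzChi δ Γ t))
      unfold hpzFA hpzChi; fun_prop
    · change Measurable (fun t : ℝ =>
        δ * Real.pi * Γ / (2 * β) * t ^ 3 * (hpzFB δ Γ Ω t / hpzChi δ Γ t))
      unfold hpzFB hpzChi; fun_prop
    · change Measurable (fun t : ℝ =>
        δ * Real.pi * Γ / (2 * β) * t ^ 2 * (hpzFC δ Γ Ω t / hpzChi δ Γ t))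
      unfold hpzFC hpzChi; fun_prop

theorem continuous_flow_coeff (M : MasterEquation) :
    Continuous M.kappa ∧ Continuous M.nu ∧ Continuous M.kappaTilde ∧ Continuous M.nuTilde := by
  cases M with
  | unruhZurek γ Γ hγ hΓ =>
    refine ⟨?_, ?_, ?_, ?_⟩
    · exact continuous_const (y := (1 : ℝ))
    · change Continuous (fun t : ℝ => 1 / (2 * γ) * (1 - Real.exp (-2 * γ * t)))
      fun_prop
    · exact continuous_const (y := (0 : ℝ))
    · change Continuous (fun t : ℝ => Real.exp (-2 * γ * t))
      fun_prop
  | huPazZhang δ Γ Ω β hδ hΓ hΩ hβ =>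
    refine ⟨?_, ?_, ?_, ?_⟩
    · change Continuous (fun t : ℝ => 1 - Ω ^ 2 / 2 * t ^ 2 +
        δ * Real.pi * Γ ^ 2 / 6 * t ^ 3 - δ * Real.pi * Γ ^ 3 / 24 * t ^ 4)
      fun_prop
    · change Continuous (fun t : ℝ => t - Ω ^ 2 / 6 * t ^ 3 +
        δ * Real.pi * Γ ^ 2 / 24 * t ^ 4 - δ * Real.pi * Γ ^ 3 / 120 * t ^ 5)
      fun_prop
    · change Continuous (fun t : ℝ => -Ω ^ 2 * t +
        δ * Real.pi * Γ ^ 2 / 2 * t ^ 2 - δ * Real.pi * Γ ^ 3 / 6 * t ^ 3)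
      fun_prop
    · change Continuous (fun t : ℝ => 1 - Ω ^ 2 / 2 * t ^ 2 +
        δ * Real.pi * Γ ^ 2 / 6 * t ^ 3 - δ * Real.pi * Γ ^ 3 / 24 * t ^ 4)
      fun_prop

theorem measurable_propagator (M : MasterEquation) :
    Measurable fun p : ℝ × Phase × Phase => M.propagator p.1 p.2.1 p.2.2 := by
  obtain ⟨hA, hB, hC⟩ := measurable_coeff M
  obtain ⟨h1, h2, h3, h4⟩ := continuous_flow_coeff M
  have hd : Measurable M.disc := by
    change Measurable fun t => 4 * M.coeffA t * M.coeffC t - M.coeffB t ^ 2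
    fun_prop
  unfold propagator gaussian gaussA gaussB gaussC gaussD
  fun_prop

theorem continuous_flow (M : MasterEquation) : Continuous M.flow := by
  obtain ⟨h1, h2, h3, h4⟩ := continuous_flow_coeff M
  have : M.flow = fun t => (ContinuousLinearMap.inl ℝ E3 E3).comp (M.kappa t •
      ContinuousLinearMap.fst ℝ E3 E3 + M.nu t • ContinuousLinearMap.snd ℝ E3 E3) +
      (ContinuousLinearMap.inr ℝ E3 E3).comp (M.kappaTilde t • ContinuousLinearMap.fst ℝ E3 E3 +
      M.nuTilde t • ContinuousLinearMap.snd ℝ E3 E3) := by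
    funext t
    ext Z <;> simp [flow]
  rw [this]
  fun_prop

theorem flow_zero (M : MasterEquation) : M.flow 0 = ContinuousLinearMap.id ℝ Phase := by
  cases M <;> ext Z <;> simp [flow, kappa, nu, kappaTilde, nuTilde]

/-- The flow is continuous in time and starts at the identity. Only short times are claimed; at
later times the Gaussian bound is no longer singular and the Jacobian is not needed. -/
theorem exists_flow_near_id (M : MasterEquation) :
    ∃ r₀ : ℝ, 0 < r₀ ∧ ∀ r ∈ Icc 0 r₀, ‖M.flow r‖ ≤ 2 ∧ 1 / 2 ≤ |(M.flow r).det| := by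
  have h1 : ∀ᶠ r in 𝓝 (0 : ℝ), ‖M.flow r‖ < 2 := by
    refine (M.continuous_flow.norm.tendsto 0).eventually_lt_const ?_
    rw [flow_zero]
    exact (ContinuousLinearMap.norm_id_le).trans_lt (by norm_num)
  have h2 : ∀ᶠ r in 𝓝 (0 : ℝ), 1 / 2 < |(M.flow r).det| := by
    have hc : Continuous fun r => |(M.flow r).det| :=
      (ContinuousLinearMap.continuous_det.comp M.continuous_flow).abs
    refine (hc.tendsto 0).eventually_const_lt ?_
    rw [flow_zero]
    norm_num [ContinuousLinearMap.det]
  obtain ⟨ε, hε, h⟩ := Metric.eventually_nhds_iff.1 (h1.and h2)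
  refine ⟨ε / 2, by positivity, fun r hr => ?_⟩
  have := h (y := r) (by rw [Real.dist_eq, sub_zero, abs_of_nonneg hr.1]; linarith [hr.2])
  exact ⟨this.1.le, this.2.le⟩

theorem measurable_gauss (M : MasterEquation) (t : ℝ) : Measurable (M.gauss t) := by
  unfold gauss gaussian
  fun_prop

theorem lintegral_gauss (hD : ∀ t ∈ Ioc 0 T, 0 < M.disc t) {t : ℝ} (ht : t ∈ Ioc 0 T) :
    ∫⁻ Y : Phase, ENNReal.ofReal (M.gauss t Y) = 1 := by
  have hd := hD t ht
  have hC := coeffC_pos hD ht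
  have hpi := Real.pi_pos
  set A := M.coeffA t with hA'
  set B := M.coeffB t with hB'
  set C := M.coeffC t with hC'
  set D := M.disc t with hD'
  have hdef : D = 4 * A * C - B ^ 2 := rfl
  -- Completing the square in `x` leaves the factor `e^{-|ξ|²/(4C)}`, because `A - B²/(4C) =
  -- D/(4C)`.
  have hsq : ∀ x ξ : E3, M.gauss t (x, ξ) = M.gaussD t *
      (Real.exp (-(C / D) * ‖x - (B / (2 * C)) • ξ‖ ^ 2) *
        Real.exp (-(1 / (4 * C)) * ‖ξ - 0‖ ^ 2)) := by
    intro x ξ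
    unfold gauss
    rw [gaussian_eq hd, ← Real.exp_add, norm_sub_sq_real, norm_smul, inner_smul_right, mul_pow,
      Real.norm_eq_abs, sq_abs, sub_zero]
    congr 2
    simp only [← hA', ← hB', ← hC', ← hD']
    have h4 : A = (D + B ^ 2) / (4 * C) := by rw [hdef]; field_simp; ring
    rw [h4]
    field_simp
    ring
  rw [Measure.volume_eq_prod, lintegral_prod_symm _
    (M.measurable_gauss t).ennreal_ofReal.aemeasurable]
  simp_rw [hsq, ENNReal.ofReal_mul (gaussD_pos hd).le, ENNReal.ofReal_mul (Real.exp_pos _).le]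
  have h1 : ∀ ξ : E3, ∫⁻ x : E3, ENNReal.ofReal (M.gaussD t) *
      (ENNReal.ofReal (Real.exp (-(C / D) * ‖x - (B / (2 * C)) • ξ‖ ^ 2)) *
        ENNReal.ofReal (Real.exp (-(1 / (4 * C)) * ‖ξ - 0‖ ^ 2))) =
      ENNReal.ofReal (M.gaussD t) * ENNReal.ofReal ((Real.pi / (C / D)) ^ (3 / 2 : ℝ)) *
        ENNReal.ofReal (Real.exp (-(1 / (4 * C)) * ‖ξ - 0‖ ^ 2)) := by
    intro ξ
    rw [lintegral_const_mul _ (by fun_prop), lintegral_mul_const _ (by fun_prop),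
      lintegral_exp_neg_mul_sq_norm (by positivity), mul_assoc]
  simp_rw [h1]
  rw [lintegral_const_mul _ (by fun_prop), lintegral_exp_neg_mul_sq_norm (by positivity),
    ← ENNReal.ofReal_mul (gaussD_pos hd).le, ← ENNReal.ofReal_mul
      (mul_nonneg (gaussD_pos hd).le (by positivity)), ENNReal.ofReal_eq_one, mul_assoc,
    ← Real.mul_rpow (by positivity) (by positivity)]
  unfold gaussD
  rw [← hD', show Real.pi / (C / D) * (Real.pi / (1 / (4 * C))) = (2 * Real.pi) ^ 2 * D by
    field_simp; ring, Real.mul_rpow (by positivity) hd.le, ← Real.rpow_natCast (2 * Real.pi) 2,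
    ← Real.rpow_mul (by positivity), Real.rpow_neg hd.le]
  norm_num
  have h3 : (2 * Real.pi) ^ (3 : ℝ) = (2 * Real.pi) ^ 3 := by
    exact_mod_cast Real.rpow_natCast (2 * Real.pi) 3
  have h5 : 0 < D ^ (3 / 2 : ℝ) := by positivity
  try rw [h3]
  field_simp

end MasterEquation

end WignerPoisson

namespace WignerPoisson

namespace MasterEquation

variable {M : MasterEquation} {T : ℝ}

/-! ### The adjoint propagator -/

/-- The adjoint propagator acting on a nonnegative function. -/
noncomputable def backProp (M : MasterEquation) (r : ℝ) (g : Phase → ℝ≥0∞) (Z : Phase) : ℝ≥0∞ :=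
  ∫⁻ X : Phase, ENNReal.ofReal (M.propagator r X Z) * g X

theorem measurable_propagator_prod (M : MasterEquation) (r : ℝ) :
    Measurable fun p : Phase × Phase => M.propagator r p.1 p.2 :=
  Measurable.comp (f := fun p : Phase × Phase => (r, p)) M.measurable_propagator (by fun_prop)

theorem measurable_backProp (M : MasterEquation) (r : ℝ) {g : Phase → ℝ≥0∞} (hg : Measurable g) :
    Measurable (M.backProp r g) := by
  refine Measurable.lintegral_prod_right'
    (f := fun p : Phase × Phase => ENNReal.ofReal (M.propagator r p.2 p.1) * g p.2) ?_
  exact ((M.measurable_propagator_prod r).comp measurable_swap).ennreal_ofReal.mul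
    (hg.comp measurable_snd)

theorem lintegral_propagator_left (hD : ∀ t ∈ Ioc 0 T, 0 < M.disc t) {r : ℝ} (hr : r ∈ Ioc 0 T)
    (Z : Phase) : ∫⁻ X : Phase, ENNReal.ofReal (M.propagator r X Z) = 1 := by
  simp_rw [propagator_eq]
  rw [lintegral_sub_right_eq_self (fun X : Phase => ENNReal.ofReal (M.gauss r X))]
  exact lintegral_gauss hD hr

/-- The propagator has mass one in its target variable, so its adjoint does not increase the
supremum. -/
theorem backProp_le_of_le (hD : ∀ t ∈ Ioc 0 T, 0 < M.disc t) {r : ℝ} (hr : r ∈ Ioc 0 T)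
    {g : Phase → ℝ≥0∞} {Λ : ℝ≥0∞} (hg : ∀ X, g X ≤ Λ) (Z : Phase) : M.backProp r g Z ≤ Λ :=
  calc M.backProp r g Z ≤ ∫⁻ X : Phase, ENNReal.ofReal (M.propagator r X Z) * Λ :=
        lintegral_mono fun X => by gcongr; exact hg X
    _ = Λ := by
        rw [lintegral_mul_const, lintegral_propagator_left hD hr, one_mul]
        exact ((M.measurable_propagator_prod r).comp measurable_prodMk_right).ennreal_ofReal

/-- This is the smoothing estimate: a bound of the Gaussian by a multiple of the weight sends the
seminorm to the sup norm, the centre of the weight being the image of the source point under the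
flow. -/
theorem backProp_le_weightedSup {r c : ℝ}
    (h : ∀ Y, ENNReal.ofReal (M.gauss r Y) ≤ ENNReal.ofReal c * weight Y)
    (g : Phase → ℝ≥0∞) (Z : Phase) :
    M.backProp r g Z ≤ ENNReal.ofReal c * weightedSup g :=
  calc M.backProp r g Z ≤ ∫⁻ X : Phase, ENNReal.ofReal c * (weight (X - M.flow r Z) * g X) :=
        lintegral_mono fun X => by
          rw [propagator_eq, ← mul_assoc]; gcongr; exact h _
    _ = ENNReal.ofReal c * ∫⁻ X : Phase, weight (X - M.flow r Z) * g X :=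
        lintegral_const_mul' _ _ ENNReal.ofReal_ne_top
    _ ≤ _ := by gcongr; exact lintegral_weight_sub_mul_le g _

theorem lintegral_comp_flow {r : ℝ} (hdet : 1 / 2 ≤ |(M.flow r).det|) {f : Phase → ℝ≥0∞}
    (hf : Measurable f) : ∫⁻ Z : Phase, f (M.flow r Z) ≤ 2 * ∫⁻ Z : Phase, f Z := by
  have hne : LinearMap.det (M.flow r : Phase →ₗ[ℝ] Phase) ≠ 0 := by
    intro h
    have : (M.flow r).det = 0 := h
    rw [this] at hdet
    norm_num at hdet
  have hmap := Measure.map_linearMap_addHaar_eq_smul_addHaar (volume : Measure Phase) hne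
  calc ∫⁻ Z : Phase, f (M.flow r Z)
      = ∫⁻ Z, f Z ∂(Measure.map (M.flow r : Phase →ₗ[ℝ] Phase) volume) :=
        (lintegral_map hf (M.flow r).continuous.measurable).symm
    _ = ENNReal.ofReal |((M.flow r).det)⁻¹| * ∫⁻ Z : Phase, f Z := by
        rw [hmap, lintegral_smul_measure]; rfl
    _ ≤ 2 * ∫⁻ Z : Phase, f Z := by
        gcongr
        refine (ENNReal.ofReal_le_ofReal (q := 2) ?_).trans_eq (by simp)
        rw [abs_inv, show (2 : ℝ) = (1 / 2)⁻¹ by norm_num]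
        exact inv_anti₀ (by norm_num) hdet

/-- For short times the propagator is almost mass preserving in its source variable. -/
theorem lintegral_propagator_right (hD : ∀ t ∈ Ioc 0 T, 0 < M.disc t) {r : ℝ} (hr : r ∈ Ioc 0 T)
    (hdet : 1 / 2 ≤ |(M.flow r).det|) (X : Phase) :
    ∫⁻ Z : Phase, ENNReal.ofReal (M.propagator r X Z) ≤ 2 := by
  simp_rw [propagator_eq]
  refine (lintegral_comp_flow hdet (f := fun Z => ENNReal.ofReal (M.gauss r (X - Z)))
    (((M.measurable_gauss r).comp (measurable_const.sub measurable_id)).ennreal_ofReal)).trans ?_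
  rw [lintegral_sub_left_eq_self (fun Z : Phase => ENNReal.ofReal (M.gauss r Z)),
    lintegral_gauss hD hr, mul_one]

/-- Comparing the weight at `Z` with the weight at its image costs `256`, and the change of
variables by the flow costs `2`. What remains is an average of translates against a Gaussian of mass
one, and the seminorm is translation invariant. Hence the constant `512` does not depend on `r`,
however singular the Gaussian is. -/
theorem weightedSup_backProp_le_of_near (hD : ∀ t ∈ Ioc 0 T, 0 < M.disc t) {r : ℝ}
    (hr : r ∈ Ioc 0 T) (hdet : 1 / 2 ≤ |(M.flow r).det|) (hnorm : ‖M.flow r‖ ≤ 2)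
    {g : Phase → ℝ≥0∞} (hg : Measurable g) :
    weightedSup (M.backProp r g) ≤ 512 * weightedSup g := by
  refine iSup_le fun Y => ?_
  have hmw : Measurable weight := measurable_weight
  have hmg : Measurable (M.gauss r) := M.measurable_gauss r
  have hswap : ∫⁻ Z : Phase, weight (Z - Y) * M.backProp r g Z =
      ∫⁻ X : Phase, g X * ∫⁻ Z : Phase, weight (Z - Y) *
        ENNReal.ofReal (M.gauss r (X - M.flow r Z)) := by
    have : ∀ Z, weight (Z - Y) * M.backProp r g Z = ∫⁻ X : Phase,
        g X * (weight (Z - Y) * ENNReal.ofReal (M.gauss r (X - M.flow r Z))) := by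
      intro Z
      unfold backProp
      rw [← lintegral_const_mul']
      · congr 1 with X
        rw [propagator_eq]; ring
      · exact ((weight_le_one _).trans_lt ENNReal.one_lt_top).ne
    simp_rw [this]
    rw [lintegral_lintegral_swap]
    · congr 1 with X
      rw [lintegral_const_mul]
      fun_prop
    · apply Measurable.aemeasurable
      have := (M.flow r).continuous.measurable
      simp only [Function.uncurry_def]
      fun_prop
  rw [hswap]
  have hinner : ∀ X, ∫⁻ Z : Phase, weight (Z - Y) *
      ENNReal.ofReal (M.gauss r (X - M.flow r Z)) ≤
      512 * ∫⁻ U : Phase, weight (X - U - M.flow r Y) * ENNReal.ofReal (M.gauss r U) := by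
    intro X
    calc ∫⁻ Z : Phase, weight (Z - Y) * ENNReal.ofReal (M.gauss r (X - M.flow r Z))
        ≤ ∫⁻ Z : Phase, 256 * (weight (M.flow r Z - M.flow r Y) *
            ENNReal.ofReal (M.gauss r (X - M.flow r Z))) := lintegral_mono fun Z => by
          rw [← mul_assoc, ← map_sub]; gcongr; exact weight_le_weight_map hnorm _
      _ = 256 * ∫⁻ Z : Phase, (weight (M.flow r Z - M.flow r Y) *
            ENNReal.ofReal (M.gauss r (X - M.flow r Z))) :=
          lintegral_const_mul' _ _ (by simp)
      _ ≤ 256 * (2 * ∫⁻ W : Phase, weight (W - M.flow r Y) *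
            ENNReal.ofReal (M.gauss r (X - W))) := by
          gcongr
          exact lintegral_comp_flow hdet (f := fun W => weight (W - M.flow r Y) *
            ENNReal.ofReal (M.gauss r (X - W))) (by fun_prop)
      _ = _ := by
          rw [← mul_assoc, ← lintegral_sub_left_eq_self _ X]
          simp only [sub_sub_cancel]
          norm_num
  calc ∫⁻ X : Phase, g X * ∫⁻ Z : Phase, weight (Z - Y) *
        ENNReal.ofReal (M.gauss r (X - M.flow r Z))
      ≤ ∫⁻ X : Phase, g X * (512 * ∫⁻ U : Phase, weight (X - U - M.flow r Y) *
          ENNReal.ofReal (M.gauss r U)) := lintegral_mono fun X => by gcongr; exact hinner X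
    _ = ∫⁻ X : Phase, ∫⁻ U : Phase, 512 * (ENNReal.ofReal (M.gauss r U) *
          (weight (X - (U + M.flow r Y)) * g X)) := by
        congr 1 with X
        rw [mul_left_comm, lintegral_const_mul' _ _ (by simp), ← lintegral_const_mul]
        · congr 2 with U
          rw [sub_sub]; ring
        · fun_prop
    _ = ∫⁻ U : Phase, 512 * (ENNReal.ofReal (M.gauss r U) *
          ∫⁻ X : Phase, weight (X - (U + M.flow r Y)) * g X) := by
        rw [lintegral_lintegral_swap]
        · congr 1 with U
          rw [lintegral_const_mul' _ _ (by simp), lintegral_const_mul' _ _ ENNReal.ofReal_ne_top]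
        · apply Measurable.aemeasurable
          simp only [Function.uncurry_def]
          fun_prop
    _ ≤ ∫⁻ U : Phase, 512 * (ENNReal.ofReal (M.gauss r U) * weightedSup g) :=
        lintegral_mono fun U => by
          gcongr; exact lintegral_weight_sub_mul_le g _
    _ = 512 * weightedSup g := by
        rw [lintegral_const_mul' _ _ (by simp), lintegral_mul_const _ (by fun_prop),
          lintegral_gauss hD hr, one_mul]

/-- The adjoint propagator is bounded for the amalgam seminorm, uniformly on `(0, T]`. -/
theorem exists_weightedSup_backProp_le (hT : 0 < T) (hD : ∀ t ∈ Ioc 0 T, 0 < M.disc t) :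
    ∃ C : ℝ, 1 ≤ C ∧ ∀ r ∈ Ioc 0 T, ∀ g : Phase → ℝ≥0∞, Measurable g →
      weightedSup (M.backProp r g) ≤ ENNReal.ofReal C * weightedSup g := by
  obtain ⟨N, c, hc, hG⟩ := exists_gauss_le_weight hT hD
  obtain ⟨r₀, hr₀, hflow⟩ := M.exists_flow_near_id
  set w := (∫⁻ Y : Phase, weight Y).toReal with hw
  have hw' : ∫⁻ Y : Phase, weight Y = ENNReal.ofReal w :=
    (ENNReal.ofReal_toReal lintegral_weight_lt_top.ne).symm
  have hw0 : 0 ≤ w := ENNReal.toReal_nonneg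
  refine ⟨512 + w * (c / r₀ ^ N), ?_, fun r hr g hg => ?_⟩
  · have : 0 ≤ w * (c / r₀ ^ N) := by positivity
    linarith
  -- Near time zero the flow is close to the identity. Later the Gaussian is at most `c/r₀ᴺ` times
  -- the weight, and integrating the outer weight suffices even if the flow degenerates.
  rcases le_or_gt r r₀ with h | h
  · obtain ⟨h1, h2⟩ := hflow r ⟨hr.1.le, h⟩
    refine (weightedSup_backProp_le_of_near hD hr h2 h1 hg).trans ?_
    gcongr
    rw [show (512 : ℝ≥0∞) = ENNReal.ofReal 512 by simp]
    apply ENNReal.ofReal_le_ofReal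
    have : 0 ≤ w * (c / r₀ ^ N) := by positivity
    linarith
  · refine iSup_le fun Y => ?_
    calc ∫⁻ Z : Phase, weight (Z - Y) * M.backProp r g Z
        ≤ ∫⁻ Z : Phase, weight (Z - Y) * (ENNReal.ofReal (c / r ^ N) * weightedSup g) :=
          lintegral_mono fun Z => by
            gcongr; exact backProp_le_weightedSup (hG r hr) g Z
      _ = ENNReal.ofReal w * (ENNReal.ofReal (c / r ^ N) * weightedSup g) := by
          rw [lintegral_mul_const _ (by have := measurable_weight; fun_prop),
            lintegral_sub_right_eq_self weight, hw']
      _ ≤ ENNReal.ofReal (512 + w * (c / r₀ ^ N)) * weightedSup g := by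
          rw [← mul_assoc, ← ENNReal.ofReal_mul hw0]
          gcongr
          have : w * (c / r ^ N) ≤ w * (c / r₀ ^ N) := by gcongr
          linarith

end MasterEquation

/-! ### Convolution in the momentum variable -/

/-- The adjoint of the convolution with `K` in the momentum variable. -/
noncomputable def momentumConv (K : E3 → ℝ≥0∞) (h : Phase → ℝ≥0∞) (X : Phase) : ℝ≥0∞ :=
  ∫⁻ ζ : E3, K ζ * h (X.1, X.2 + ζ)

theorem measurable_momentumConv {K : E3 → ℝ≥0∞} (hK : Measurable K) {h : Phase → ℝ≥0∞}
    (hh : Measurable h) : Measurable (momentumConv K h) := by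
  refine Measurable.lintegral_prod_right'
    (f := fun p : Phase × E3 => K p.2 * h (p.1.1, p.1.2 + p.2)) ?_
  fun_prop

theorem momentumConv_le_of_le {K : E3 → ℝ≥0∞} (hK : Measurable K) {h : Phase → ℝ≥0∞} {Λ : ℝ≥0∞}
    (hh : ∀ X, h X ≤ Λ) (X : Phase) : momentumConv K h X ≤ (∫⁻ ζ, K ζ) * Λ := by
  rw [← lintegral_mul_const _ hK]
  exact lintegral_mono fun ζ => by gcongr; exact hh _

/-- The convolution is an average of momentum translates with total mass `∫ K`, and the supremum
over centres ignores translations. -/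
theorem weightedSup_momentumConv_le {K : E3 → ℝ≥0∞} (hK : Measurable K) {h : Phase → ℝ≥0∞}
    (hh : Measurable h) : weightedSup (momentumConv K h) ≤ (∫⁻ ζ, K ζ) * weightedSup h := by
  refine iSup_le fun Y => ?_
  have hw := measurable_weight
  calc ∫⁻ X : Phase, weight (X - Y) * momentumConv K h X
      = ∫⁻ X : Phase, ∫⁻ ζ : E3, K ζ * (weight (X - Y) * h (X.1, X.2 + ζ)) := by
        congr 1 with X
        unfold momentumConv
        rw [← lintegral_const_mul' _ _ ((weight_le_one _).trans_lt ENNReal.one_lt_top).ne]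
        congr 1 with ζ
        ring
    _ = ∫⁻ ζ : E3, ∫⁻ X : Phase, K ζ * (weight (X - Y) * h (X.1, X.2 + ζ)) := by
        rw [lintegral_lintegral_swap]
        apply Measurable.aemeasurable
        simp only [Function.uncurry_def]
        fun_prop
    _ ≤ ∫⁻ ζ : E3, K ζ * weightedSup h := by
        refine lintegral_mono fun ζ => ?_
        rw [lintegral_const_mul _ (by fun_prop)]
        gcongr
        refine le_trans (le_of_eq ?_) (lintegral_weight_sub_mul_le h (Y + ((0 : E3), ζ)))
        rw [← lintegral_add_right_eq_self (fun X : Phase => weight (X - (Y + ((0 : E3), ζ))) * h X)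
          ((0 : E3), ζ)]
        congr 1 with X
        rw [add_sub_add_right_eq_sub]
        simp [Prod.add_def]
    _ = _ := lintegral_mul_const _ hK

end WignerPoisson

namespace WignerPoisson

/-! ### Duality and Gronwall: smoothing away from the initial time -/

theorem weightedSup_const_mul {a : ℝ≥0∞} (ha : a ≠ ∞) (g : Phase → ℝ≥0∞) :
    weightedSup (fun X => a * g X) = a * weightedSup g := by
  unfold weightedSup
  rw [ENNReal.mul_iSup]
  congr 1 with Y
  rw [← lintegral_const_mul' _ _ ha]
  congr 1 with X
  ring

theorem weightedSup_mono {g h : Phase → ℝ≥0∞} (hgh : ∀ X, g X ≤ h X) :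
    weightedSup g ≤ weightedSup h :=
  iSup_mono fun Y => lintegral_mono fun X => by gcongr; exact hgh X

/-- The absorption step of the Gronwall argument. It fails for `S = ∞`, which is why the supremum
below is first taken over bounded test functions. -/
theorem le_two_mul_of_le_add_half {S a : ℝ≥0∞} (hS : S ≠ ∞) (h : S ≤ a + S / 2) : S ≤ 2 * a := by
  have h1 : S / 2 + S / 2 ≤ a + S / 2 := by rwa [ENNReal.add_halves]
  have h2 : S / 2 ≤ a :=
    (ENNReal.add_le_add_iff_right (ENNReal.div_lt_top hS (by norm_num)).ne).1 h1
  calc S = S / 2 + S / 2 := (ENNReal.add_halves S).symm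
    _ ≤ a + a := add_le_add h2 h2
    _ = 2 * a := (two_mul a).symm

theorem lintegral_exp_mul_Ioo_le {lam : ℝ} (hlam : 0 < lam) {t : ℝ} (ht : 0 ≤ t) :
    ∫⁻ s in Ioo 0 t, ENNReal.ofReal (Real.exp (lam * s)) ≤
      ENNReal.ofReal (Real.exp (lam * t) / lam) := by
  have hint : IntegrableOn (fun s => Real.exp (lam * s)) (Ioc 0 t) :=
    (Continuous.intervalIntegrable (by fun_prop) 0 t).1
  calc ∫⁻ s in Ioo 0 t, ENNReal.ofReal (Real.exp (lam * s))
      ≤ ∫⁻ s in Ioc 0 t, ENNReal.ofReal (Real.exp (lam * s)) :=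
        lintegral_mono_set Ioo_subset_Ioc_self
    _ = ENNReal.ofReal (∫ s in Ioc 0 t, Real.exp (lam * s)) :=
        (ofReal_integral_eq_lintegral_ofReal hint
          (Eventually.of_forall fun s => (Real.exp_pos _).le)).symm
    _ ≤ _ := by
        apply ENNReal.ofReal_le_ofReal
        rw [← intervalIntegral.integral_of_le ht, intervalIntegral.integral_comp_mul_left
          (f := Real.exp) hlam.ne', integral_exp, mul_zero, Real.exp_zero, smul_eq_mul,
          inv_mul_eq_div]
        gcongr
        linarith

/-- **Smoothing by a Gronwall argument.** A nonnegative subsolution of the Duhamel inequality is,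
away from the initial time, bounded by duality with the amalgam seminorm. -/
theorem MasterEquation.exists_lintegral_mul_le {M : MasterEquation} {T : ℝ} (hT : 0 < T)
    (hD : ∀ t ∈ Ioc 0 T, 0 < M.disc t) {u : ℝ → Phase → ℝ≥0∞} {u₀ : Phase → ℝ≥0∞}
    {K : ℝ → E3 → ℝ≥0∞} {m κ : ℝ} (hm : 0 < m) (hκ : 1 ≤ κ)
    (hu : ∀ t ∈ Ioc 0 T, AEMeasurable (u t)) (hum : ∀ t ∈ Ioc 0 T, ∫⁻ X, u t X ≤ ENNReal.ofReal m)
    (hu₀ : AEMeasurable u₀) (hu₀m : ∫⁻ X, u₀ X ≤ ENNReal.ofReal m)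
    (hK : ∀ s ∈ Ioc 0 T, Measurable (K s)) (hKκ : ∀ s ∈ Ioc 0 T, ∫⁻ ζ, K s ζ ≤ ENNReal.ofReal κ)
    (hDuh : ∀ t ∈ Ioc 0 T, ∀ g : Phase → ℝ≥0∞, Measurable g →
      ∫⁻ X, u t X * g X ≤ (∫⁻ X, u₀ X * M.backProp t g X) +
        ∫⁻ s in Ioo 0 t, ∫⁻ X, u s X * momentumConv (K s) (M.backProp (t - s) g) X)
    {τ : ℝ} (hτ : 0 < τ) :
    ∃ B : ℝ, 0 < B ∧ ∀ t ∈ Icc τ T, ∀ g : Phase → ℝ≥0∞, Measurable g → ∀ c : ℝ, 0 < c →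
      weightedSup g ≤ ENNReal.ofReal c → ∫⁻ X, u t X * g X ≤ ENNReal.ofReal (B * c) := by
  obtain ⟨N, c, hc, hG⟩ := exists_gauss_le_weight hT hD
  obtain ⟨C, hC, hGC⟩ := exists_weightedSup_backProp_le hT hD
  have hκ0 : 0 < κ := by linarith
  have hC0 : 0 < C := by linarith
  -- Chosen so that the recent half of the Duhamel integral contributes exactly the factor `κ C 2ᴺ /
  -- lam = 1/2`.
  set lam := 2 * (κ * C * 2 ^ N) with hlam
  have hlam0 : 0 < lam := by positivity
  -- The two terms come from the initial datum and from the times `s ≤ t/2`, after multiplication by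
  -- `tᴺ`.
  set a := m * c + T * (m * κ * c * 2 ^ N) with ha
  have ha0 : 0 < a := by positivity
  have mul_le : ∀ {v g : Phase → ℝ≥0∞} {b : ℝ≥0∞}, AEMeasurable v →
      ∫⁻ X, v X ≤ ENNReal.ofReal m → (∀ X, g X ≤ b) → ∫⁻ X, v X * g X ≤ ENNReal.ofReal m * b := by
    intro v g b hv hvm hg
    calc ∫⁻ X, v X * g X ≤ ∫⁻ X, v X * b := lintegral_mono fun X => by gcongr; exact hg X
      _ = (∫⁻ X, v X) * b := lintegral_mul_const'' _ hv
      _ ≤ _ := by gcongr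
  have key : ∀ Λ : ℝ, 0 < Λ → ∀ t ∈ Ioc 0 T, ∀ g : Phase → ℝ≥0∞, Measurable g →
      (∀ X, g X ≤ ENNReal.ofReal Λ) → weightedSup g ≤ 1 →
      ENNReal.ofReal (t ^ N * Real.exp (-(lam * t))) * ∫⁻ X, u t X * g X ≤
        2 * ENNReal.ofReal a := by
    intro Λ hΛ
    set S : ℝ≥0∞ := ⨆ (t : ℝ) (_ : t ∈ Ioc 0 T) (g : Phase → ℝ≥0∞) (_ : Measurable g)
      (_ : ∀ X, g X ≤ ENNReal.ofReal Λ) (_ : weightedSup g ≤ 1),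
      ENNReal.ofReal (t ^ N * Real.exp (-(lam * t))) * ∫⁻ X, u t X * g X with hS
    have hle : ∀ t ∈ Ioc 0 T, ∀ g : Phase → ℝ≥0∞, Measurable g →
        (∀ X, g X ≤ ENNReal.ofReal Λ) → weightedSup g ≤ 1 →
        ENNReal.ofReal (t ^ N * Real.exp (-(lam * t))) * ∫⁻ X, u t X * g X ≤ S := by
      intro t ht g h1 h2 h3
      rw [hS]
      refine le_iSup₂_of_le t ht (le_iSup₂_of_le g h1 (le_iSup₂_of_le h2 h3 le_rfl))
    -- The mass bound `m` and the bound `Λ` of the test functions make `S` finite. The final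
    -- estimate does not depend on `Λ`.
    have hSfin : S ≠ ∞ := by
      refine ne_top_of_le_ne_top (b := ENNReal.ofReal (T ^ N) * (ENNReal.ofReal m *
        ENNReal.ofReal Λ)) (by finiteness) ?_
      refine iSup₂_le fun t ht => iSup₂_le fun g h1 => iSup₂_le fun h2 h3 => ?_
      gcongr
      · have h4 : Real.exp (-(lam * t)) ≤ 1 := Real.exp_le_one_iff.2 (by
          have := ht.1
          have : 0 < lam * t := by positivity
          linarith)
        have h5 := pow_le_pow_left₀ ht.1.le ht.2 N
        calc t ^ N * Real.exp (-(lam * t)) ≤ T ^ N * 1 := by gcongr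
          _ = T ^ N := mul_one _
      · exact mul_le (hu t ht) (hum t ht) h2
    suffices hmain : S ≤ ENNReal.ofReal a + S / 2 from fun t ht g h1 h2 h3 =>
      (hle t ht g h1 h2 h3).trans (le_two_mul_of_le_add_half hSfin hmain)
    refine iSup₂_le fun t ht => iSup₂_le fun g h1 => iSup₂_le fun h2 h3 => ?_
    have ht0 : 0 < t := ht.1
    have hfirst : ∫⁻ X, u₀ X * M.backProp t g X ≤ ENNReal.ofReal (m * c / t ^ N) := by
      have h4 : ∀ X, M.backProp t g X ≤ ENNReal.ofReal (c / t ^ N) := fun X =>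
        (backProp_le_weightedSup (hG t ht) g X).trans
          ((mul_le_mul_right h3 _).trans_eq (mul_one _))
      refine (mul_le hu₀ hu₀m h4).trans_eq ?_
      rw [← ENNReal.ofReal_mul hm.le, mul_div_assoc]
    have hsecond : ∀ s ∈ Ioo 0 t, ∫⁻ X, u s X * momentumConv (K s) (M.backProp (t - s) g) X ≤
        ENNReal.ofReal (m * κ * c * 2 ^ N / t ^ N) +
          ENNReal.ofReal (κ * C * 2 ^ N / t ^ N) * S * ENNReal.ofReal (Real.exp (lam * s)) := by
      intro s hs
      have hs0 : 0 < s := hs.1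
      have hsT : s ∈ Ioc 0 T := ⟨hs.1, hs.2.le.trans ht.2⟩
      have hr : t - s ∈ Ioc 0 T := ⟨sub_pos.2 hs.2, by linarith [ht.2]⟩
      have hmb := M.measurable_backProp (t - s) h1
      -- For `s ≤ t/2` the remaining time is at least `t/2`, so the adjoint propagator smooths `g`
      -- at cost `(t/2)⁻ᴺ` and the mass of `u s` suffices. For `s > t/2` smoothing would be too
      -- singular; instead the transported test function is inserted in the definition of `S` at
      -- time `s`, where `s⁻ᴺ ≤ (t/2)⁻ᴺ`.
      rcases le_or_gt s (t / 2) with h | h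
      · refine le_add_right ?_
        have h4 : ∀ X, M.backProp (t - s) g X ≤ ENNReal.ofReal (c * 2 ^ N / t ^ N) := fun X => by
          refine ((backProp_le_weightedSup (hG _ hr) g X).trans
            ((mul_le_mul_right h3 _).trans_eq (mul_one _))).trans (ENNReal.ofReal_le_ofReal ?_)
          have : c * 2 ^ N / t ^ N = c / (t / 2) ^ N := by rw [div_pow]; field_simp
          rw [this]
          have : t / 2 ≤ t - s := by linarith
          gcongr
        refine (mul_le (hu s hsT) (hum s hsT) (b := ENNReal.ofReal κ *
          ENNReal.ofReal (c * 2 ^ N / t ^ N)) fun X => ?_).trans_eq ?_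
        · refine (momentumConv_le_of_le (hK s hsT) h4 X).trans ?_
          gcongr
          exact hKκ s hsT
        · rw [← ENNReal.ofReal_mul hκ0.le, ← ENNReal.ofReal_mul hm.le]
          congr 1
          ring
      · refine le_add_left ?_
        set h := momentumConv (K s) (M.backProp (t - s) g) with hh
        have hmh : Measurable h := measurable_momentumConv (hK s hsT) hmb
        -- This scaling makes the transported function admissible again: its supremum grew by at
        -- most `κ ≤ κ C`, its seminorm by at most `κ C`.
        set b : ℝ≥0∞ := ENNReal.ofReal ((κ * C)⁻¹) with hb
        have hb' : ENNReal.ofReal (κ * C) * b = 1 := by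
          rw [hb, ← ENNReal.ofReal_mul (by positivity), mul_inv_cancel₀ (by positivity),
            ENNReal.ofReal_one]
        have hb'' : b * ENNReal.ofReal (κ * C) = 1 := by rw [mul_comm, hb']
        have h5 := hle s hsT (fun X => b * h X) (hmh.const_mul b) (fun X => by
          have h6 : h X ≤ ENNReal.ofReal κ * ENNReal.ofReal Λ := by
            refine (momentumConv_le_of_le (hK s hsT) (backProp_le_of_le hD hr h2) X).trans ?_
            gcongr
            exact hKκ s hsT
          calc b * h X ≤ b * (ENNReal.ofReal (κ * C) * ENNReal.ofReal Λ) := by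
                gcongr
                refine h6.trans ?_
                gcongr
                nlinarith
            _ = ENNReal.ofReal Λ := by rw [← mul_assoc, hb'', one_mul]) (by
          rw [weightedSup_const_mul (by finiteness)]
          calc b * weightedSup h ≤ b * (ENNReal.ofReal κ * (ENNReal.ofReal C * 1)) := by
                gcongr
                refine (weightedSup_momentumConv_le (hK s hsT) hmb).trans ?_
                gcongr
                · exact hKκ s hsT
                · refine (hGC _ hr g h1).trans ?_
                  gcongr
            _ = 1 := by rw [mul_one, ← ENNReal.ofReal_mul hκ0.le, hb''])
        have h7 : ∫⁻ X, u s X * h X = ENNReal.ofReal (κ * C) * ∫⁻ X, u s X * (b * h X) := by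
          rw [← lintegral_const_mul' _ _ (by finiteness)]
          congr 1 with X
          rw [mul_left_comm, ← mul_assoc (ENNReal.ofReal (κ * C)), hb', one_mul]
        rw [h7]
        set P := ∫⁻ X, u s X * (b * h X)
        have h8 : P ≤ ENNReal.ofReal (2 ^ N / t ^ N * Real.exp (lam * s)) * S := by
          calc P = ENNReal.ofReal (Real.exp (lam * s) / s ^ N) *
                (ENNReal.ofReal (s ^ N * Real.exp (-(lam * s))) * P) := by
                rw [← mul_assoc, ← ENNReal.ofReal_mul (by positivity), Real.exp_neg]
                have : Real.exp (lam * s) / s ^ N * (s ^ N * (Real.exp (lam * s))⁻¹) = 1 := by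
                  field_simp
                rw [this, ENNReal.ofReal_one, one_mul]
            _ ≤ ENNReal.ofReal (2 ^ N / t ^ N * Real.exp (lam * s)) * S := by
                gcongr
                have : 2 ^ N / t ^ N = 1 / (t / 2) ^ N := by rw [div_pow]; field_simp
                rw [this, div_mul_eq_mul_div, one_mul]
                gcongr
        calc ENNReal.ofReal (κ * C) * P
            ≤ ENNReal.ofReal (κ * C) * (ENNReal.ofReal (2 ^ N / t ^ N * Real.exp (lam * s)) * S) :=
              by gcongr
          _ = _ := by
              rw [ENNReal.ofReal_mul (by positivity : 0 ≤ (2 : ℝ) ^ N / t ^ N), mul_div_assoc,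
                ENNReal.ofReal_mul (by positivity : 0 ≤ κ * C)]
              ring
    have hint : ∫⁻ s in Ioo 0 t, ∫⁻ X, u s X * momentumConv (K s) (M.backProp (t - s) g) X ≤
        ENNReal.ofReal (m * κ * c * 2 ^ N / t ^ N) * ENNReal.ofReal T +
          ENNReal.ofReal (κ * C * 2 ^ N / t ^ N) * S *
            ENNReal.ofReal (Real.exp (lam * t) / lam) := by
      refine (setLIntegral_mono (by fun_prop) hsecond).trans ?_
      rw [lintegral_add_left (by fun_prop), lintegral_const_mul _ (by fun_prop), setLIntegral_const,
        Real.volume_Ioo, sub_zero]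
      gcongr
      · exact ht.2
      · exact lintegral_exp_mul_Ioo_le hlam0 ht0.le
    calc ENNReal.ofReal (t ^ N * Real.exp (-(lam * t))) * ∫⁻ X, u t X * g X
        ≤ ENNReal.ofReal (t ^ N * Real.exp (-(lam * t))) * (ENNReal.ofReal (m * c / t ^ N) +
          (ENNReal.ofReal (m * κ * c * 2 ^ N / t ^ N) * ENNReal.ofReal T +
          ENNReal.ofReal (κ * C * 2 ^ N / t ^ N) * S *
            ENNReal.ofReal (Real.exp (lam * t) / lam))) := by
          gcongr
          exact (hDuh t ht g h1).trans (add_le_add hfirst hint)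
      _ = ENNReal.ofReal (Real.exp (-(lam * t)) * a) + ENNReal.ofReal (1 / 2) * S := by
          have e1 : ENNReal.ofReal (κ * C * 2 ^ N / t ^ N) * S *
              ENNReal.ofReal (Real.exp (lam * t) / lam) =
              ENNReal.ofReal (κ * C * 2 ^ N / t ^ N * (Real.exp (lam * t) / lam)) * S := by
            rw [ENNReal.ofReal_mul (p := κ * C * 2 ^ N / t ^ N) (by positivity)]; ring
          rw [e1, ← ENNReal.ofReal_mul (by positivity), ← add_assoc,
            ← ENNReal.ofReal_add (by positivity) (by positivity), mul_add,
            ← ENNReal.ofReal_mul (by positivity), ← mul_assoc,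
            ← ENNReal.ofReal_mul (by positivity)]
          have e2 : t ^ N * Real.exp (-(lam * t)) * (m * c / t ^ N + m * κ * c * 2 ^ N / t ^ N * T) =
              Real.exp (-(lam * t)) * a := by
            rw [ha]
            field_simp
          have e3 : t ^ N * Real.exp (-(lam * t)) *
              (κ * C * 2 ^ N / t ^ N * (Real.exp (lam * t) / lam)) = 1 / 2 := by
            rw [hlam, Real.exp_neg]
            field_simp
          rw [e2, e3]
      _ ≤ ENNReal.ofReal a + S / 2 := by
          gcongr
          · have h4 : Real.exp (-(lam * t)) ≤ 1 := Real.exp_le_one_iff.2 (by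
              have : 0 < lam * t := by positivity
              linarith)
            nlinarith
          · rw [mul_comm, one_div, ENNReal.ofReal_inv_of_pos (by norm_num), ENNReal.div_eq_inv_mul,
              mul_comm]
            simp
  refine ⟨2 * a * (Real.exp (lam * T) / τ ^ N), by positivity, fun t ht g hg c' hc' hgc => ?_⟩
  have ht0 : 0 < t := hτ.trans_le ht.1
  have htT : t ∈ Ioc 0 T := ⟨ht0, ht.2⟩
  set b : ℝ≥0∞ := ENNReal.ofReal c'⁻¹ with hb
  have hb' : b * ENNReal.ofReal c' = 1 := by
    rw [hb, ← ENNReal.ofReal_mul (by positivity), inv_mul_cancel₀ hc'.ne', ENNReal.ofReal_one]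
  -- An unbounded test function is the increasing limit of its truncations, to which the estimate
  -- applies with a bound independent of the truncation level.
  have hlim : ∫⁻ X, u t X * (b * g X) =
      ⨆ n : ℕ, ∫⁻ X, u t X * min (b * g X) (ENNReal.ofReal (n + 1 : ℝ)) := by
    rw [← lintegral_iSup']
    · congr 1 with X
      rw [← ENNReal.mul_iSup]
      congr 1
      refine le_antisymm ?_ (iSup_le fun n => min_le_left _ _)
      have h1 : Tendsto (fun n : ℕ => ENNReal.ofReal (n + 1 : ℝ)) atTop (𝓝 ∞) :=
        ENNReal.tendsto_ofReal_nhds_top.2 (tendsto_atTop_add_const_right _ _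
          tendsto_natCast_atTop_atTop)
      have h2 := (tendsto_const_nhds (x := b * g X)).min h1
      rw [min_eq_left le_top] at h2
      exact le_of_tendsto' h2 fun n => le_iSup
        (fun n : ℕ => min (b * g X) (ENNReal.ofReal (n + 1 : ℝ))) n
    · intro n
      have := hu t htT
      fun_prop
    · refine Eventually.of_forall fun X i j hij => ?_
      dsimp only
      gcongr
  have hbound : ∫⁻ X, u t X * (b * g X) ≤
      ENNReal.ofReal (2 * a * (Real.exp (lam * T) / τ ^ N)) := by
    rw [hlim]
    refine iSup_le fun n => ?_
    have h1 := key (n + 1) (by positivity) t htT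
      (fun X => min (b * g X) (ENNReal.ofReal (n + 1 : ℝ))) (by fun_prop)
      (fun X => min_le_right _ _) (by
        refine (weightedSup_mono fun X => min_le_left _ _).trans ?_
        rw [weightedSup_const_mul (by finiteness), ← hb']
        gcongr)
    set P := ∫⁻ X, u t X * min (b * g X) (ENNReal.ofReal (n + 1 : ℝ))
    calc P = ENNReal.ofReal (Real.exp (lam * t) / t ^ N) *
          (ENNReal.ofReal (t ^ N * Real.exp (-(lam * t))) * P) := by
          rw [← mul_assoc, ← ENNReal.ofReal_mul (by positivity), Real.exp_neg]
          have : Real.exp (lam * t) / t ^ N * (t ^ N * (Real.exp (lam * t))⁻¹) = 1 := by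
            field_simp
          rw [this, ENNReal.ofReal_one, one_mul]
      _ ≤ ENNReal.ofReal (Real.exp (lam * T) / τ ^ N) * (2 * ENNReal.ofReal a) := by
          have h2 := ht.1
          have h3 := ht.2
          gcongr
      _ = _ := by
          rw [show (2 : ℝ≥0∞) = ENNReal.ofReal 2 by simp, ← ENNReal.ofReal_mul (by norm_num),
            ← ENNReal.ofReal_mul (by positivity)]
          congr 1
          ring
  calc ∫⁻ X, u t X * g X = ENNReal.ofReal c' * ∫⁻ X, u t X * (b * g X) := by
        rw [← lintegral_const_mul' _ _ (by finiteness)]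
        congr 1 with X
        rw [mul_left_comm, ← mul_assoc (ENNReal.ofReal c'), mul_comm (ENNReal.ofReal c') b, hb',
          one_mul]
    _ ≤ ENNReal.ofReal c' * ENNReal.ofReal (2 * a * (Real.exp (lam * T) / τ ^ N)) := by gcongr
    _ = _ := by
        rw [← ENNReal.ofReal_mul hc'.le, mul_comm]

end WignerPoisson

namespace WignerPoisson

/-! ### Mixed norms as iterated integrals -/

theorem ae_ae_swap {P : Phase → Prop} (h : ∀ᵐ X : Phase, P X) :
    ∀ᵐ ξ : E3, ∀ᵐ x : E3, P (x, ξ) := by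
  have h1 : ∀ᵐ Y : E3 × E3 ∂((volume : Measure E3).prod volume), P Y.swap :=
    (Measure.measurePreserving_swap (μ := (volume : Measure E3))
      (ν := (volume : Measure E3))).quasiMeasurePreserving.ae h
  exact Measure.ae_ae_of_ae_prod h1

theorem mixedNorm_congr_ae {q p : ℝ≥0∞} {f g : Phase → ℝ} (h : f =ᵐ[volume] g) :
    mixedNorm q p f = mixedNorm q p g := by
  refine eLpNorm_congr_ae ?_
  filter_upwards [ae_ae_swap h] with ξ hξ
  exact eLpNorm_congr_ae hξ

theorem mixedNorm_one_eq {p : ℝ≥0∞} (h0 : p ≠ 0) (hp : p ≠ ∞) (f : Phase → ℝ) :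
    mixedNorm 1 p f =
      ∫⁻ ξ : E3, (∫⁻ x : E3, ‖f (x, ξ)‖ₑ ^ p.toReal) ^ (1 / p.toReal) := by
  unfold mixedNorm
  rw [eLpNorm_one_eq_lintegral_enorm]
  simp [eLpNorm_eq_lintegral_rpow_enorm_toReal h0 hp]

theorem mixedNorm_one_one_eq {f : Phase → ℝ} (hf : AEStronglyMeasurable f volume) :
    mixedNorm 1 1 f = ∫⁻ X, ‖f X‖ₑ := by
  rw [mixedNorm_one_eq one_ne_zero ENNReal.one_ne_top, Measure.volume_eq_prod,
    lintegral_prod_symm _ hf.enorm]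
  simp

theorem mixedNorm_top_top_le {f : Phase → ℝ} {B : ℝ≥0∞} (h : ∀ᵐ X, ‖f X‖ₑ ≤ B) :
    mixedNorm ∞ ∞ f ≤ B := by
  unfold mixedNorm
  rw [eLpNorm_exponent_top]
  refine essSup_le_of_ae_le B ?_
  filter_upwards [ae_ae_swap h] with ξ hξ
  rw [enorm_eq_self, eLpNorm_exponent_top]
  exact essSup_le_of_ae_le B hξ

/-- Interpolation of `L^{1,p}` between `L^{1,1}` and `L^{1,2p-1}`. -/
theorem lintegral_rpow_interpolation {v : Phase → ℝ≥0∞} (hv : Measurable v) {p : ℝ} (hp : 1 ≤ p) :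
    ∫⁻ ξ : E3, (∫⁻ x : E3, v (x, ξ) ^ p) ^ (1 / p) ≤
      (∫⁻ ξ : E3, ∫⁻ x : E3, v (x, ξ)) ^ (1 / (2 * p)) *
      (∫⁻ ξ : E3, (∫⁻ x : E3, v (x, ξ) ^ (2 * p - 1)) ^ (1 / (2 * p - 1))) ^
        ((2 * p - 1) / (2 * p)) := by
  have hp0 : 0 < p := by linarith
  have hq0 : 0 < 2 * p - 1 := by linarith
  have hm : ∀ a : ℝ, Measurable fun ξ : E3 => ∫⁻ x : E3, v (x, ξ) ^ a := fun a =>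
    Measurable.lintegral_prod_left' (f := fun X : E3 × E3 => v X ^ a) (by fun_prop)
  have hm1 : Measurable fun ξ : E3 => ∫⁻ x : E3, v (x, ξ) :=
    Measurable.lintegral_prod_left' (f := fun X : E3 × E3 => v X) (by fun_prop)
  have h1 : ∀ ξ : E3, (∫⁻ x : E3, v (x, ξ) ^ p) ^ (1 / p) ≤
      (∫⁻ x : E3, v (x, ξ)) ^ (1 / (2 * p)) *
      ((∫⁻ x : E3, v (x, ξ) ^ (2 * p - 1)) ^ (1 / (2 * p - 1))) ^ ((2 * p - 1) / (2 * p)) := by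
    intro ξ
    -- Cauchy–Schwarz with `p = 1/2 + (2p - 1)/2`. The later Hölder inequality in `ξ` uses the
    -- exponents `1/(2p)` and `(2p-1)/(2p)`, whose sum is `1`.
    have h2 : ∫⁻ x : E3, v (x, ξ) ^ p ≤ (∫⁻ x : E3, v (x, ξ)) ^ (1 / 2 : ℝ) *
        (∫⁻ x : E3, v (x, ξ) ^ (2 * p - 1)) ^ (1 / 2 : ℝ) := by
      refine le_trans (le_of_eq ?_) (ENNReal.lintegral_mul_norm_pow_le
        (f := fun x : E3 => v (x, ξ)) (g := fun x : E3 => v (x, ξ) ^ (2 * p - 1))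
        (by fun_prop) (by fun_prop) (by norm_num) (by norm_num) (by norm_num))
      congr 1 with x
      rw [← ENNReal.rpow_mul, ← ENNReal.rpow_add_of_nonneg _ _ (by norm_num) (by linarith)]
      congr 1
      ring
    refine (ENNReal.rpow_le_rpow h2 (by positivity)).trans_eq ?_
    rw [ENNReal.mul_rpow_of_nonneg _ _ (by positivity), ← ENNReal.rpow_mul, ← ENNReal.rpow_mul,
      ← ENNReal.rpow_mul]
    congr 2
    · field_simp
    · field_simp
  refine (lintegral_mono h1).trans ?_
  refine ENNReal.lintegral_mul_norm_pow_le (f := fun ξ : E3 => ∫⁻ x : E3, v (x, ξ))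
    hm1.aemeasurable ((hm _).pow_const _).aemeasurable (by positivity) (by positivity) ?_
  field_simp
  ring

/-! ### Consequences of boundedness in the dual of the amalgam seminorm -/

/-- `∫ v g ≤ B` for every `g` of amalgam seminorm one. -/
def DualBound (B : ℝ) (v : Phase → ℝ≥0∞) : Prop :=
  ∀ g : Phase → ℝ≥0∞, Measurable g → ∀ c : ℝ, 0 < c → weightedSup g ≤ ENNReal.ofReal c →
    ∫⁻ X, v X * g X ≤ ENNReal.ofReal (B * c)

theorem DualBound.lintegral_mul_le_of_le {B : ℝ} (hB : 0 ≤ B) {v : Phase → ℝ≥0∞}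
    (h : DualBound B v) {g : Phase → ℝ≥0∞} (hg : Measurable g) {c : ℝ≥0∞} (h0 : c ≠ 0)
    (hc : weightedSup g ≤ c) (hfin : c ≠ ∞) : ∫⁻ X, v X * g X ≤ ENNReal.ofReal B * c := by
  have := h g hg _ (ENNReal.toReal_pos h0 hfin) (hc.trans_eq (ENNReal.ofReal_toReal hfin).symm)
  rwa [ENNReal.ofReal_mul hB, ENNReal.ofReal_toReal hfin] at this

/-- Test functions are indicators: since the weight is at most one, the seminorm of an indicator is
at most the measure of its set. -/
theorem DualBound.ae_le {B : ℝ} (hB : 0 ≤ B) {v : Phase → ℝ≥0∞} (hv : AEMeasurable v)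
    (h : DualBound B v) : ∀ᵐ X, v X ≤ ENNReal.ofReal B := by
  refine ae_le_of_forall_setLIntegral_le_of_sigmaFinite₀ hv fun s hs hsfin => ?_
  rw [setLIntegral_const]
  rcases eq_or_ne (volume s) 0 with h0 | h0
  · rw [setLIntegral_measure_zero _ _ h0]; exact zero_le
  have h1 : ∫⁻ X in s, v X = ∫⁻ X, v X * s.indicator 1 X := by
    rw [← lintegral_indicator hs]
    congr 1 with X
    by_cases hX : X ∈ s <;> simp [hX]
  rw [h1]
  refine h.lintegral_mul_le_of_le hB (measurable_one.indicator hs) h0 ?_ hsfin.ne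
  refine iSup_le fun Y => ?_
  calc ∫⁻ X, weight (X - Y) * s.indicator 1 X ≤ ∫⁻ X, s.indicator 1 X :=
        lintegral_mono fun X => mul_le_of_le_one_left' (weight_le_one _)
    _ = volume s := lintegral_indicator_one hs

/-- The weight `(1 + ‖y‖)⁻⁴` on `ℝ³`. -/
noncomputable def decay (y : E3) : ℝ≥0∞ := ENNReal.ofReal ((1 + ‖y‖) ^ (-4 : ℝ))

theorem measurable_decay : Measurable decay := by unfold decay; fun_prop

theorem decay_le_one (y : E3) : decay y ≤ 1 := by
  unfold decay
  rw [ENNReal.ofReal_le_one]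
  exact Real.rpow_le_one_of_one_le_of_nonpos (by linarith [norm_nonneg y]) (by norm_num)

theorem lintegral_decay_lt_top : ∫⁻ y : E3, decay y < ∞ := by
  have h : Integrable (fun y : E3 => (1 + ‖y‖) ^ (-4 : ℝ)) volume :=
    integrable_one_add_norm (by simp; norm_num)
  exact h.lintegral_lt_top

theorem lintegral_decay_pos : ∫⁻ y : E3, decay y ≠ 0 := by
  rw [Ne, lintegral_eq_zero_iff measurable_decay]
  intro h
  obtain ⟨y, hy⟩ := h.exists
  have h1 : 0 < (1 + ‖y‖) ^ (-4 : ℝ) := Real.rpow_pos_of_pos (by positivity) _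
  exact h1.not_ge (ENNReal.ofReal_eq_zero.1 hy)

/-- The exponent splits as `8 = 4 + 4`, and `4` still exceeds the dimension `3` of each factor. -/
theorem weight_le_decay_mul (Y : Phase) : weight Y ≤ decay Y.1 * decay Y.2 := by
  unfold weight decay
  rw [← ENNReal.ofReal_mul (by positivity)]
  apply ENNReal.ofReal_le_ofReal
  have h1 : (1 + ‖Y‖) ^ (-8 : ℝ) = (1 + ‖Y‖) ^ (-4 : ℝ) * (1 + ‖Y‖) ^ (-4 : ℝ) := by
    rw [← Real.rpow_add (by positivity)]; norm_num
  rw [h1]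
  gcongr ?_ * ?_
  · exact Real.rpow_le_rpow_of_nonpos (by positivity) (by linarith [norm_fst_le Y]) (by norm_num)
  · exact Real.rpow_le_rpow_of_nonpos (by positivity) (by linarith [norm_snd_le Y]) (by norm_num)

theorem lintegral_weight_sub_mul_le_iterated {g : Phase → ℝ≥0∞} (hg : Measurable g) (Y : Phase) :
    ∫⁻ X, weight (X - Y) * g X ≤
      ∫⁻ ξ : E3, decay (ξ - Y.2) * ∫⁻ x : E3, decay (x - Y.1) * g (x, ξ) := by
  have hw := measurable_weight
  have hd := measurable_decay
  rw [Measure.volume_eq_prod, lintegral_prod_symm _ (by fun_prop)]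
  refine lintegral_mono fun ξ => ?_
  rw [← lintegral_const_mul _ (by fun_prop)]
  refine lintegral_mono fun x => ?_
  rw [← mul_assoc, mul_comm (decay (ξ - Y.2))]
  gcongr
  exact weight_le_decay_mul _

/-- Here the test function is the indicator of the cylinder `s × ℝ³`. The decay in `ξ` keeps its
seminorm finite, and boundedness of the decay in `x` leaves the measure of `s`. -/
theorem DualBound.ae_lintegral_le {B : ℝ} (hB : 0 ≤ B) {v : Phase → ℝ≥0∞} (hv : Measurable v)
    (h : DualBound B v) :
    ∀ᵐ x : E3, ∫⁻ ξ : E3, v (x, ξ) ≤ ENNReal.ofReal B * ∫⁻ y : E3, decay y := by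
  refine ae_le_of_forall_setLIntegral_le_of_sigmaFinite hv.lintegral_prod_right' fun s hs hsfin => ?_
  rw [setLIntegral_const]
  have hd := measurable_decay
  rcases eq_or_ne (volume s) 0 with h0 | h0
  · rw [setLIntegral_measure_zero _ _ h0]; exact zero_le
  have hms : Measurable fun X : Phase => s.indicator (1 : E3 → ℝ≥0∞) X.1 :=
    (measurable_one.indicator hs).comp measurable_fst
  have h1 : ∫⁻ x in s, ∫⁻ ξ : E3, v (x, ξ) = ∫⁻ X : Phase, v X * s.indicator 1 X.1 := by
    rw [Measure.volume_eq_prod, lintegral_prod _ (by fun_prop), ← lintegral_indicator hs]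
    congr 1 with x
    by_cases hx : x ∈ s <;> simp [hx]
  rw [h1, mul_assoc]
  refine h.lintegral_mul_le_of_le hB hms (mul_ne_zero lintegral_decay_pos h0) ?_
    (ENNReal.mul_ne_top lintegral_decay_lt_top.ne hsfin.ne)
  refine iSup_le fun Y => (lintegral_weight_sub_mul_le_iterated hms Y).trans ?_
  calc ∫⁻ ξ : E3, decay (ξ - Y.2) * ∫⁻ x : E3, decay (x - Y.1) * s.indicator 1 x
      ≤ ∫⁻ ξ : E3, decay (ξ - Y.2) * volume s := by
        refine lintegral_mono fun ξ => ?_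
        gcongr
        rw [← lintegral_indicator_one hs]
        exact lintegral_mono fun x => mul_le_of_le_one_left' (decay_le_one _)
    _ = (∫⁻ y : E3, decay y) * volume s := by
        rw [lintegral_mul_const _ (by fun_prop), lintegral_sub_right_eq_self decay]

/-- The test function is the Hölder extremal `v^{p-1} / ‖v(·, ξ)‖_p^{p-1}`, which has norm at most
one in the conjugate space for each `ξ`. Hölder against the decay in `x`, and integration of the
decay in `ξ`, bound its seminorm; pairing it with `v` reproduces the mixed norm. -/
theorem DualBound.lintegral_rpow_le {B : ℝ} (hB : 0 ≤ B) {v : Phase → ℝ≥0∞} (hv : Measurable v)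
    (hv1 : ∫⁻ X, v X ≠ ∞) (h : DualBound B v) {p : ℝ} (hp : 1 < p) :
    ∫⁻ ξ : E3, (∫⁻ x : E3, v (x, ξ) ^ p) ^ (1 / p) ≤
      ENNReal.ofReal B * ((∫⁻ y : E3, decay y) * (∫⁻ y : E3, decay y) ^ (1 / p)) := by
  have hp0 : 0 < p := by linarith
  have hd := measurable_decay
  set N : E3 → ℝ≥0∞ := fun ξ => ∫⁻ x : E3, v (x, ξ) ^ p with hN
  have hNm : Measurable N :=
    Measurable.lintegral_prod_left' (f := fun X : E3 × E3 => v X ^ p) (by fun_prop)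
  -- Needed for the cancellation `N · N^{-(1-1/p)} = N^{1/p}` at the end; it follows from the
  -- essential bound of `v` and its integrability.
  have hNfin : ∀ᵐ ξ : E3, N ξ ≠ ∞ := by
    have h1 : ∀ᵐ ξ : E3, ∫⁻ x : E3, v (x, ξ) < ∞ := by
      refine ae_lt_top (Measurable.lintegral_prod_left' (f := fun X : E3 × E3 => v X) hv) ?_
      rwa [Measure.volume_eq_prod, lintegral_prod_symm _ hv.aemeasurable] at hv1
    filter_upwards [h1, ae_ae_swap (h.ae_le hB hv.aemeasurable)] with ξ h2 h3
    refine ne_top_of_le_ne_top (b := ENNReal.ofReal B ^ (p - 1) * ∫⁻ x : E3, v (x, ξ))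
      (ENNReal.mul_ne_top (ENNReal.rpow_ne_top_of_nonneg (by linarith) ENNReal.ofReal_ne_top)
        h2.ne) ?_
    rw [← lintegral_const_mul _ (by fun_prop)]
    refine lintegral_mono_ae (h3.mono fun x hx => ?_)
    have : v (x, ξ) ^ p = v (x, ξ) ^ (p - 1) * v (x, ξ) := by
      conv_rhs => rw [← ENNReal.rpow_one (v (x, ξ)), ← ENNReal.rpow_mul,
        ← ENNReal.rpow_add_of_nonneg _ _ (by linarith) (by norm_num)]
      congr 1
      ring
    rw [this]
    gcongr
  set g : Phase → ℝ≥0∞ := fun X => v X ^ (p - 1) * (N X.2 ^ (1 - 1 / p))⁻¹ with hg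
  have hgm : Measurable g := by fun_prop
  have hconj : p.HolderConjugate (p / (p - 1)) := Real.HolderConjugate.conjExponent hp
  have hgq : ∀ ξ : E3, ∫⁻ x : E3, g (x, ξ) ^ (p / (p - 1)) ≤ 1 := by
    intro ξ
    have : ∀ x : E3, g (x, ξ) ^ (p / (p - 1)) = v (x, ξ) ^ p * (N ξ)⁻¹ := by
      intro x
      have hp1 : p - 1 ≠ 0 := by linarith
      rw [hg]
      dsimp only
      rw [ENNReal.mul_rpow_of_nonneg _ _ (by have := hconj.symm.pos; positivity),
        ← ENNReal.rpow_mul, ENNReal.inv_rpow, ← ENNReal.rpow_mul]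
      have e1 : (p - 1) * (p / (p - 1)) = p := by field_simp
      have e2 : (1 - 1 / p) * (p / (p - 1)) = 1 := by field_simp
      rw [e1, e2, ENNReal.rpow_one]
    simp_rw [this]
    rw [lintegral_mul_const _ (by fun_prop)]
    exact ENNReal.mul_inv_le_one _
  have hweight : weightedSup g ≤ (∫⁻ y : E3, decay y) * (∫⁻ y : E3, decay y) ^ (1 / p) := by
    refine iSup_le fun Y => (lintegral_weight_sub_mul_le_iterated hgm Y).trans ?_
    calc ∫⁻ ξ : E3, decay (ξ - Y.2) * ∫⁻ x : E3, decay (x - Y.1) * g (x, ξ)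
        ≤ ∫⁻ ξ : E3, decay (ξ - Y.2) * (∫⁻ y : E3, decay y) ^ (1 / p) := by
          refine lintegral_mono fun ξ => ?_
          gcongr
          have hdp : ∫⁻ x : E3, decay (x - Y.1) ^ p ≤ ∫⁻ y : E3, decay y := by
            rw [← lintegral_sub_right_eq_self decay Y.1]
            refine lintegral_mono fun x => ?_
            conv_rhs => rw [← ENNReal.rpow_one (decay (x - Y.1))]
            exact ENNReal.rpow_le_rpow_of_exponent_ge (decay_le_one _) hp.le
          have hH := ENNReal.lintegral_mul_le_Lp_mul_Lq volume hconj
            (f := fun x : E3 => decay (x - Y.1)) (g := fun x : E3 => g (x, ξ))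
            (by fun_prop) (by fun_prop)
          refine hH.trans ?_
          calc _ ≤ (∫⁻ y : E3, decay y) ^ (1 / p) * 1 ^ (1 / (p / (p - 1))) := by
                have := hconj.symm.pos
                gcongr
                exact hgq ξ
            _ = _ := by rw [ENNReal.one_rpow, mul_one]
      _ = _ := by rw [lintegral_mul_const _ (by fun_prop), lintegral_sub_right_eq_self decay]
  have hmain := h.lintegral_mul_le_of_le hB hgm (c := (∫⁻ y : E3, decay y) *
    (∫⁻ y : E3, decay y) ^ (1 / p)) (mul_ne_zero lintegral_decay_pos (by
      rw [Ne, ENNReal.rpow_eq_zero_iff]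
      simp [lintegral_decay_pos, lintegral_decay_lt_top.ne])) hweight
    (ENNReal.mul_ne_top lintegral_decay_lt_top.ne
      (ENNReal.rpow_ne_top_of_nonneg (by positivity) lintegral_decay_lt_top.ne))
  refine le_trans (le_of_eq ?_) hmain
  rw [Measure.volume_eq_prod, lintegral_prod_symm _ (by fun_prop)]
  refine lintegral_congr_ae (hNfin.mono fun ξ hξ => ?_)
  have e3 : ∀ x : E3, v (x, ξ) * g (x, ξ) = v (x, ξ) ^ p * (N ξ ^ (1 - 1 / p))⁻¹ := by
    intro x
    rw [hg]
    dsimp only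
    rw [← mul_assoc]
    congr 1
    conv_lhs => rw [← ENNReal.rpow_one (v (x, ξ)), ← ENNReal.rpow_mul,
        ← ENNReal.rpow_add_of_nonneg _ _ (by norm_num) (by linarith)]
    congr 1
    ring
  simp_rw [e3]
  rw [lintegral_mul_const _ (by fun_prop)]
  change N ξ ^ (1 / p) = N ξ * (N ξ ^ (1 - 1 / p))⁻¹
  rcases eq_or_ne (N ξ) 0 with h0 | h0
  · rw [h0, zero_mul, ENNReal.zero_rpow_of_pos (by positivity)]
  · rw [← ENNReal.rpow_neg]
    conv_rhs => rw [← ENNReal.rpow_one (N ξ), ← ENNReal.rpow_mul, ← ENNReal.rpow_add _ _ h0 hξ]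
    congr 1
    ring

end WignerPoisson

namespace WignerPoisson

/-! ### Singular kernels on `ℝ³` -/

theorem integrableOn_ball_inv_norm_sq :
    IntegrableOn (fun x : E3 => (‖x‖ ^ 2)⁻¹) (Metric.ball 0 1) := by
  rw [integrableOn_fun_norm_addHaar volume (f := fun y : ℝ => (y ^ 2)⁻¹)]
  have : IntegrableOn (fun _ : ℝ => (1 : ℝ)) (Ioo 0 1) := by simp
  refine this.congr_fun (fun y hy => ?_) measurableSet_Ioo
  have : y ≠ 0 := hy.1.ne'
  simp only [finrank_euclideanSpace, Fintype.card_fin, smul_eq_mul]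
  field_simp

theorem integrableOn_compl_ball_inv_norm_pow_four :
    IntegrableOn (fun x : E3 => (‖x‖ ^ 4)⁻¹) (Metric.ball 0 1)ᶜ := by
  have h : Integrable (fun x : E3 => 16 * (1 + ‖x‖) ^ (-4 : ℝ)) volume :=
    (integrable_one_add_norm (by simp; norm_num)).const_mul 16
  refine Integrable.mono' h.integrableOn (by fun_prop) ?_
  filter_upwards [ae_restrict_mem Metric.isOpen_ball.measurableSet.compl] with x hx
  have hx1 : 1 ≤ ‖x‖ := by simpa using hx
  rw [Real.norm_of_nonneg (by positivity), Real.rpow_neg (by positivity)]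
  have h4 : (1 + ‖x‖) ^ (4 : ℝ) = (1 + ‖x‖) ^ 4 := by exact_mod_cast Real.rpow_natCast (1 + ‖x‖) 4
  rw [h4, ← div_eq_mul_inv, inv_eq_one_div, div_le_div_iff₀ (by positivity) (by positivity), one_mul]
  calc (1 + ‖x‖) ^ 4 ≤ (2 * ‖x‖) ^ 4 := by gcongr; linarith
    _ = _ := by ring

/-- `∫ ‖x‖⁻²` over the unit ball. -/
noncomputable def ballMass : ℝ≥0∞ := ∫⁻ x in Metric.ball (0 : E3) 1, ENNReal.ofReal (‖x‖ ^ 2)⁻¹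

/-- `∫ ‖x‖⁻⁴` outside the unit ball. -/
noncomputable def tailMass : ℝ≥0∞ :=
  ∫⁻ x in (Metric.ball (0 : E3) 1)ᶜ, ENNReal.ofReal (‖x‖ ^ 4)⁻¹

theorem ballMass_ne_top : ballMass ≠ ∞ := integrableOn_ball_inv_norm_sq.lintegral_lt_top.ne

theorem tailMass_ne_top : tailMass ≠ ∞ :=
  integrableOn_compl_ball_inv_norm_pow_four.lintegral_lt_top.ne

/-- `∫ ‖x‖⁻² v` is controlled by a local sup bound and an `L²` bound at infinity. -/
theorem lintegral_inv_norm_sq_mul_le_of_memLp {v : E3 → ℝ≥0∞} (hv : Measurable v) {b : ℝ≥0∞}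
    (hb : ∀ x, v x ≤ b) :
    ∫⁻ x : E3, ENNReal.ofReal (‖x‖ ^ 2)⁻¹ * v x ≤
      ballMass * b + tailMass ^ (1 / 2 : ℝ) * (∫⁻ x, v x ^ (2 : ℝ)) ^ (1 / 2 : ℝ) := by
  rw [← lintegral_add_compl _ (Metric.isOpen_ball (x := (0 : E3)) (ε := 1)).measurableSet]
  gcongr
  · unfold ballMass
    rw [← lintegral_mul_const _ (by fun_prop)]
    exact lintegral_mono fun x => by gcongr; exact hb x
  · have hH := ENNReal.lintegral_mul_le_Lp_mul_Lq (volume.restrict (Metric.ball (0 : E3) 1)ᶜ)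
      (Real.HolderConjugate.two_two) (f := fun x : E3 => ENNReal.ofReal (‖x‖ ^ 2)⁻¹) (g := v)
      (by fun_prop) (by fun_prop)
    refine hH.trans ?_
    gcongr
    · refine lintegral_mono fun x => le_of_eq ?_
      rw [ENNReal.ofReal_rpow_of_nonneg (by positivity) (by norm_num)]
      congr 1
      norm_cast
      rw [← inv_pow, ← inv_pow, ← pow_mul]
    · exact Measure.restrict_le_self

/-- `∫ ‖x - y‖⁻² v(y)` is controlled by a sup bound and the mass of `v`. -/
theorem lintegral_inv_norm_sq_mul_le {v : E3 → ℝ≥0∞} (hv : AEMeasurable v) {b : ℝ≥0∞}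
    (hb : ∀ᵐ x, v x ≤ b) (x : E3) :
    ∫⁻ y : E3, ENNReal.ofReal (‖x - y‖ ^ 2)⁻¹ * v y ≤ ballMass * b + ∫⁻ y, v y := by
  have h1 : ∀ y : E3, ENNReal.ofReal (‖x - y‖ ^ 2)⁻¹ ≤
      (Metric.ball (0 : E3) 1).indicator (fun z => ENNReal.ofReal (‖z‖ ^ 2)⁻¹) (x - y) + 1 := by
    intro y
    by_cases h : x - y ∈ Metric.ball (0 : E3) 1
    · rw [indicator_of_mem h]; exact le_self_add
    · rw [indicator_of_notMem h, zero_add, ENNReal.ofReal_le_one]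
      have : 1 ≤ ‖x - y‖ := by simpa using h
      exact inv_le_one_of_one_le₀ (one_le_pow₀ this)
  have hm : Measurable fun y : E3 =>
      (Metric.ball (0 : E3) 1).indicator (fun z => ENNReal.ofReal (‖z‖ ^ 2)⁻¹) (x - y) :=
    (Measurable.indicator (by fun_prop) Metric.isOpen_ball.measurableSet).comp
      (measurable_const.sub measurable_id)
  calc ∫⁻ y : E3, ENNReal.ofReal (‖x - y‖ ^ 2)⁻¹ * v y
      ≤ ∫⁻ y : E3, ((Metric.ball (0 : E3) 1).indicator
          (fun z => ENNReal.ofReal (‖z‖ ^ 2)⁻¹) (x - y) * b + v y) := by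
        refine lintegral_mono_ae (hb.mono fun y hy => ?_)
        calc _ ≤ ((Metric.ball (0 : E3) 1).indicator
            (fun z => ENNReal.ofReal (‖z‖ ^ 2)⁻¹) (x - y) + 1) * v y := by gcongr; exact h1 y
          _ ≤ _ := by rw [add_mul, one_mul]; gcongr
    _ = _ := by
        rw [lintegral_add_right' _ hv, lintegral_mul_const _ hm,
          lintegral_sub_left_eq_self (fun z : E3 => (Metric.ball (0 : E3) 1).indicator
            (fun z => ENNReal.ofReal (‖z‖ ^ 2)⁻¹) z) x, lintegral_indicator
            Metric.isOpen_ball.measurableSet, ballMass]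

/-- The Coulomb kernel itself is thus handled by the estimates for `‖z‖⁻²`. -/
theorem inv_norm_le (z : E3) : ENNReal.ofReal ‖z‖⁻¹ ≤ ENNReal.ofReal (‖z‖ ^ 2)⁻¹ + 1 := by
  rw [← ENNReal.ofReal_one, ← ENNReal.ofReal_add (by positivity) (by norm_num)]
  apply ENNReal.ofReal_le_ofReal
  rw [← inv_pow]
  nlinarith [sq_nonneg (‖z‖⁻¹ - 1), sq_nonneg ‖z‖⁻¹]

theorem lintegral_inv_norm_mul_le {v : E3 → ℝ≥0∞} (hv : AEMeasurable v) {b : ℝ≥0∞}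
    (hb : ∀ᵐ x, v x ≤ b) (x : E3) :
    ∫⁻ y : E3, ENNReal.ofReal ‖x - y‖⁻¹ * v y ≤ ballMass * b + 2 * ∫⁻ y, v y := by
  calc ∫⁻ y : E3, ENNReal.ofReal ‖x - y‖⁻¹ * v y
      ≤ ∫⁻ y : E3, (ENNReal.ofReal (‖x - y‖ ^ 2)⁻¹ * v y + v y) := by
        refine lintegral_mono fun y => ?_
        rw [← add_one_mul]
        gcongr
        exact inv_norm_le _
    _ ≤ _ := by
        rw [lintegral_add_right' _ hv, two_mul, ← add_assoc]
        gcongr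
        exact lintegral_inv_norm_sq_mul_le hv hb x

/-! ### Plancherel and uniqueness of distributional transforms -/

open scoped FourierTransform SchwartzMap

theorem ae_eq_of_forall_schwartz {f g : E3 → ℂ} (hf : LocallyIntegrable f volume)
    (hg : LocallyIntegrable g volume)
    (h : ∀ φ : SchwartzMap E3 ℂ, ∫ x, f x * φ x = ∫ x, g x * φ x) : f =ᵐ[volume] g := by
  refine ae_eq_of_integral_contDiff_smul_eq hf hg fun φ hφ hφc => ?_
  have h1 : HasCompactSupport (fun x => (φ x : ℂ)) := hφc.comp_left Complex.ofReal_zero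
  have h2 := h (h1.toSchwartzMap (Complex.ofRealCLM.contDiff.comp hφ))
  simp_rw [Complex.real_smul, mul_comm (Complex.ofReal _)]
  exact h2

/-- Plancherel is known for the Fourier transform on `L²`. That transform agrees almost everywhere
with the Fourier integral of an `L¹ ∩ L²` function, because the two act alike on Schwartz functions.
-/
theorem eLpNorm_fourier_eq {f : E3 → ℂ} (h1 : Integrable f) (h2 : MemLp f 2) :
    eLpNorm (𝓕 f) 2 = eLpNorm f 2 := by
  have hae : (𝓕 (h2.toLp f) : Lp ℂ 2 (volume : Measure E3)) =ᵐ[volume] 𝓕 f := by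
    refine ae_eq_of_forall_schwartz
      ((Lp.memLp _).locallyIntegrable (by norm_num)) ?_ fun φ => ?_
    · exact (VectorFourier.fourierIntegral_continuous Real.continuous_fourierChar
        (innerSL ℝ).continuous₂ h1).locallyIntegrable
    · have e1 := congrArg (fun S => S φ) (Lp.fourier_toTemperedDistribution_eq (h2.toLp f))
      simp only [TemperedDistribution.fourier_apply, Lp.toTemperedDistribution_apply,
        smul_eq_mul] at e1
      have e2 : ∫ x, (𝓕 φ) x * (h2.toLp f) x = ∫ x, (𝓕 φ) x * f x :=
        integral_congr_ae (h2.coeFn_toLp.mono fun x hx => by simp only [hx])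
      have e3 := VectorFourier.integral_fourierIntegral_smul_eq_flip (L := innerₗ E3)
        (μ := volume) (ν := volume) Real.continuous_fourierChar continuous_inner
        (f := φ) (g := f) φ.integrable h1
      simp_rw [mul_comm _ (φ _)]
      rw [← e1, e2]
      rw [flip_innerₗ] at e3
      exact e3
  have := Lp.norm_fourier_eq (h2.toLp f)
  rw [Lp.norm_def, Lp.norm_def, ENNReal.toReal_eq_toReal_iff' (Lp.eLpNorm_ne_top _)
    (Lp.eLpNorm_ne_top _), eLpNorm_congr_ae hae, eLpNorm_congr_ae h2.coeFn_toLp] at this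
  exact this

end WignerPoisson

namespace WignerPoisson

open scoped FourierTransform SchwartzMap

/-! ### The Fourier transform of the Coulomb potential -/

/-- Read backwards, this writes `1/r` as a superposition of Gaussians in `r`, whose Fourier
transforms are explicit. -/
theorem integral_exp_neg_sq_mul_sq {r : ℝ} (hr : 0 < r) :
    ∫ u in Ioi (0 : ℝ), Real.exp (-r ^ 2 * u ^ 2) = √Real.pi / (2 * r) := by
  rw [integral_gaussian_Ioi, Real.sqrt_div Real.pi_pos.le, Real.sqrt_sq hr.le]
  field_simp

theorem inv_cube_exp_hasDerivAt (a : ℝ) {u : ℝ} (hu : 0 < u) :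
    HasDerivAt (fun u : ℝ => Real.exp (-(a ^ 2 / (4 * u ^ 2))))
      (a ^ 2 / 2 * (Real.exp (-(a ^ 2 / (4 * u ^ 2))) / u ^ 3)) u := by
  have h1 : HasDerivAt (fun u : ℝ => -(a ^ 2 / (4 * u ^ 2))) (a ^ 2 / 2 / u ^ 3) u := by
    have h2 := ((hasDerivAt_pow 2 u).const_mul 4).inv (by positivity : (4 : ℝ) * u ^ 2 ≠ 0)
    have h3 := (h2.const_mul (a ^ 2)).neg
    refine (h3.congr_deriv ?_).congr_of_eventuallyEq (Eventually.of_forall fun v => ?_)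
    · field_simp; ring
    · simp [div_eq_mul_inv]
  refine h1.exp.congr_deriv ?_
  ring

/-- The integrand is, up to the factor `2/a²`, the derivative of `e^{-a²/(4u²)}`, which increases
from `0` to `1`. -/
theorem inv_cube_exp_integral {a : ℝ} (ha : 0 < a) :
    IntegrableOn (fun u : ℝ => Real.exp (-(a ^ 2 / (4 * u ^ 2))) / u ^ 3) (Ioi 0) ∧
      ∫ u in Ioi (0 : ℝ), Real.exp (-(a ^ 2 / (4 * u ^ 2))) / u ^ 3 = 2 / a ^ 2 := by
  have hne : a ^ 2 / 2 ≠ 0 := by positivity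
  -- The value at `0` is corrected: division by zero would make the exponential equal to `1` there,
  -- while its limit is `0`.
  set g : ℝ → ℝ := fun u => if u = 0 then 0 else Real.exp (-(a ^ 2 / (4 * u ^ 2))) with hg
  have hgpos : ∀ u ∈ Ioi (0 : ℝ), HasDerivAt g
      (a ^ 2 / 2 * (Real.exp (-(a ^ 2 / (4 * u ^ 2))) / u ^ 3)) u := by
    intro u hu
    refine (inv_cube_exp_hasDerivAt a hu).congr_of_eventuallyEq ?_
    filter_upwards [lt_mem_nhds hu] with v hv
    simp [hg, (ne_of_gt hv : v ≠ 0)]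
  have h0 : ContinuousWithinAt g (Ici 0) 0 := by
    rw [← continuousWithinAt_Ioi_iff_Ici]
    have : Tendsto (fun u : ℝ => Real.exp (-(a ^ 2 / (4 * u ^ 2)))) (𝓝[>] 0) (𝓝 0) := by
      refine Real.tendsto_exp_neg_atTop_nhds_zero.comp ?_
      have h1 : Tendsto (fun u : ℝ => (4 * u ^ 2)⁻¹) (𝓝[>] 0) atTop := by
        refine tendsto_inv_nhdsGT_zero.comp (tendsto_nhdsWithin_iff.2 ⟨?_, ?_⟩)
        · have : Tendsto (fun u : ℝ => 4 * u ^ 2) (𝓝 0) (𝓝 (4 * 0 ^ 2)) :=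
            Continuous.tendsto (by fun_prop) 0
          simpa using this.mono_left nhdsWithin_le_nhds
        · filter_upwards [self_mem_nhdsWithin] with u hu
          have : 0 < u := hu
          exact mem_Ioi.2 (by positivity)
      exact h1.const_mul_atTop (by positivity : 0 < a ^ 2)
    unfold ContinuousWithinAt
    have hg0 : g 0 = 0 := by simp [hg]
    rw [hg0]
    refine this.congr' ?_
    filter_upwards [self_mem_nhdsWithin] with u hu
    simp [hg, (ne_of_gt hu : u ≠ 0)]
  have hinf : Tendsto g atTop (𝓝 1) := by
    have : Tendsto (fun u : ℝ => Real.exp (-(a ^ 2 / (4 * u ^ 2)))) atTop (𝓝 1) := by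
      rw [← Real.exp_zero]
      refine (Real.continuous_exp.tendsto 0).comp ?_
      have h1 : Tendsto (fun u : ℝ => a ^ 2 / (4 * u ^ 2)) atTop (𝓝 0) :=
        Tendsto.div_atTop tendsto_const_nhds
          ((tendsto_pow_atTop two_ne_zero).const_mul_atTop (by norm_num))
      simpa using h1.neg
    refine this.congr' ?_
    filter_upwards [eventually_gt_atTop 0] with u hu
    simp [hg, hu.ne']
  have hnn : ∀ u ∈ Ioi (0 : ℝ),
      0 ≤ a ^ 2 / 2 * (Real.exp (-(a ^ 2 / (4 * u ^ 2))) / u ^ 3) := by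
    intro u hu
    have : 0 < u := hu
    positivity
  have hint := integrableOn_Ioi_deriv_of_nonneg h0 hgpos hnn hinf
  have hval := integral_Ioi_of_hasDerivAt_of_nonneg h0 hgpos hnn hinf
  constructor
  · have : IntegrableOn (fun u : ℝ => (a ^ 2 / 2)⁻¹ *
        (a ^ 2 / 2 * (Real.exp (-(a ^ 2 / (4 * u ^ 2))) / u ^ 3))) (Ioi 0) := hint.const_mul _
    refine this.congr_fun (fun u _ => ?_) measurableSet_Ioi
    dsimp only
    rw [inv_mul_cancel_left₀ hne]
  · rw [integral_const_mul] at hval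
    have hg0 : g 0 = 0 := by simp [hg]
    rw [hg0, sub_zero] at hval
    field_simp at hval ⊢
    linarith

/-- The Fourier character `e^{i x·ξ}`. -/
noncomputable def planeWave (x ξ : E3) : ℂ := Complex.exp (Complex.I * ((inner ℝ x ξ : ℝ) : ℂ))

theorem norm_planeWave (x ξ : E3) : ‖planeWave x ξ‖ = 1 := by
  unfold planeWave
  rw [mul_comm, Complex.norm_exp_ofReal_mul_I]

theorem continuous_planeWave : Continuous fun p : E3 × E3 => planeWave p.1 p.2 := by
  unfold planeWave; fun_prop

theorem measurable_planeWave : Measurable fun p : E3 × E3 => planeWave p.1 p.2 :=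
  continuous_planeWave.measurable

theorem integral_gaussian_planeWave {u : ℝ} (hu : 0 < u) (y ξ : E3) :
    ∫ x : E3, (Real.exp (-u ^ 2 * ‖x - y‖ ^ 2) : ℂ) * planeWave x ξ =
      ((Real.pi * √Real.pi / u ^ 3 * Real.exp (-(‖ξ‖ ^ 2 / (4 * u ^ 2))) : ℝ) : ℂ) *
        planeWave y ξ := by
  have hb : 0 < ((u ^ 2 : ℝ) : ℂ).re := by rw [Complex.ofReal_re]; positivity
  have h1 := GaussianFourier.integral_cexp_neg_mul_sq_norm_add (V := E3) hb Complex.I ξ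
  rw [← integral_add_right_eq_self (fun x : E3 =>
    (Real.exp (-u ^ 2 * ‖x - y‖ ^ 2) : ℂ) * planeWave x ξ) y]
  have h2 : ∀ x : E3, (Real.exp (-u ^ 2 * ‖x + y - y‖ ^ 2) : ℂ) * planeWave (x + y) ξ =
      Complex.exp (-((u ^ 2 : ℝ) : ℂ) * ‖x‖ ^ 2 + Complex.I * ((inner ℝ ξ x : ℝ) : ℂ)) *
        planeWave y ξ := by
    intro x
    unfold planeWave
    rw [add_sub_cancel_right, inner_add_left, real_inner_comm x ξ, Complex.ofReal_exp,
      ← Complex.exp_add, ← Complex.exp_add]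
    congr 1
    push_cast
    ring
  simp_rw [h2]
  rw [integral_mul_const, h1]
  congr 1
  rw [Complex.ofReal_mul]
  congr 1
  · have : (((Module.finrank ℝ E3 : ℕ) : ℂ) / 2) = ((3 / 2 : ℝ) : ℂ) := by simp
    rw [this, ← Complex.ofReal_div, ← Complex.ofReal_cpow (by positivity)]
    congr 1
    rw [Real.div_rpow Real.pi_pos.le (by positivity), ← Real.rpow_natCast u 2,
      ← Real.rpow_mul hu.le]
    norm_num
    rw [show (3 / 2 : ℝ) = 1 + 1 / 2 by norm_num, Real.rpow_add Real.pi_pos, Real.rpow_one,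
      ← Real.sqrt_eq_rpow]
  · rw [Complex.ofReal_exp]
    congr 1
    rw [Complex.I_sq]
    push_cast
    ring

theorem integrable_gaussian_sub {u : ℝ} (hu : 0 < u) (y : E3) :
    Integrable fun x : E3 => Real.exp (-u ^ 2 * ‖x - y‖ ^ 2) := by
  have h := GaussianFourier.integrable_cexp_neg_mul_sq_norm_add (V := E3) (b := ((u ^ 2 : ℝ) : ℂ))
    (by rw [Complex.ofReal_re]; positivity) 0 0
  have h2 := (h.re).comp_sub_right y
  refine h2.congr (Eventually.of_forall fun x => ?_)
  have : (-((u ^ 2 : ℝ) : ℂ) * (‖x - y‖ : ℂ) ^ 2 + 0 * ((inner ℝ (0 : E3) (x - y) : ℝ) : ℂ)) =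
      ((-u ^ 2 * ‖x - y‖ ^ 2 : ℝ) : ℂ) := by push_cast; ring
  simp only [this]
  rw [← Complex.ofReal_exp]
  exact Complex.ofReal_re _

/-! ### Inverse Fourier integrals of Schwartz functions -/

theorem invFourierSchwartz_eq_planeWave (φ : SchwartzMap E3 ℂ) (x : E3) :
    invFourierSchwartz φ x = (((2 * Real.pi) ^ 3)⁻¹ : ℝ) * ∫ ξ : E3, φ ξ * planeWave x ξ := rfl

/-- Passing to the inverse transform with kernel `e^{2πi x·ξ}` is a rescaling, so integrability,
continuity and boundedness are inherited from Schwartz functions. -/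
theorem invFourierSchwartz_eq_comp_smul (φ : SchwartzMap E3 ℂ) (x : E3) :
    invFourierSchwartz φ x = (((2 * Real.pi) ^ 3)⁻¹ : ℝ) * (𝓕⁻ φ) ((2 * Real.pi)⁻¹ • x) := by
  rw [invFourierSchwartz_eq_planeWave, SchwartzMap.fourierInv_coe, Real.fourierInv_eq']
  congr 2 with ξ
  rw [smul_eq_mul, mul_comm, planeWave]
  congr 2
  rw [inner_smul_right, real_inner_comm x ξ, mul_inv_cancel_left₀ (by positivity)]
  ring

theorem integrable_invFourierSchwartz (φ : SchwartzMap E3 ℂ) :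
    Integrable (invFourierSchwartz φ) := by
  rw [funext (invFourierSchwartz_eq_comp_smul φ)]
  exact ((𝓕⁻ φ).integrable.comp_smul (by positivity)).const_mul _

theorem continuous_invFourierSchwartz (φ : SchwartzMap E3 ℂ) :
    Continuous (invFourierSchwartz φ) := by
  rw [funext (invFourierSchwartz_eq_comp_smul φ)]
  have := (𝓕⁻ φ).continuous
  fun_prop

theorem exists_norm_invFourierSchwartz_le (φ : SchwartzMap E3 ℂ) :
    ∃ b : ℝ≥0∞, b ≠ ∞ ∧ ∀ x, ‖invFourierSchwartz φ x‖ₑ ≤ b := by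
  obtain ⟨C, hC⟩ := (𝓕⁻ φ).decay' 0 0
  refine ⟨‖((((2 * Real.pi) ^ 3)⁻¹ : ℝ) : ℂ)‖ₑ * ENNReal.ofReal C, by finiteness, fun x => ?_⟩
  rw [invFourierSchwartz_eq_comp_smul, enorm_mul]
  gcongr
  rw [← ofReal_norm]
  apply ENNReal.ofReal_le_ofReal
  have := hC ((2 * Real.pi)⁻¹ • x)
  rw [pow_zero, one_mul, norm_iteratedFDeriv_zero] at this
  exact this

end WignerPoisson

namespace WignerPoisson

open scoped FourierTransform SchwartzMap

theorem integrable_inv_norm_mul {ψ : E3 → ℂ} (h1 : Integrable ψ) {b : ℝ≥0∞} (hb : b ≠ ∞)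
    (hψ : ∀ x, ‖ψ x‖ₑ ≤ b) (y : E3) :
    Integrable fun x : E3 => ((‖x - y‖⁻¹ : ℝ) : ℂ) * ψ x := by
  refine ⟨AEStronglyMeasurable.mul (by fun_prop) h1.1, ?_⟩
  have h := lintegral_inv_norm_mul_le h1.1.enorm (Eventually.of_forall hψ) y
  refine lt_of_le_of_lt (le_of_eq ?_) (h.trans_lt ?_)
  · congr 1 with x
    rw [enorm_mul, norm_sub_rev, ← ofReal_norm ((‖y - x‖⁻¹ : ℝ) : ℂ), Complex.norm_real,
      Real.norm_of_nonneg (by positivity)]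
  · have h2 : ∫⁻ x, ‖ψ x‖ₑ < ∞ := h1.2
    have := ballMass_ne_top
    finiteness

theorem integrable_schwartz_div_norm_sq (φ : SchwartzMap E3 ℂ) :
    Integrable fun ξ : E3 => φ ξ * (((‖ξ‖ ^ 2)⁻¹ : ℝ) : ℂ) := by
  obtain ⟨C, hC⟩ := φ.decay' 0 0
  have hφ : ∀ ξ, ‖φ ξ‖ₑ ≤ ENNReal.ofReal C := fun ξ => by
    rw [← ofReal_norm]
    apply ENNReal.ofReal_le_ofReal
    have := hC ξ
    rw [pow_zero, one_mul, norm_iteratedFDeriv_zero] at this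
    exact this
  refine ⟨φ.integrable.1.mul (by fun_prop), ?_⟩
  have h := lintegral_inv_norm_sq_mul_le φ.integrable.1.enorm (Eventually.of_forall hφ) 0
  refine lt_of_le_of_lt (le_of_eq ?_) (h.trans_lt ?_)
  · congr 1 with x
    rw [enorm_mul, mul_comm, zero_sub, norm_neg, ← ofReal_norm (((‖x‖ ^ 2)⁻¹ : ℝ) : ℂ),
      Complex.norm_real, Real.norm_of_nonneg (by positivity)]
  · have h2 : ∫⁻ x, ‖φ x‖ₑ < ∞ := φ.integrable.2
    have := ballMass_ne_top
    finiteness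

theorem integral_gaussian_invFourierSchwartz (φ : SchwartzMap E3 ℂ) {u : ℝ} (hu : 0 < u) (y : E3) :
    ∫ x : E3, (Real.exp (-u ^ 2 * ‖x - y‖ ^ 2) : ℂ) * invFourierSchwartz φ x =
      (((2 * Real.pi) ^ 3)⁻¹ : ℝ) * ∫ ξ : E3, φ ξ * planeWave y ξ *
        ((Real.pi * √Real.pi / u ^ 3 * Real.exp (-(‖ξ‖ ^ 2 / (4 * u ^ 2))) : ℝ) : ℂ) := by
  have hint : Integrable (fun p : E3 × E3 =>
      (Real.exp (-u ^ 2 * ‖p.1 - y‖ ^ 2) : ℂ) * φ p.2 * planeWave p.1 p.2)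
      ((volume : Measure E3).prod volume) := by
    refine (((integrable_gaussian_sub hu y).ofReal).mul_prod φ.integrable).mul_bdd (c := 1)
      measurable_planeWave.aestronglyMeasurable (Eventually.of_forall fun p => ?_)
    rw [norm_planeWave]
  calc ∫ x : E3, (Real.exp (-u ^ 2 * ‖x - y‖ ^ 2) : ℂ) * invFourierSchwartz φ x
      = (((2 * Real.pi) ^ 3)⁻¹ : ℝ) * ∫ x : E3, ∫ ξ : E3,
          (Real.exp (-u ^ 2 * ‖x - y‖ ^ 2) : ℂ) * φ ξ * planeWave x ξ := by
        rw [← integral_const_mul]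
        congr 1 with x
        rw [invFourierSchwartz_eq_planeWave, mul_left_comm, ← integral_const_mul]
        simp_rw [mul_assoc]
    _ = (((2 * Real.pi) ^ 3)⁻¹ : ℝ) * ∫ ξ : E3, ∫ x : E3,
          (Real.exp (-u ^ 2 * ‖x - y‖ ^ 2) : ℂ) * φ ξ * planeWave x ξ := by
        rw [integral_integral_swap hint]
    _ = _ := by
        congr 2 with ξ
        have : ∀ x : E3, (Real.exp (-u ^ 2 * ‖x - y‖ ^ 2) : ℂ) * φ ξ * planeWave x ξ =
            φ ξ * ((Real.exp (-u ^ 2 * ‖x - y‖ ^ 2) : ℂ) * planeWave x ξ) := fun x => by ring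
        simp_rw [this]
        rw [integral_const_mul, integral_gaussian_planeWave hu]
        ring

theorem ae_ne_point (y : E3) : ∀ᵐ x : E3, x ≠ y := by
  rw [ae_iff]
  simp

/-- Justifies Fubini in the superposition of Gaussians: the `u`-integral of the absolute value is
`(√π/2) ‖x - y‖⁻¹ |ψ(x)|`, which is integrable in `x`. -/
theorem integrable_gaussian_mul_prod {ψ : E3 → ℂ} (hψi : Integrable ψ) (hcψ : Continuous ψ)
    {b : ℝ≥0∞} (hb : b ≠ ∞) (hψb : ∀ x, ‖ψ x‖ₑ ≤ b) (y : E3) :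
    Integrable (fun p : E3 × ℝ => (Real.exp (-p.2 ^ 2 * ‖p.1 - y‖ ^ 2) : ℂ) * ψ p.1)
      (volume.prod (volume.restrict (Ioi 0))) := by
  have hpi := Real.pi_pos
  have hsp : 0 < √Real.pi := Real.sqrt_pos.2 hpi
  set μ : Measure ℝ := volume.restrict (Ioi 0) with hμ
  have hm : AEStronglyMeasurable (fun p : E3 × ℝ =>
    (Real.exp (-p.2 ^ 2 * ‖p.1 - y‖ ^ 2) : ℂ) * ψ p.1) (volume.prod μ) :=
    Continuous.aestronglyMeasurable (by fun_prop)
  rw [integrable_prod_iff hm]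
  constructor
  · filter_upwards [ae_ne_point y] with x hx
    have hr : 0 < ‖x - y‖ := norm_pos_iff.2 (sub_ne_zero.2 hx)
    have h1 : IntegrableOn (fun u : ℝ => Real.exp (-‖x - y‖ ^ 2 * u ^ 2)) (Ioi 0) :=
      (integrable_exp_neg_mul_sq (by positivity)).integrableOn
    refine (h1.ofReal (𝕜 := ℂ)).mul_const (ψ x) |>.congr (Eventually.of_forall fun u => ?_)
    dsimp only
    congr 3
    ring
  · refine ((integrable_inv_norm_mul hψi hb hψb y).norm.const_mul (√Real.pi / 2)).congr ?_
    filter_upwards [ae_ne_point y] with x hx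
    have hr : 0 < ‖x - y‖ := norm_pos_iff.2 (sub_ne_zero.2 hx)
    have h2 : ∀ u : ℝ, ‖(Real.exp (-u ^ 2 * ‖x - y‖ ^ 2) : ℂ) * ψ x‖ =
        Real.exp (-‖x - y‖ ^ 2 * u ^ 2) * ‖ψ x‖ := fun u => by
      rw [norm_mul, Complex.norm_real, Real.norm_of_nonneg (Real.exp_pos _).le]
      congr 2
      ring
    simp_rw [h2]
    rw [integral_mul_const, hμ, integral_exp_neg_sq_mul_sq hr, norm_mul, Complex.norm_real,
      Real.norm_of_nonneg (by positivity)]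
    field_simp

theorem measurable_inv_cube_exp : Measurable fun p : E3 × ℝ =>
    ((Real.exp (-(‖p.1‖ ^ 2 / (4 * p.2 ^ 2))) / p.2 ^ 3 : ℝ) : ℂ) := by
  fun_prop

/-- The same on the Fourier side: the `u`-integral of the absolute value is `2 |a(ξ)| ‖ξ‖⁻²`. -/
theorem integrable_inv_cube_exp_prod {a : E3 → ℂ} (ha : Measurable a)
    (hint : Integrable fun ξ => a ξ * (((‖ξ‖ ^ 2)⁻¹ : ℝ) : ℂ)) :
    Integrable (fun p : E3 × ℝ => a p.1 *
      ((Real.exp (-(‖p.1‖ ^ 2 / (4 * p.2 ^ 2))) / p.2 ^ 3 : ℝ) : ℂ))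
      (volume.prod (volume.restrict (Ioi 0))) := by
  have hm : AEStronglyMeasurable (fun p : E3 × ℝ => a p.1 *
      ((Real.exp (-(‖p.1‖ ^ 2 / (4 * p.2 ^ 2))) / p.2 ^ 3 : ℝ) : ℂ))
      (volume.prod (volume.restrict (Ioi 0))) :=
    ((ha.comp measurable_fst).mul measurable_inv_cube_exp).aestronglyMeasurable
  refine (integrable_prod_iff hm).2 ⟨?_, ?_⟩
  · filter_upwards [ae_ne_point 0] with ξ hξ
    exact ((inv_cube_exp_integral (norm_pos_iff.2 hξ)).1.ofReal (𝕜 := ℂ)).const_mul _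
  · refine (hint.norm.const_mul 2).congr ?_
    filter_upwards [ae_ne_point 0] with ξ hξ
    have hr : 0 < ‖ξ‖ := norm_pos_iff.2 hξ
    have h2 : ∀ᵐ u ∂(volume.restrict (Ioi 0)),
        ‖a ξ * ((Real.exp (-(‖ξ‖ ^ 2 / (4 * u ^ 2))) / u ^ 3 : ℝ) : ℂ)‖ =
        ‖a ξ‖ * (Real.exp (-(‖ξ‖ ^ 2 / (4 * u ^ 2))) / u ^ 3) := by
      filter_upwards [ae_restrict_mem measurableSet_Ioi] with u hu
      have : 0 < u := hu
      rw [norm_mul, Complex.norm_real, Real.norm_of_nonneg (by positivity)]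
    rw [integral_congr_ae h2, integral_const_mul, (inv_cube_exp_integral hr).2, norm_mul,
      Complex.norm_real, Real.norm_of_nonneg (by positivity)]
    field_simp

theorem integrable_schwartz_planeWave_div (φ : SchwartzMap E3 ℂ) (y : E3) :
    Integrable fun ξ => φ ξ * planeWave y ξ * (((‖ξ‖ ^ 2)⁻¹ : ℝ) : ℂ) := by
  have h := (integrable_schwartz_div_norm_sq φ).mul_bdd (c := 1) (g := fun ξ => planeWave y ξ)
    (measurable_planeWave.comp measurable_prodMk_left).aestronglyMeasurable
    (Eventually.of_forall fun ξ => (norm_planeWave y ξ).le)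
  refine h.congr (Eventually.of_forall fun ξ => ?_)
  dsimp only
  ring

set_option maxHeartbeats 1000000 in
/-- The Fourier transform of the Coulomb kernel, tested against a Schwartz function. -/
theorem integral_coulomb_invFourierSchwartz (φ : SchwartzMap E3 ℂ) (y : E3) :
    ∫ x : E3, ((‖x - y‖⁻¹ : ℝ) : ℂ) * invFourierSchwartz φ x =
      ((4 * Real.pi * ((2 * Real.pi) ^ 3)⁻¹ : ℝ) : ℂ) *
        ∫ ξ : E3, φ ξ * planeWave y ξ * (((‖ξ‖ ^ 2)⁻¹ : ℝ) : ℂ) := by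
  set ψ := invFourierSchwartz φ with hψ
  have hpi := Real.pi_pos
  have hsp : 0 < √Real.pi := Real.sqrt_pos.2 hpi
  obtain ⟨b, hb, hψb⟩ := exists_norm_invFourierSchwartz_le φ
  have hψi : Integrable ψ := integrable_invFourierSchwartz φ
  have hcψ : Continuous ψ := continuous_invFourierSchwartz φ
  set μ : Measure ℝ := volume.restrict (Ioi 0) with hμ
  have hF := integrable_gaussian_mul_prod hψi hcψ hb hψb y
  have hG := integrable_inv_cube_exp_prod (a := fun ξ => φ ξ * planeWave y ξ)
    (φ.continuous.measurable.mul (measurable_planeWave.comp measurable_prodMk_left))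
    (integrable_schwartz_planeWave_div φ y)
  rw [← hμ] at hF hG
  -- The Coulomb kernel is written as a superposition of Gaussians over `u > 0`, each Gaussian is
  -- transformed, and the `u`-integral on the Fourier side produces `2 ‖ξ‖⁻²`.
  calc ∫ x : E3, ((‖x - y‖⁻¹ : ℝ) : ℂ) * ψ x
      = ∫ x : E3, ((2 / √Real.pi : ℝ) : ℂ) *
          ∫ u, (Real.exp (-u ^ 2 * ‖x - y‖ ^ 2) : ℂ) * ψ x ∂μ := by
        refine integral_congr_ae ?_
        filter_upwards [ae_ne_point y] with x hx
        have hr : 0 < ‖x - y‖ := norm_pos_iff.2 (sub_ne_zero.2 hx)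
        have h3 : ∀ u : ℝ, ((Real.exp (-u ^ 2 * ‖x - y‖ ^ 2) : ℝ) : ℂ) =
          ((Real.exp (-‖x - y‖ ^ 2 * u ^ 2) : ℝ) : ℂ) := fun u => by congr 2; ring
        rw [integral_mul_const]
        simp_rw [h3]
        rw [integral_complex_ofReal, hμ, integral_exp_neg_sq_mul_sq hr, ← mul_assoc,
          ← Complex.ofReal_mul]
        congr 2
        field_simp
    _ = ((2 / √Real.pi : ℝ) : ℂ) * ∫ u, (∫ x : E3,
          (Real.exp (-u ^ 2 * ‖x - y‖ ^ 2) : ℂ) * ψ x) ∂μ := by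
        rw [integral_const_mul, integral_integral_swap hF]
    _ = ((2 / √Real.pi : ℝ) : ℂ) * ∫ u, (((2 * Real.pi) ^ 3)⁻¹ * (Real.pi * √Real.pi) : ℝ) *
          (∫ ξ : E3, φ ξ * planeWave y ξ *
            ((Real.exp (-(‖ξ‖ ^ 2 / (4 * u ^ 2))) / u ^ 3 : ℝ) : ℂ)) ∂μ := by
        congr 1
        refine integral_congr_ae ?_
        filter_upwards [ae_restrict_mem measurableSet_Ioi] with u hu
        rw [hψ, integral_gaussian_invFourierSchwartz φ hu, Complex.ofReal_mul _ (Real.pi * √Real.pi),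
          mul_assoc]
        congr 1
        rw [← integral_const_mul (Complex.ofReal (Real.pi * √Real.pi))]
        refine integral_congr_ae (Eventually.of_forall fun ξ => ?_)
        push_cast
        ring
    _ = ((2 / √Real.pi : ℝ) : ℂ) * ((((2 * Real.pi) ^ 3)⁻¹ * (Real.pi * √Real.pi) : ℝ) *
          ∫ ξ : E3, ∫ u, φ ξ * planeWave y ξ *
            ((Real.exp (-(‖ξ‖ ^ 2 / (4 * u ^ 2))) / u ^ 3 : ℝ) : ℂ) ∂μ) := by
        rw [integral_const_mul, ← integral_integral_swap hG]
    _ = ((2 / √Real.pi : ℝ) : ℂ) * ((((2 * Real.pi) ^ 3)⁻¹ * (Real.pi * √Real.pi) : ℝ) *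
          ∫ ξ : E3, 2 * (φ ξ * planeWave y ξ * (((‖ξ‖ ^ 2)⁻¹ : ℝ) : ℂ))) := by
        congr 2
        refine integral_congr_ae ?_
        filter_upwards [ae_ne_point 0] with ξ hξ
        rw [integral_const_mul, integral_complex_ofReal, hμ,
          (inv_cube_exp_integral (norm_pos_iff.2 hξ)).2]
        push_cast
        ring
    _ = _ := by
        rw [integral_const_mul, ← mul_assoc, ← mul_assoc, ← Complex.ofReal_mul]
        congr 1
        rw [show (2 : ℂ) = ((2 : ℝ) : ℂ) by simp, ← Complex.ofReal_mul]
        congr 1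
        field_simp
        ring

end WignerPoisson

namespace WignerPoisson

open scoped FourierTransform SchwartzMap

/-! ### The transform of a Coulomb potential -/

/-- The Fourier integral `∫ n(y) e^{i y·ξ} dy`. -/
noncomputable def charIntegral (n : E3 → ℝ) (ξ : E3) : ℂ := ∫ y : E3, (n y : ℂ) * planeWave y ξ

/-- The Fourier multiplier `(2π)⁻³ |ξ|⁻²` applied to the Fourier integral of `n`. -/
noncomputable def poissonSymbol (n : E3 → ℝ) (ξ : E3) : ℂ :=
  ((((2 * Real.pi) ^ 3)⁻¹ : ℝ) : ℂ) * (charIntegral n ξ * (((‖ξ‖ ^ 2)⁻¹ : ℝ) : ℂ))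

/-- The Coulomb potential of the density `n`. -/
noncomputable def coulomb (n : E3 → ℝ) (x : E3) : ℝ := ∫ y : E3, 1 / (4 * Real.pi * ‖x - y‖) * n y

theorem potential_eq_coulomb (f : Phase → ℝ) : potential f = coulomb (density f) := rfl

theorem charIntegral_eq_fourier (n : E3 → ℝ) (ξ : E3) :
    charIntegral n ξ = 𝓕 (fun y => (n y : ℂ)) ((-(2 * Real.pi)⁻¹) • ξ) := by
  rw [Real.fourier_eq', charIntegral]
  congr 1 with y
  rw [smul_eq_mul, mul_comm, planeWave]
  congr 2
  rw [inner_smul_right]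
  have : 2 * Real.pi ≠ 0 := by positivity
  have h : -2 * Real.pi * (-(2 * Real.pi)⁻¹ * inner ℝ y ξ) = inner ℝ y ξ := by field_simp
  rw [h, mul_comm]

theorem charIntegral_congr {n n' : E3 → ℝ} (h : n =ᵐ[volume] n') :
    charIntegral n = charIntegral n' := by
  funext ξ
  exact integral_congr_ae (h.mono fun y hy => by simp only [hy])

theorem integrable_mul_planeWave {n : E3 → ℝ} (hn : Integrable n) (ξ : E3) :
    Integrable fun y => (n y : ℂ) * planeWave y ξ :=
  hn.ofReal.mul_bdd (c := 1) (g := fun y => planeWave y ξ)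
    (measurable_planeWave.comp measurable_prodMk_right).aestronglyMeasurable
    (Eventually.of_forall fun y => (norm_planeWave y ξ).le)

theorem charIntegral_sub {n n' : E3 → ℝ} (hn : Integrable n) (hn' : Integrable n') (ξ : E3) :
    charIntegral (fun y => n y - n' y) ξ = charIntegral n ξ - charIntegral n' ξ := by
  unfold charIntegral
  rw [← integral_sub (integrable_mul_planeWave hn ξ) (integrable_mul_planeWave hn' ξ)]
  congr 1 with y
  push_cast
  ring

theorem poissonSymbol_sub {n n' : E3 → ℝ} (hn : Integrable n) (hn' : Integrable n') (ξ : E3) :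
    poissonSymbol (fun y => n y - n' y) ξ = poissonSymbol n ξ - poissonSymbol n' ξ := by
  unfold poissonSymbol
  rw [charIntegral_sub hn hn']
  ring

theorem continuous_charIntegral {n : E3 → ℝ} (hn : Integrable n) :
    Continuous (charIntegral n) := by
  rw [funext (charIntegral_eq_fourier n)]
  have : Continuous (𝓕 (fun y => (n y : ℂ))) :=
    VectorFourier.fourierIntegral_continuous Real.continuous_fourierChar
      (innerSL ℝ).continuous₂ hn.ofReal
  exact this.comp (by fun_prop)

theorem measurable_poissonSymbol {n : E3 → ℝ} (hn : Integrable n) :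
    Measurable (poissonSymbol n) := by
  have := (continuous_charIntegral hn).measurable
  unfold poissonSymbol
  fun_prop

theorem enorm_charIntegral_le (n : E3 → ℝ) (ξ : E3) : ‖charIntegral n ξ‖ₑ ≤ ∫⁻ y, ‖n y‖ₑ := by
  refine (enorm_integral_le_lintegral_enorm _).trans (le_of_eq ?_)
  congr 1 with y
  rw [enorm_mul, ← ofReal_norm (planeWave y ξ), norm_planeWave, ENNReal.ofReal_one, mul_one,
    ← ofReal_norm, Complex.norm_real, ofReal_norm]

theorem lintegral_comp_smul (f : E3 → ℝ≥0∞) (hf : Measurable f) {r : ℝ} (hr : r ≠ 0) :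
    ∫⁻ x : E3, f (r • x) = ENNReal.ofReal |(r ^ 3)⁻¹| * ∫⁻ x : E3, f x := by
  rw [← lintegral_map (μ := volume) (g := fun x : E3 => r • x) hf (by fun_prop),
    Measure.map_addHaar_smul volume hr, lintegral_smul_measure]
  simp

/-- Plancherel after the rescaling by `-(2π)⁻¹`; the constant is the square root of the Jacobian. -/
theorem lintegral_enorm_charIntegral_sq {n : E3 → ℝ} (hn : Integrable n) (hn2 : MemLp n 2) :
    (∫⁻ ξ, ‖charIntegral n ξ‖ₑ ^ (2 : ℝ)) ^ (1 / 2 : ℝ) =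
      ENNReal.ofReal |((-(2 * Real.pi)⁻¹) ^ 3)⁻¹| ^ (1 / 2 : ℝ) * eLpNorm n 2 := by
  have h1 : Integrable fun y => (n y : ℂ) := hn.ofReal
  have h2 : MemLp (fun y => (n y : ℂ)) 2 := hn2.ofReal
  have hc : Continuous (𝓕 (fun y => (n y : ℂ))) :=
    VectorFourier.fourierIntegral_continuous Real.continuous_fourierChar
      (innerSL ℝ).continuous₂ h1
  simp_rw [charIntegral_eq_fourier]
  rw [lintegral_comp_smul (fun w => ‖𝓕 (fun y => (n y : ℂ)) w‖ₑ ^ (2 : ℝ))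
    (hc.measurable.enorm.pow_const _) (by have := Real.pi_pos; simp [this.ne']),
    ENNReal.mul_rpow_of_nonneg _ _ (by norm_num)]
  congr 1
  have h3 := eLpNorm_fourier_eq h1 h2
  rw [eLpNorm_eq_lintegral_rpow_enorm_toReal (f := 𝓕 (fun y => (n y : ℂ))) (by norm_num)
    (by norm_num)] at h3
  rw [ENNReal.toReal_ofNat] at h3
  rw [h3]
  refine eLpNorm_congr_norm_ae (Eventually.of_forall fun y => ?_)
  simp

/-- The constant in the `L¹` bound of the Poisson symbol. -/
noncomputable def symbolConst : ℝ≥0∞ :=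
  ballMass + tailMass ^ (1 / 2 : ℝ) * ENNReal.ofReal |((-(2 * Real.pi)⁻¹) ^ 3)⁻¹| ^ (1 / 2 : ℝ)

theorem symbolConst_ne_top : symbolConst ≠ ∞ := by
  have h1 := ballMass_ne_top
  have h2 := tailMass_ne_top
  unfold symbolConst
  finiteness

theorem mul_add_mul_mul_le (a b c x y : ℝ≥0∞) :
    a * x + b * (c * y) ≤ (a + b * c) * (x + y) := by
  rw [← mul_assoc, add_mul]
  exact add_le_add (mul_le_mul_right le_self_add a) (mul_le_mul_right le_add_self _)

/-- At low frequencies `‖ξ‖⁻²` is integrable and the Fourier integral is bounded by the `L¹` norm of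
`n`. At high frequencies `‖ξ‖⁻²` is square integrable and Plancherel supplies the `L²` norm of `n`.
-/
theorem lintegral_poissonSymbol_le {n : E3 → ℝ} (hn : Integrable n) (hn2 : MemLp n 2) :
    ∫⁻ ξ, ‖poissonSymbol n ξ‖ₑ ≤ symbolConst * ((∫⁻ y, ‖n y‖ₑ) + eLpNorm n 2) := by
  have h1 : ∀ ξ, ‖poissonSymbol n ξ‖ₑ ≤ ENNReal.ofReal (‖ξ‖ ^ 2)⁻¹ * ‖charIntegral n ξ‖ₑ := by
    intro ξ
    unfold poissonSymbol
    rw [enorm_mul, enorm_mul, ← ofReal_norm ((((2 * Real.pi) ^ 3)⁻¹ : ℝ) : ℂ), Complex.norm_real,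
      Real.norm_of_nonneg (by have := Real.pi_pos; positivity),
      ← ofReal_norm (((‖ξ‖ ^ 2)⁻¹ : ℝ) : ℂ), Complex.norm_real,
      Real.norm_of_nonneg (by positivity), mul_comm ‖charIntegral n ξ‖ₑ]
    refine mul_le_of_le_one_left' (ENNReal.ofReal_le_one.2 ?_)
    exact inv_le_one_of_one_le₀ (one_le_pow₀ (by linarith [Real.pi_gt_three]))
  refine (lintegral_mono h1).trans ((lintegral_inv_norm_sq_mul_le_of_memLp
    (continuous_charIntegral hn).measurable.enorm (enorm_charIntegral_le n)).trans ?_)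
  rw [lintegral_enorm_charIntegral_sq hn hn2, symbolConst]
  exact mul_add_mul_mul_le _ _ _ _ _

theorem integrable_poissonSymbol {n : E3 → ℝ} (hn : Integrable n) (hn2 : MemLp n 2) :
    Integrable (poissonSymbol n) := by
  refine ⟨(measurable_poissonSymbol hn).aestronglyMeasurable,
    (lintegral_poissonSymbol_le hn hn2).trans_lt ?_⟩
  have h1 : ∫⁻ y, ‖n y‖ₑ < ∞ := hn.2
  have h2 : eLpNorm n 2 < ∞ := hn2.2
  have := symbolConst_ne_top
  finiteness

theorem integrable_inv_norm_prod {n : E3 → ℝ} (hn : Integrable n) {ψ : E3 → ℂ}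
    (hψ : Integrable ψ) {b : ℝ≥0∞} (hb : b ≠ ∞) (hψb : ∀ x, ‖ψ x‖ₑ ≤ b) :
    Integrable (fun p : E3 × E3 => (n p.2 : ℂ) * (((‖p.1 - p.2‖⁻¹ : ℝ) : ℂ) * ψ p.1))
      ((volume : Measure E3).prod volume) := by
  have hm : AEStronglyMeasurable
      (fun p : E3 × E3 => (n p.2 : ℂ) * (((‖p.1 - p.2‖⁻¹ : ℝ) : ℂ) * ψ p.1))
      ((volume : Measure E3).prod volume) :=
    AEStronglyMeasurable.mul hn.ofReal.1.comp_snd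
      (AEStronglyMeasurable.mul (by fun_prop) hψ.1.comp_fst)
  refine (integrable_prod_iff' hm).2 ⟨Eventually.of_forall fun y =>
    (integrable_inv_norm_mul hψ hb hψb y).const_mul (n y : ℂ), ?_⟩
  set C := (ballMass * b + 2 * ∫⁻ x, ‖ψ x‖ₑ).toReal with hC
  refine (hn.norm.mul_const C).mono' hm.norm.prod_swap.integral_prod_right'
    (Eventually.of_forall fun y => ?_)
  have hfin : ballMass * b + 2 * ∫⁻ x, ‖ψ x‖ₑ ≠ ∞ := by
    have h2 : ∫⁻ x, ‖ψ x‖ₑ < ∞ := hψ.2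
    have := ballMass_ne_top
    finiteness
  have hle : ∫ x, ‖((‖x - y‖⁻¹ : ℝ) : ℂ) * ψ x‖ ≤ C := by
    rw [integral_norm_eq_lintegral_enorm (integrable_inv_norm_mul hψ hb hψb y).1, hC]
    refine ENNReal.toReal_mono hfin (le_trans (le_of_eq ?_)
      (lintegral_inv_norm_mul_le hψ.1.enorm (Eventually.of_forall hψb) y))
    congr 1 with x
    rw [enorm_mul, norm_sub_rev, ← ofReal_norm ((‖y - x‖⁻¹ : ℝ) : ℂ), Complex.norm_real,
      Real.norm_of_nonneg (by positivity)]
  simp_rw [norm_mul (n y : ℂ)]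
  rw [integral_const_mul, Complex.norm_real, Real.norm_of_nonneg (by positivity)]
  gcongr

/-- Two applications of Fubini reduce the claim to the Coulomb kernel centred at one point `y`. The
constants combine as `(4π)⁻¹ · 4π (2π)⁻³ = (2π)⁻³`. -/
theorem isInvFourierTransform_coulomb {n : E3 → ℝ} (hn : Integrable n) (hn2 : MemLp n 2) :
    IsInvFourierTransform (coulomb n) (poissonSymbol n) := by
  refine ⟨(integrable_poissonSymbol hn hn2).locallyIntegrable, fun φ => ?_⟩
  obtain ⟨b, hb, hψb⟩ := exists_norm_invFourierSchwartz_le φ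
  have hψ := integrable_invFourierSchwartz φ
  set ψ := invFourierSchwartz φ
  have hpi := Real.pi_pos
  have hV : ∀ x, (coulomb n x : ℂ) * ψ x = ((4 * Real.pi)⁻¹ : ℝ) *
      ∫ y, (n y : ℂ) * (((‖x - y‖⁻¹ : ℝ) : ℂ) * ψ x) := by
    intro x
    unfold coulomb
    rw [← integral_complex_ofReal, ← integral_mul_const, ← integral_const_mul]
    congr 1 with y
    push_cast
    rw [one_div, mul_inv]
    ring
  simp_rw [hV]
  rw [integral_const_mul, integral_integral_swap (integrable_inv_norm_prod hn hψ hb hψb)]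
  have h1 : ∀ y, ∫ x, (n y : ℂ) * (((‖x - y‖⁻¹ : ℝ) : ℂ) * ψ x) =
      ((4 * Real.pi * ((2 * Real.pi) ^ 3)⁻¹ : ℝ) : ℂ) *
        ∫ ξ : E3, (n y : ℂ) * (φ ξ * planeWave y ξ * (((‖ξ‖ ^ 2)⁻¹ : ℝ) : ℂ)) := by
    intro y
    rw [integral_const_mul, integral_coulomb_invFourierSchwartz, integral_const_mul]
    ring
  simp_rw [h1]
  have hint : Integrable (fun p : E3 × E3 => (n p.1 : ℂ) *
      (φ p.2 * planeWave p.1 p.2 * (((‖p.2‖ ^ 2)⁻¹ : ℝ) : ℂ)))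
      ((volume : Measure E3).prod volume) := by
    have h2 := (hn.ofReal (𝕜 := ℂ)).mul_prod (integrable_schwartz_div_norm_sq φ)
    have h3 := h2.mul_bdd (c := 1) measurable_planeWave.aestronglyMeasurable
      (Eventually.of_forall fun p => (norm_planeWave p.1 p.2).le)
    refine h3.congr (Eventually.of_forall fun p => ?_)
    dsimp only
    simp only [Complex.coe_algebraMap]
    ring
  rw [integral_const_mul, integral_integral_swap hint, ← mul_assoc, ← integral_const_mul]
  refine integral_congr_ae (Eventually.of_forall fun ξ => ?_)
  dsimp only
  have h4 : ∀ y, (n y : ℂ) * (φ ξ * planeWave y ξ * (((‖ξ‖ ^ 2)⁻¹ : ℝ) : ℂ)) =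
      ((n y : ℂ) * planeWave y ξ) * (φ ξ * (((‖ξ‖ ^ 2)⁻¹ : ℝ) : ℂ)) := fun y => by ring
  simp_rw [h4]
  rw [integral_mul_const, ← charIntegral, poissonSymbol, ← Complex.ofReal_mul]
  rw [show (4 * Real.pi)⁻¹ * (4 * Real.pi * ((2 * Real.pi) ^ 3)⁻¹) = ((2 * Real.pi) ^ 3)⁻¹ by
    field_simp]
  ring

/-- The transform is a choice among locally integrable representatives, and two of them agree almost
everywhere because they agree on Schwartz functions. -/
theorem invFourier_coulomb_ae_eq {n : E3 → ℝ} (hn : Integrable n) (hn2 : MemLp n 2) :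
    invFourier (coulomb n) =ᵐ[volume] poissonSymbol n := by
  have hex : ∃ g : E3 → ℂ, IsInvFourierTransform (coulomb n) g :=
    ⟨_, isInvFourierTransform_coulomb hn hn2⟩
  have hspec := hex.choose_spec
  have hself := isInvFourierTransform_coulomb hn hn2
  unfold invFourier
  rw [dif_pos hex]
  exact ae_eq_of_forall_schwartz hspec.1 hself.1 fun φ => (hspec.2 φ).symm.trans (hself.2 φ)

end WignerPoisson

namespace WignerPoisson

/-! ### The density in `L¹ ∩ L²` -/

theorem measurable_density {f : Phase → ℝ} (hf : Measurable f) : Measurable (density f) :=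
  (hf.stronglyMeasurable.integral_prod_right' (ν := (volume : Measure E3))).measurable

theorem enorm_density_le (f : Phase → ℝ) (x : E3) : ‖density f x‖ₑ ≤ ∫⁻ ξ, ‖f (x, ξ)‖ₑ :=
  enorm_integral_le_lintegral_enorm _

theorem lintegral_phase {g : Phase → ℝ≥0∞} (hg : Measurable g) :
    ∫⁻ X, g X = ∫⁻ x : E3, ∫⁻ ξ : E3, g (x, ξ) :=
  lintegral_prod _ hg.aemeasurable

theorem lintegral_enorm_density_le {f : Phase → ℝ} (hf : Measurable f) :
    ∫⁻ x, ‖density f x‖ₑ ≤ mixedNorm 1 1 f := by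
  rw [mixedNorm_one_one_eq hf.aestronglyMeasurable, lintegral_phase hf.enorm]
  exact lintegral_mono fun x => enorm_density_le f x

/-- Minkowski's integral inequality for the exponent two. -/
theorem lintegral_sq_lintegral_le {v : Phase → ℝ≥0∞} (hv : Measurable v) :
    ∫⁻ x, (∫⁻ ξ, v (x, ξ)) ^ (2 : ℝ) ≤ (∫⁻ ξ, (∫⁻ x, v (x, ξ) ^ (2 : ℝ)) ^ (1 / 2 : ℝ)) ^ (2 : ℝ) := by
  have hsq : ∀ a : ℝ≥0∞, a ^ (2 : ℝ) = a * a := fun a => by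
    rw [ENNReal.rpow_ofNat, pow_two]
  have hN : Measurable fun ξ : E3 => (∫⁻ x : E3, v (x, ξ) ^ (2 : ℝ)) ^ (1 / 2 : ℝ) :=
    ((hv.pow_const _).lintegral_prod_left' (μ := (volume : Measure E3))).pow_const _
  -- The square is opened as an integral over pairs of momenta, for which `Phase` serves as the
  -- product space; Cauchy–Schwarz in `x` then separates the pair.
  have h1 : ∀ x, (∫⁻ ξ, v (x, ξ)) ^ (2 : ℝ) = ∫⁻ p : Phase, v (x, p.1) * v (x, p.2) := by
    intro x
    have hvx : Measurable fun ξ => v (x, ξ) := hv.comp measurable_prodMk_left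
    rw [hsq]
    exact (lintegral_prod_mul hvx.aemeasurable hvx.aemeasurable).symm
  simp_rw [h1]
  rw [lintegral_lintegral_swap (f := fun (x : E3) (p : Phase) => v (x, p.1) * v (x, p.2))
    (by unfold Function.uncurry; fun_prop), hsq,
    ← lintegral_prod_mul hN.aemeasurable hN.aemeasurable]
  refine lintegral_mono fun p => ?_
  refine (ENNReal.lintegral_mul_le_Lp_mul_Lq volume Real.HolderConjugate.two_two
    (hv.comp measurable_prodMk_right).aemeasurable
    (hv.comp measurable_prodMk_right).aemeasurable)

theorem eLpNorm_density_le {f : Phase → ℝ} (hf : Measurable f) :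
    eLpNorm (density f) 2 ≤ mixedNorm 1 2 f := by
  rw [mixedNorm_one_eq (by norm_num) (by norm_num),
    eLpNorm_eq_lintegral_rpow_enorm_toReal (by norm_num) (by norm_num)]
  simp only [ENNReal.toReal_ofNat]
  calc (∫⁻ x, ‖density f x‖ₑ ^ (2 : ℝ)) ^ (1 / 2 : ℝ)
      ≤ (∫⁻ x, (∫⁻ ξ, ‖f (x, ξ)‖ₑ) ^ (2 : ℝ)) ^ (1 / 2 : ℝ) := by
        gcongr with x
        exact enorm_density_le f x
    _ ≤ ((∫⁻ ξ, (∫⁻ x, ‖f (x, ξ)‖ₑ ^ (2 : ℝ)) ^ (1 / 2 : ℝ)) ^ (2 : ℝ)) ^ (1 / 2 : ℝ) := by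
        gcongr
        exact lintegral_sq_lintegral_le hf.enorm
    _ = _ := by rw [← ENNReal.rpow_mul]; norm_num

theorem integrable_density {f : Phase → ℝ} (hf : Measurable f) (h1 : mixedNorm 1 1 f < ∞) :
    Integrable (density f) :=
  ⟨(measurable_density hf).aestronglyMeasurable, (lintegral_enorm_density_le hf).trans_lt h1⟩

theorem memLp_density {f : Phase → ℝ} (hf : Measurable f) (h2 : mixedNorm 1 2 f < ∞) :
    MemLp (density f) 2 :=
  ⟨(measurable_density hf).aestronglyMeasurable, (eLpNorm_density_le hf).trans_lt h2⟩

theorem density_sub_ae_eq {f g : Phase → ℝ} (hf : Integrable f) (hg : Integrable g) :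
    density (fun X => f X - g X) =ᵐ[volume] fun x => density f x - density g x := by
  filter_upwards [hf.prod_right_ae, hg.prod_right_ae] with x hx hx'
  exact integral_sub hx hx'

theorem density_congr_ae {f g : Phase → ℝ} (h : f =ᵐ[volume] g) :
    density f =ᵐ[volume] density g :=
  (Measure.ae_ae_of_ae_prod h).mono fun _ hx => integral_congr_ae hx

theorem potential_congr_ae {f g : Phase → ℝ} (h : f =ᵐ[volume] g) : potential f = potential g := by
  funext x
  exact integral_congr_ae ((density_congr_ae h).mono fun y hy => by simp only [hy])

/-! ### The pseudo-differential operator with the Poisson symbol -/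

/-- The kernel of `Θ[V]` for the Coulomb potential `V` of the density `n`. -/
noncomputable def coulombKernel (n : E3 → ℝ) (x ζ : E3) : ℝ :=
  16 * (Complex.I * Complex.exp (2 * Complex.I * ((inner ℝ x ζ : ℝ) : ℂ)) *
    poissonSymbol n ((-2 : ℝ) • ζ)).re

/-- `Θ[V] f` for the Coulomb potential `V` of the density `n`. -/
noncomputable def coulombTheta (n : E3 → ℝ) (f : Phase → ℝ) (X : Phase) : ℝ :=
  ∫ ξ' : E3, coulombKernel n X.1 (X.2 - ξ') * f (X.1, ξ')

/-- A bound of `coulombKernel` which does not depend on the position. -/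
noncomputable def kernelBound (n : E3 → ℝ) (ζ : E3) : ℝ≥0∞ :=
  16 * ‖poissonSymbol n ((-2 : ℝ) • ζ)‖ₑ

/-- `V̌` is known only almost everywhere, yet the equality holds at every point: `ξ' ↦ -2(ξ - ξ')`
pulls null sets back to null sets, so the integrands agree for almost every `ξ'`. -/
theorem theta_potential_eq {f₀ : Phase → ℝ} (hn : Integrable (density f₀))
    (hn2 : MemLp (density f₀) 2) (f : Phase → ℝ) :
    theta (potential f₀) f = coulombTheta (density f₀) f := by
  funext X
  refine integral_congr_ae ?_
  have hq : Measure.QuasiMeasurePreserving (fun ξ' : E3 => (-2 : ℝ) • (X.2 - ξ')) volume volume := by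
    refine ⟨by fun_prop, ?_⟩
    have h1 : (fun ξ' : E3 => (-2 : ℝ) • (X.2 - ξ')) = (fun y : E3 => (-2 : ℝ) • y) ∘
      fun ξ' => X.2 - ξ' := rfl
    rw [h1, ← Measure.map_map (by fun_prop) (by fun_prop),
      (Measure.measurePreserving_sub_left volume X.2).map_eq,
      Measure.map_addHaar_smul volume (by norm_num)]
    exact Measure.smul_absolutelyContinuous
  filter_upwards [hq.ae (invFourier_coulomb_ae_eq hn hn2)] with ξ' h
  rw [← potential_eq_coulomb] at h
  simp only [wignerKernel, coulombKernel, h]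

theorem theta_congr_ae (V : E3 → ℝ) {f g : Phase → ℝ} (h : f =ᵐ[volume] g) :
    theta V f =ᵐ[volume] theta V g := by
  have h1 : ∀ᵐ x : E3, ∀ᵐ ξ : E3, f (x, ξ) = g (x, ξ) := Measure.ae_ae_of_ae_prod h
  have h2 : ∀ᵐ X : Phase, ∀ᵐ ξ : E3, f (X.1, ξ) = g (X.1, ξ) :=
    Measure.quasiMeasurePreserving_fst.ae h1
  filter_upwards [h2] with X hX
  exact integral_congr_ae (hX.mono fun ξ hξ => by simp only [hξ])

theorem enorm_coulombKernel_le (n : E3 → ℝ) (x ζ : E3) :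
    ‖coulombKernel n x ζ‖ₑ ≤ kernelBound n ζ := by
  unfold coulombKernel kernelBound
  rw [enorm_mul, show ‖(16 : ℝ)‖ₑ = 16 by
    rw [← ofReal_norm]; norm_num]
  gcongr
  rw [enorm_le_iff_norm_le, Real.norm_eq_abs]
  refine (Complex.abs_re_le_norm _).trans (le_of_eq ?_)
  have h : ‖Complex.exp (2 * Complex.I * ((inner ℝ x ζ : ℝ) : ℂ))‖ = 1 := by
    rw [Complex.norm_exp]
    simp
  rw [norm_mul, norm_mul, h, Complex.norm_I, one_mul, one_mul]

theorem measurable_kernelBound {n : E3 → ℝ} (hn : Integrable n) : Measurable (kernelBound n) :=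
  ((measurable_poissonSymbol hn).comp (by fun_prop)).enorm.const_mul _

theorem lintegral_kernelBound_le {n : E3 → ℝ} (hn : Integrable n) (hn2 : MemLp n 2) :
    ∫⁻ ζ, kernelBound n ζ ≤ 2 * symbolConst * ((∫⁻ y, ‖n y‖ₑ) + eLpNorm n 2) := by
  have hm := measurable_poissonSymbol hn
  unfold kernelBound
  rw [lintegral_const_mul _ (by fun_prop),
    lintegral_comp_smul (fun ξ => ‖poissonSymbol n ξ‖ₑ) (measurable_poissonSymbol hn).enorm
      (by norm_num), ← mul_assoc, mul_assoc 2]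
  refine mul_le_mul' (le_of_eq ?_) (lintegral_poissonSymbol_le hn hn2)
  rw [show (16 : ℝ≥0∞) = ENNReal.ofReal 16 by norm_num, ← ENNReal.ofReal_mul (by norm_num)]
  norm_num [abs_of_pos]

theorem measurable_coulombKernel {n : E3 → ℝ} (hn : Integrable n) :
    Measurable fun p : E3 × E3 => coulombKernel n p.1 p.2 := by
  have h := (measurable_poissonSymbol hn).comp
    (show Measurable fun p : E3 × E3 => (-2 : ℝ) • p.2 by fun_prop)
  unfold coulombKernel
  exact ((Complex.measurable_re.comp ((Measurable.const_mul (by fun_prop) _).mul h))).const_mul _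

theorem measurable_coulombTheta_integrand {n : E3 → ℝ} (hn : Integrable n) {f : Phase → ℝ}
    (hf : Measurable f) :
    Measurable fun p : Phase × E3 => coulombKernel n p.1.1 (p.1.2 - p.2) * f (p.1.1, p.2) :=
  ((measurable_coulombKernel hn).comp
    (show Measurable fun p : Phase × E3 => (p.1.1, p.1.2 - p.2) by fun_prop)).mul
    (hf.comp (by fun_prop))

theorem measurable_coulombTheta {n : E3 → ℝ} (hn : Integrable n) {f : Phase → ℝ}
    (hf : Measurable f) : Measurable (coulombTheta n f) :=
  ((measurable_coulombTheta_integrand hn hf).stronglyMeasurable.integral_prod_right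
    (ν := (volume : Measure E3))).measurable

/-- Transposition of the momentum convolution, by Tonelli and a translation in `ξ` at fixed `x`. -/
theorem lintegral_kernelBound_mul {K : E3 → ℝ≥0∞} (hK : Measurable K) {v h : Phase → ℝ≥0∞}
    (hv : Measurable v) (hh : Measurable h) :
    ∫⁻ X : Phase, (∫⁻ ξ' : E3, K (X.2 - ξ') * v (X.1, ξ')) * h X =
      ∫⁻ X : Phase, v X * momentumConv K h X := by
  have hm := measurable_momentumConv hK hh
  have hm1 : Measurable fun X : Phase => ∫⁻ ξ' : E3, K (X.2 - ξ') * v (X.1, ξ') :=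
    Measurable.lintegral_prod_right' (ν := (volume : Measure E3))
      (f := fun p : Phase × E3 => K (p.1.2 - p.2) * v (p.1.1, p.2))
      ((hK.comp (by fun_prop)).mul (hv.comp (by fun_prop)))
  refine (lintegral_phase (hm1.mul hh)).trans (Eq.trans ?_ (lintegral_phase (hv.mul hm)).symm)
  simp only [Pi.mul_apply]
  refine lintegral_congr fun x => ?_
  have h1 : ∀ ξ : E3, (∫⁻ ξ' : E3, K (ξ - ξ') * v (x, ξ')) * h (x, ξ) =
      ∫⁻ ξ' : E3, K (ξ - ξ') * v (x, ξ') * h (x, ξ) := fun ξ =>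
    (lintegral_mul_const _ ((hK.comp (by fun_prop)).mul (hv.comp (by fun_prop)))).symm
  simp_rw [h1]
  rw [lintegral_lintegral_swap (((hK.comp (by fun_prop)).mul (hv.comp (by fun_prop))).mul
    (hh.comp (by fun_prop))).aemeasurable]
  refine lintegral_congr fun ξ' => ?_
  rw [momentumConv, ← lintegral_const_mul _ (by fun_prop),
    ← lintegral_add_left_eq_self _ ξ']
  refine lintegral_congr fun ζ => ?_
  rw [add_sub_cancel_left]
  ring

theorem enorm_coulombTheta_le (n : E3 → ℝ) (f : Phase → ℝ) (X : Phase) :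
    ‖coulombTheta n f X‖ₑ ≤ ∫⁻ ξ' : E3, kernelBound n (X.2 - ξ') * ‖f (X.1, ξ')‖ₑ := by
  refine (enorm_integral_le_lintegral_enorm _).trans (lintegral_mono fun ξ' => ?_)
  dsimp only
  rw [enorm_mul]
  gcongr
  exact enorm_coulombKernel_le n _ _

theorem lintegral_coulombTheta_mul_le {n : E3 → ℝ} (hn : Integrable n) {f : Phase → ℝ}
    (hf : Measurable f) {h : Phase → ℝ≥0∞} (hh : Measurable h) :
    ∫⁻ X, ‖coulombTheta n f X‖ₑ * h X ≤
      ∫⁻ X, ‖f X‖ₑ * momentumConv (kernelBound n) h X := by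
  rw [← lintegral_kernelBound_mul (measurable_kernelBound hn) hf.enorm hh]
  exact lintegral_mono fun X => mul_le_mul_left (enorm_coulombTheta_le n f X) _

theorem lintegral_kernelBound_conv {n : E3 → ℝ} (hn : Integrable n) {f : Phase → ℝ}
    (hf : Measurable f) :
    ∫⁻ X : Phase, (∫⁻ ξ' : E3, kernelBound n (X.2 - ξ') * ‖f (X.1, ξ')‖ₑ) =
      (∫⁻ ζ, kernelBound n ζ) * ∫⁻ X, ‖f X‖ₑ := by
  have h := lintegral_kernelBound_mul (measurable_kernelBound hn) hf.enorm
    (h := fun _ => 1) measurable_const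
  simp only [mul_one, momentumConv] at h
  rw [h, lintegral_mul_const _ hf.enorm, mul_comm]

theorem lintegral_coulombTheta_le {n : E3 → ℝ} (hn : Integrable n) {f : Phase → ℝ}
    (hf : Measurable f) :
    ∫⁻ X, ‖coulombTheta n f X‖ₑ ≤ (∫⁻ ζ, kernelBound n ζ) * ∫⁻ X, ‖f X‖ₑ :=
  (lintegral_mono fun X => enorm_coulombTheta_le n f X).trans
    (lintegral_kernelBound_conv hn hf).le

theorem ae_integrable_coulombTheta {n : E3 → ℝ} (hn : Integrable n) (hn2 : MemLp n 2)
    {f : Phase → ℝ} (hf : Measurable f) (hfi : Integrable f) :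
    ∀ᵐ X : Phase, Integrable fun ξ' : E3 => coulombKernel n X.1 (X.2 - ξ') * f (X.1, ξ') := by
  have hK := measurable_kernelBound hn
  have hm1 : Measurable fun X : Phase => ∫⁻ ξ' : E3, kernelBound n (X.2 - ξ') * ‖f (X.1, ξ')‖ₑ :=
    Measurable.lintegral_prod_right' (ν := (volume : Measure E3))
      (f := fun p : Phase × E3 => kernelBound n (p.1.2 - p.2) * ‖f (p.1.1, p.2)‖ₑ)
      ((hK.comp (by fun_prop)).mul (hf.enorm.comp (by fun_prop)))
  have hfin : ∫⁻ X : Phase, (∫⁻ ξ' : E3, kernelBound n (X.2 - ξ') * ‖f (X.1, ξ')‖ₑ) ≠ ∞ := by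
    rw [lintegral_kernelBound_conv hn hf]
    have h1 : ∫⁻ X, ‖f X‖ₑ < ∞ := hfi.2
    have h2 := lintegral_kernelBound_le hn hn2
    have h3 : ∫⁻ y, ‖n y‖ₑ < ∞ := hn.2
    have h4 : eLpNorm n 2 < ∞ := hn2.2
    have h5 := symbolConst_ne_top
    have h6 : ∫⁻ ζ, kernelBound n ζ < ∞ := h2.trans_lt (by finiteness)
    finiteness
  filter_upwards [ae_lt_top hm1 hfin] with X hX
  refine ⟨((measurable_coulombTheta_integrand hn hf).comp measurable_prodMk_left).aestronglyMeasurable,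
    lt_of_le_of_lt (lintegral_mono fun ξ' => ?_) hX⟩
  dsimp only
  rw [enorm_mul]
  gcongr
  exact enorm_coulombKernel_le n _ _

theorem coulombKernel_sub {n n' : E3 → ℝ} (hn : Integrable n) (hn' : Integrable n') (x ζ : E3) :
    coulombKernel (fun y => n y - n' y) x ζ = coulombKernel n x ζ - coulombKernel n' x ζ := by
  unfold coulombKernel
  rw [poissonSymbol_sub hn hn', mul_sub, Complex.sub_re, mul_sub]

/-- Bilinearity in density and state. It is asserted only almost everywhere because the four
integrals have to converge for the splitting. -/
theorem coulombTheta_sub_ae_eq {n n' : E3 → ℝ} (hn : Integrable n) (hn2 : MemLp n 2)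
    (hn' : Integrable n') (hn2' : MemLp n' 2) {f f' : Phase → ℝ} (hf : Measurable f)
    (hfi : Integrable f) (hf' : Measurable f') (hfi' : Integrable f') :
    (fun X => coulombTheta n f X - coulombTheta n' f' X) =ᵐ[volume] fun X =>
      coulombTheta (fun y => n y - n' y) f X + coulombTheta n' (fun X => f X - f' X) X := by
  filter_upwards [ae_integrable_coulombTheta hn hn2 hf hfi,
    ae_integrable_coulombTheta hn' hn2' hf' hfi',
    ae_integrable_coulombTheta (hn.sub hn') (hn2.sub hn2') hf hfi,
    ae_integrable_coulombTheta hn' hn2' (hf.sub hf') (hfi.sub hfi')] with X h1 h2 h3 h4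
  simp only [coulombTheta]
  refine (integral_sub h1 h2).symm.trans (Eq.trans ?_ (integral_add h3 h4))
  refine integral_congr_ae (Eventually.of_forall fun ξ' => ?_)
  have := coulombKernel_sub hn hn' X.1 (X.2 - ξ')
  change _ = coulombKernel (fun y => n y - n' y) X.1 (X.2 - ξ') * _ + _ * (f _ - f' _)
  rw [this]
  ring

end WignerPoisson

namespace WignerPoisson

/-! ### Continuity in time of the nonlinear term -/

theorem measurable_slice_norm {f : Phase → ℝ} (hf : Measurable f) (p : ℝ) :
    Measurable fun ξ : E3 => (∫⁻ x : E3, ‖f (x, ξ)‖ₑ ^ p) ^ (1 / p) :=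
  (Measurable.lintegral_prod_left' (f := fun X : E3 × E3 => ‖f X‖ₑ ^ p)
    (hf.enorm.pow_const _)).pow_const _

theorem mixedNorm_one_add_le {p : ℝ≥0∞} (hp1 : 1 ≤ p) (hp : p ≠ ∞) {f g : Phase → ℝ}
    (hf : Measurable f) (hg : Measurable g) :
    mixedNorm 1 p (fun X => f X + g X) ≤ mixedNorm 1 p f + mixedNorm 1 p g := by
  have h0 : p ≠ 0 := (zero_lt_one.trans_le hp1).ne'
  have hm := measurable_slice_norm hf p.toReal
  simp_rw [mixedNorm, eLpNorm_one_eq_lintegral_enorm, enorm_eq_self]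
  rw [← lintegral_add_left]
  · exact lintegral_mono fun ξ => eLpNorm_add_le
      (hf.comp measurable_prodMk_right).aestronglyMeasurable
      (hg.comp measurable_prodMk_right).aestronglyMeasurable hp1
  · simpa only [eLpNorm_eq_lintegral_rpow_enorm_toReal h0 hp] using hm

/-- The norm of `L^{1,1} ∩ L^{1,2}`. -/
noncomputable def stateNorm (f : Phase → ℝ) : ℝ≥0∞ := mixedNorm 1 1 f + mixedNorm 1 2 f

theorem stateNorm_add_le {f g : Phase → ℝ} (hf : Measurable f) (hg : Measurable g) :
    stateNorm (fun X => f X + g X) ≤ stateNorm f + stateNorm g := by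
  refine (add_le_add (mixedNorm_one_add_le le_rfl (by norm_num) hf hg)
    (mixedNorm_one_add_le (by norm_num) (by norm_num) hf hg)).trans_eq ?_
  unfold stateNorm
  abel

theorem lintegral_enorm_le_stateNorm {f : Phase → ℝ} (hf : Measurable f) :
    ∫⁻ X, ‖f X‖ₑ ≤ stateNorm f := by
  rw [← mixedNorm_one_one_eq hf.aestronglyMeasurable]
  exact le_self_add

/-- A measurable family of states, continuous on `[0, T]` with values in `L^{1,1} ∩ L^{1,2}`. -/
structure StateCurve (T : ℝ) (w : ℝ → Phase → ℝ) : Prop where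
  measurable : ∀ s, Measurable (w s)
  finite : ∀ s, stateNorm (w s) < ∞
  tendsto : ∀ s ∈ Icc 0 T,
    Tendsto (fun r => stateNorm (fun X => w r X - w s X)) (𝓝[Icc 0 T] s) (𝓝 0)

/-- The nonlinear term `Θ[V_f] f`. -/
noncomputable def source (f : Phase → ℝ) : Phase → ℝ := coulombTheta (density f) f

section State

variable {f g : Phase → ℝ}

theorem integrable_state (hf : Measurable f) (hfin : stateNorm f < ∞) : Integrable f :=
  ⟨hf.aestronglyMeasurable, (lintegral_enorm_le_stateNorm hf).trans_lt hfin⟩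

theorem integrable_density_state (hf : Measurable f) (hfin : stateNorm f < ∞) :
    Integrable (density f) :=
  integrable_density hf (le_self_add.trans_lt hfin)

theorem memLp_density_state (hf : Measurable f) (hfin : stateNorm f < ∞) :
    MemLp (density f) 2 :=
  memLp_density hf (le_add_self.trans_lt hfin)

theorem measurable_source (hf : Measurable f) (hfin : stateNorm f < ∞) : Measurable (source f) :=
  measurable_coulombTheta (integrable_density_state hf hfin) hf

theorem lintegral_kernelBound_state_le (hf : Measurable f) (hfin : stateNorm f < ∞) :
    ∫⁻ ζ, kernelBound (density f) ζ ≤ 2 * symbolConst * stateNorm f :=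
  (lintegral_kernelBound_le (integrable_density_state hf hfin)
    (memLp_density_state hf hfin)).trans <| by
      unfold stateNorm
      exact mul_le_mul_right (add_le_add (lintegral_enorm_density_le hf) (eLpNorm_density_le hf)) _

theorem lintegral_source_le (hf : Measurable f) (hfin : stateNorm f < ∞) :
    ∫⁻ X, ‖source f X‖ₑ ≤ 2 * symbolConst * stateNorm f * stateNorm f :=
  (lintegral_coulombTheta_le (integrable_density_state hf hfin) hf).trans
    (mul_le_mul' (lintegral_kernelBound_state_le hf hfin) (lintegral_enorm_le_stateNorm hf))

theorem integrable_source (hf : Measurable f) (hfin : stateNorm f < ∞) :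
    Integrable (source f) := by
  refine ⟨(measurable_source hf hfin).aestronglyMeasurable,
    (lintegral_source_le hf hfin).trans_lt ?_⟩
  have := symbolConst_ne_top
  finiteness

theorem poissonSymbol_congr_ae {n n' : E3 → ℝ} (h : n =ᵐ[volume] n') :
    poissonSymbol n = poissonSymbol n' := by
  unfold poissonSymbol
  rw [charIntegral_congr h]

/-- The nonlinearity is quadratic, hence locally Lipschitz from the state space to `L¹`. This is
what carries continuity in time over to the source. -/
theorem lintegral_source_sub_le (hf : Measurable f) (hfin : stateNorm f < ∞) (hg : Measurable g)
    (hgfin : stateNorm g < ∞) (hfg : stateNorm (fun X => f X - g X) < ∞) :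
    ∫⁻ X, ‖source f X - source g X‖ₑ ≤
      2 * symbolConst * stateNorm (fun X => f X - g X) * stateNorm f +
        2 * symbolConst * stateNorm g * stateNorm (fun X => f X - g X) := by
  have hn := integrable_density_state hf hfin
  have hn' := integrable_density_state hg hgfin
  have hd : Measurable fun X => f X - g X := hf.sub hg
  have hae := coulombTheta_sub_ae_eq hn (memLp_density_state hf hfin) hn'
    (memLp_density_state hg hgfin) hf (integrable_state hf hfin) hg (integrable_state hg hgfin)
  have hK : kernelBound (fun y => density f y - density g y) =
      kernelBound (density fun X => f X - g X) := by
    unfold kernelBound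
    rw [poissonSymbol_congr_ae (density_sub_ae_eq (integrable_state hf hfin)
      (integrable_state hg hgfin))]
  calc ∫⁻ X, ‖source f X - source g X‖ₑ
      = ∫⁻ X, ‖coulombTheta (fun y => density f y - density g y) f X +
          coulombTheta (density g) (fun X => f X - g X) X‖ₑ :=
        lintegral_congr_ae (hae.mono fun X hX => congrArg enorm hX)
    _ ≤ ∫⁻ X, (‖coulombTheta (fun y => density f y - density g y) f X‖ₑ +
          ‖coulombTheta (density g) (fun X => f X - g X) X‖ₑ) :=
        lintegral_mono fun X => enorm_add_le _ _
    _ = (∫⁻ X, ‖coulombTheta (fun y => density f y - density g y) f X‖ₑ) +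
          ∫⁻ X, ‖coulombTheta (density g) (fun X => f X - g X) X‖ₑ :=
        lintegral_add_left (measurable_coulombTheta (hn.sub hn') hf).enorm _
    _ ≤ _ := by
        refine add_le_add ((lintegral_coulombTheta_le (hn.sub hn') hf).trans ?_)
          ((lintegral_coulombTheta_le hn' hd).trans ?_)
        · change (∫⁻ ζ, kernelBound (fun y => density f y - density g y) ζ) * _ ≤ _
          rw [hK]
          exact mul_le_mul' (lintegral_kernelBound_state_le hd hfg)
            (lintegral_enorm_le_stateNorm hf)
        · exact mul_le_mul' (lintegral_kernelBound_state_le hg hgfin)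
            (lintegral_enorm_le_stateNorm hd)

end State

namespace StateCurve

variable {T : ℝ} {w : ℝ → Phase → ℝ}

/-- Each time has a neighbourhood in `[0, T]` on which the norm is at most one more than its value
there; compactness does the rest. -/
theorem exists_bound (hw : StateCurve T w) :
    ∃ m : ℝ, 0 < m ∧ ∀ s ∈ Icc 0 T, stateNorm (w s) ≤ ENNReal.ofReal m := by
  have h : ∃ c : ℝ≥0∞, c ≠ ∞ ∧ ∀ s ∈ Icc 0 T, stateNorm (w s) ≤ c := by
    refine isCompact_Icc.induction_on (p := fun S => ∃ c : ℝ≥0∞, c ≠ ∞ ∧ ∀ s ∈ S,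
      stateNorm (w s) ≤ c) ⟨0, by simp, by simp⟩ ?_ ?_ ?_
    · rintro S S' hS ⟨c, hc, h⟩
      exact ⟨c, hc, fun s hs => h s (hS hs)⟩
    · rintro S S' ⟨c, hc, h⟩ ⟨c', hc', h'⟩
      refine ⟨c + c', by finiteness, fun s hs => ?_⟩
      rcases hs with hs | hs
      · exact (h s hs).trans le_self_add
      · exact (h' s hs).trans le_add_self
    · intro s hs
      refine ⟨_, (hw.tendsto s hs).eventually (gt_mem_nhds zero_lt_one),
        1 + stateNorm (w s), by have := hw.finite s; finiteness, fun r hr => ?_⟩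
      have h1 := stateNorm_add_le (f := fun X => w r X - w s X) (g := w s)
        ((hw.measurable r).sub (hw.measurable s)) (hw.measurable s)
      simp only [sub_add_cancel] at h1
      exact h1.trans (add_le_add (le_of_lt hr) le_rfl)
  obtain ⟨c, hc, h⟩ := h
  refine ⟨c.toReal + 1, by positivity, fun s hs => (h s hs).trans ?_⟩
  rw [ENNReal.le_ofReal_iff_toReal_le hc (by positivity)]
  linarith

theorem tendsto_source (hw : StateCurve T w) {s : ℝ} (hs : s ∈ Icc 0 T) :
    Tendsto (fun r => ∫⁻ X, ‖source (w r) X - source (w s) X‖ₑ) (𝓝[Icc 0 T] s) (𝓝 0) := by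
  obtain ⟨m, hm, hb⟩ := hw.exists_bound
  have hC := symbolConst_ne_top
  have h1 := hw.tendsto s hs
  have hlim : Tendsto (fun r => 2 * symbolConst * stateNorm (fun X => w r X - w s X) *
      ENNReal.ofReal m + 2 * symbolConst * ENNReal.ofReal m *
        stateNorm (fun X => w r X - w s X)) (𝓝[Icc 0 T] s) (𝓝 0) := by
    have ha := ENNReal.Tendsto.mul_const (b := ENNReal.ofReal m)
      (ENNReal.Tendsto.const_mul (a := 2 * symbolConst) h1 (Or.inr (by finiteness)))
      (Or.inr ENNReal.ofReal_ne_top)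
    have hb := ENNReal.Tendsto.const_mul (a := 2 * symbolConst * ENNReal.ofReal m) h1
      (Or.inr (by finiteness))
    simpa using ha.add hb
  refine tendsto_of_tendsto_of_tendsto_of_le_of_le' tendsto_const_nhds hlim
    (Eventually.of_forall fun _ => zero_le) ?_
  filter_upwards [h1.eventually (gt_mem_nhds zero_lt_one), self_mem_nhdsWithin] with r hr hrT
  refine (lintegral_source_sub_le (hw.measurable r) (hw.finite r) (hw.measurable s) (hw.finite s)
    (lt_trans hr ENNReal.one_lt_top)).trans ?_
  gcongr
  · exact hb r hrT
  · exact hb s hs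

end StateCurve

/-! ### Measurability of the Duhamel integrand -/

namespace MasterEquation

variable {M : MasterEquation} {T : ℝ}

theorem propagator_nonneg {r : ℝ} (h : 0 < M.disc r) (X Z : Phase) : 0 ≤ M.propagator r X Z := by
  rw [propagator_eq]
  exact gauss_nonneg h _

theorem exists_propagator_le (hD : ∀ t ∈ Ioc 0 T, 0 < M.disc t) {r : ℝ} (hr : r ∈ Ioc 0 T) :
    ∃ c : ℝ, 0 ≤ c ∧ ∀ X Z, ‖M.propagator r X Z‖ ≤ c := by
  obtain ⟨K, hK0, hK⟩ := exists_coeff_add_le hD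
  refine ⟨M.gaussD r, (gaussD_pos (hD r hr)).le, fun X Z => ?_⟩
  rw [Real.norm_of_nonneg (propagator_nonneg (hD r hr) X Z), propagator_eq]
  refine (gauss_le_exp hD hr hK0 (hK r hr) _).trans (mul_le_of_le_one_right
    (gaussD_pos (hD r hr)).le ?_)
  rw [Real.exp_le_one_iff, neg_nonpos]
  positivity

/-- The action of the propagator. -/
noncomputable def forwardProp (M : MasterEquation) (r : ℝ) (f : Phase → ℝ) (X : Phase) : ℝ :=
  ∫ Z : Phase, M.propagator r X Z * f Z

theorem integrable_propagator_mul (hD : ∀ t ∈ Ioc 0 T, 0 < M.disc t) {r : ℝ} (hr : r ∈ Ioc 0 T)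
    {f : Phase → ℝ} (hf : Integrable f) (X : Phase) :
    Integrable fun Z => M.propagator r X Z * f Z := by
  obtain ⟨c, -, hc⟩ := exists_propagator_le hD hr
  exact hf.bdd_mul (c := c) ((M.measurable_propagator_prod r).comp
    measurable_prodMk_left).aestronglyMeasurable (Eventually.of_forall (hc X))

/-- At a fixed positive time the propagator is a bounded kernel, so `L¹` convergence yields
convergence at every point, which is what the measurability argument needs. -/
theorem tendsto_forwardProp (hD : ∀ t ∈ Ioc 0 T, 0 < M.disc t) {r : ℝ} (hr : r ∈ Ioc 0 T)
    {ι : Type*} {l : Filter ι} {F : ι → Phase → ℝ} {f : Phase → ℝ} (hF : ∀ i, Integrable (F i))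
    (hf : Integrable f) (h : Tendsto (fun i => ∫⁻ Z, ‖F i Z - f Z‖ₑ) l (𝓝 0)) (X : Phase) :
    Tendsto (fun i => M.forwardProp r (F i) X) l (𝓝 (M.forwardProp r f X)) := by
  obtain ⟨c, hc0, hc⟩ := exists_propagator_le hD hr
  refine tendsto_integral_of_L1 _ (integrable_propagator_mul hD hr hf X).1
    (Eventually.of_forall fun i => integrable_propagator_mul hD hr (hF i) X) ?_
  have h1 := ENNReal.Tendsto.const_mul (a := ENNReal.ofReal c) h (Or.inr ENNReal.ofReal_ne_top)
  rw [mul_zero] at h1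
  refine tendsto_of_tendsto_of_tendsto_of_le_of_le tendsto_const_nhds h1 (fun _ => zero_le)
    fun i => ?_
  dsimp only
  rw [← lintegral_const_mul' _ _ ENNReal.ofReal_ne_top]
  refine lintegral_mono fun Z => ?_
  dsimp only
  rw [← mul_sub, enorm_mul]
  gcongr
  rw [← ofReal_norm]
  exact ENNReal.ofReal_le_ofReal (hc X Z)

/-- The Duhamel integrand is measurable when the source is continuous in time with values
in `L¹`. -/
theorem measurable_forwardProp_indicator (hD : ∀ t ∈ Ioc 0 T, 0 < M.disc t) {t : ℝ}
    (ht : t ∈ Ioc 0 T) {F : ℝ → Phase → ℝ} (hFm : ∀ s, Measurable (F s))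
    (hF : ∀ s, Integrable (F s))
    (hcont : ∀ s ∈ Icc 0 T, Tendsto (fun r => ∫⁻ Z, ‖F r Z - F s Z‖ₑ) (𝓝[Icc 0 T] s) (𝓝 0)) :
    Measurable fun p : ℝ × Phase =>
      (Ioo 0 t).indicator (fun s => M.forwardProp (t - s) (F s) p.2) p.1 := by
  -- The family `F` is measurable in `Z` for each time only, not jointly. Sampling it at the grid
  -- times `⌊s k⌋ / k` involves countably many functions and is therefore jointly measurable.
  have hstep : ∀ k : ℕ, Measurable fun q : ℝ × Phase => F ((⌊q.1 * k⌋₊ : ℝ) / k) q.2 := by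
    intro k
    have h1 : Measurable fun q : ℕ × Phase => F ((q.1 : ℝ) / k) q.2 :=
      measurable_from_prod_countable_right fun m => hFm ((m : ℝ) / k)
    exact h1.comp (f := fun q : ℝ × Phase => (⌊q.1 * k⌋₊, q.2))
      ((Nat.measurable_floor.comp (by fun_prop)).prodMk measurable_snd)
  have hJ : ∀ k : ℕ, Measurable fun p : ℝ × Phase => (Ioo 0 t).indicator
      (fun s => M.forwardProp (t - s) (F ((⌊s * k⌋₊ : ℝ) / k)) p.2) p.1 := by
    intro k
    have h1 : Measurable fun p : ℝ × Phase =>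
        M.forwardProp (t - p.1) (F ((⌊p.1 * k⌋₊ : ℝ) / k)) p.2 := by
      have h2 : Measurable fun q : (ℝ × Phase) × Phase =>
          M.propagator (t - q.1.1) q.1.2 q.2 * F ((⌊q.1.1 * k⌋₊ : ℝ) / k) q.2 :=
        (M.measurable_propagator.comp (show Measurable fun q : (ℝ × Phase) × Phase =>
          (t - q.1.1, q.1.2, q.2) by fun_prop)).mul
          ((hstep k).comp (show Measurable fun q : (ℝ × Phase) × Phase => (q.1.1, q.2)
            by fun_prop))
      exact (h2.stronglyMeasurable.integral_prod_right' (ν := (volume : Measure Phase))).measurable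
    exact h1.indicator (measurableSet_Ioo.preimage measurable_fst : MeasurableSet
      (Prod.fst ⁻¹' Ioo (0 : ℝ) t : Set (ℝ × Phase)))
  refine measurable_of_tendsto_metrizable hJ (tendsto_pi_nhds.2 fun p => ?_)
  by_cases hp : p.1 ∈ Ioo 0 t
  · simp only [indicator_of_mem hp]
    have hr : t - p.1 ∈ Ioc 0 T := ⟨by linarith [hp.2], by linarith [hp.1, ht.2]⟩
    refine tendsto_forwardProp hD hr (fun k => hF _) (hF _) ?_ p.2
    refine (hcont p.1 ⟨hp.1.le, by linarith [hp.2, ht.2]⟩).comp ?_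
    rw [nhdsWithin_eq_nhds.2 (Icc_mem_nhds hp.1 (lt_of_lt_of_le hp.2 ht.2))]
    exact (tendsto_nat_floor_mul_div_atTop hp.1.le).comp tendsto_natCast_atTop_atTop
  · simp only [indicator_of_notMem hp]
    exact tendsto_const_nhds

end MasterEquation

end WignerPoisson

namespace WignerPoisson

/-! ### The Duhamel formula paired with test functions -/

theorem lintegral_kernel_mul_swap {k : Phase × Phase → ℝ≥0∞} (hk : Measurable k)
    {v g : Phase → ℝ≥0∞} (hv : Measurable v) (hg : Measurable g) :
    ∫⁻ X, (∫⁻ Z, k (X, Z) * v Z) * g X = ∫⁻ Z, v Z * ∫⁻ X, k (X, Z) * g X := by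
  have h1 : ∀ X, (∫⁻ Z, k (X, Z) * v Z) * g X = ∫⁻ Z, k (X, Z) * v Z * g X := fun X =>
    (lintegral_mul_const _ (by fun_prop)).symm
  have h2 : ∀ Z, v Z * ∫⁻ X, k (X, Z) * g X = ∫⁻ X, k (X, Z) * v Z * g X := fun Z => by
    rw [← lintegral_const_mul _ (by fun_prop)]
    exact lintegral_congr fun X => by ring
  simp_rw [h1, h2]
  exact lintegral_lintegral_swap (by unfold Function.uncurry; fun_prop)

namespace MasterEquation

variable {M : MasterEquation} {T : ℝ}

/-- The action of the propagator on nonnegative functions. -/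
noncomputable def absProp (M : MasterEquation) (r : ℝ) (v : Phase → ℝ≥0∞) (X : Phase) : ℝ≥0∞ :=
  ∫⁻ Z : Phase, ENNReal.ofReal (M.propagator r X Z) * v Z

theorem measurable_absProp (M : MasterEquation) (r : ℝ) {v : Phase → ℝ≥0∞} (hv : Measurable v) :
    Measurable (M.absProp r v) :=
  Measurable.lintegral_prod_right'
    (f := fun p : Phase × Phase => ENNReal.ofReal (M.propagator r p.1 p.2) * v p.2)
    ((M.measurable_propagator_prod r).ennreal_ofReal.mul (hv.comp measurable_snd))

theorem enorm_propagator (hD : ∀ t ∈ Ioc 0 T, 0 < M.disc t) {r : ℝ} (hr : r ∈ Ioc 0 T)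
    (X Z : Phase) : ‖M.propagator r X Z‖ₑ = ENNReal.ofReal (M.propagator r X Z) :=
  Real.enorm_of_nonneg (propagator_nonneg (hD r hr) X Z)

theorem enorm_forwardProp_le (hD : ∀ t ∈ Ioc 0 T, 0 < M.disc t) {r : ℝ} (hr : r ∈ Ioc 0 T)
    (f : Phase → ℝ) (X : Phase) :
    ‖M.forwardProp r f X‖ₑ ≤ M.absProp r (fun Z => ‖f Z‖ₑ) X := by
  refine (enorm_integral_le_lintegral_enorm _).trans (le_of_eq (lintegral_congr fun Z => ?_))
  rw [enorm_mul, enorm_propagator hD hr]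

/-- Writes the nonnegative Duhamel integrand as the propagator acting on a real `L¹` function, so
that the measurability result for such actions applies to it. -/
theorem absProp_enorm_eq (hD : ∀ t ∈ Ioc 0 T, 0 < M.disc t) {r : ℝ} (hr : r ∈ Ioc 0 T)
    {f : Phase → ℝ} (hf : Integrable f) (X : Phase) :
    M.absProp r (fun Z => ‖f Z‖ₑ) X = ENNReal.ofReal (M.forwardProp r (fun Z => |f Z|) X) := by
  rw [forwardProp, ofReal_integral_eq_lintegral_ofReal (integrable_propagator_mul hD hr hf.abs X)
    (Eventually.of_forall fun Z => mul_nonneg (propagator_nonneg (hD r hr) X Z) (abs_nonneg _))]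
  refine lintegral_congr fun Z => ?_
  rw [ENNReal.ofReal_mul (propagator_nonneg (hD r hr) X Z), ← Real.enorm_eq_ofReal_abs]

theorem lintegral_absProp_mul (M : MasterEquation) (r : ℝ) {v g : Phase → ℝ≥0∞}
    (hv : Measurable v) (hg : Measurable g) :
    ∫⁻ X, M.absProp r v X * g X = ∫⁻ Z, v Z * M.backProp r g Z :=
  lintegral_kernel_mul_swap (M.measurable_propagator_prod r).ennreal_ofReal hv hg

end MasterEquation

namespace StateCurve

variable {M : MasterEquation} {T : ℝ} {w : ℝ → Phase → ℝ}

theorem tendsto_abs_source (hw : StateCurve T w) {s : ℝ} (hs : s ∈ Icc 0 T) :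
    Tendsto (fun r => ∫⁻ X, ‖|source (w r) X| - |source (w s) X|‖ₑ) (𝓝[Icc 0 T] s) (𝓝 0) :=
  tendsto_of_tendsto_of_tendsto_of_le_of_le tendsto_const_nhds (hw.tendsto_source hs)
    (fun _ => zero_le) fun r => lintegral_mono fun X => by
      rw [enorm_le_iff_norm_le, Real.norm_eq_abs, Real.norm_eq_abs]
      exact abs_abs_sub_abs_le _ _

theorem measurable_absProp_indicator (hw : StateCurve T w)
    (hD : ∀ t ∈ Ioc 0 T, 0 < M.disc t) {t : ℝ} (ht : t ∈ Ioc 0 T) :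
    Measurable fun p : ℝ × Phase => (Ioo 0 t).indicator
      (fun s => M.absProp (t - s) (fun Z => ‖source (w s) Z‖ₑ) p.2) p.1 := by
  have h1 := (MasterEquation.measurable_forwardProp_indicator hD ht
    (F := fun s Z => |source (w s) Z|)
    (fun s => (measurable_source (hw.measurable s) (hw.finite s)).abs)
    (fun s => (integrable_source (hw.measurable s) (hw.finite s)).abs)
    (fun s hs => hw.tendsto_abs_source hs)).ennreal_ofReal
  convert h1 using 2 with p
  by_cases hp : p.1 ∈ Ioo 0 t
  · simp only [indicator_of_mem hp]
    exact MasterEquation.absProp_enorm_eq hD ⟨by linarith [hp.2], by linarith [hp.1, ht.2]⟩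
      (integrable_source (hw.measurable _) (hw.finite _)) _
  · simp only [indicator_of_notMem hp, ENNReal.ofReal_zero]

theorem lintegral_source_mul_le (hw : StateCurve T w) (s : ℝ) {h : Phase → ℝ≥0∞}
    (hh : Measurable h) :
    ∫⁻ X, ‖source (w s) X‖ₑ * h X ≤
      ∫⁻ X, ‖w s X‖ₑ * momentumConv (kernelBound (density (w s))) h X :=
  lintegral_coulombTheta_mul_le (integrable_density_state (hw.measurable s) (hw.finite s))
    (hw.measurable s) hh

/-- The Duhamel formula. -/
def Solves (M : MasterEquation) (T : ℝ) (w : ℝ → Phase → ℝ) : Prop :=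
  ∀ t ∈ Ioc 0 T, ∀ᵐ X, w t X = M.forwardProp t (w 0) X -
    ∫ s in (0 : ℝ)..t, M.forwardProp (t - s) (source (w s)) X

theorem enorm_duhamel_le (hD : ∀ t ∈ Ioc 0 T, 0 < M.disc t) {a t : ℝ} (ht : t ∈ Ioc 0 T)
    (ha : a ∈ Icc 0 t) (X : Phase) :
    ‖∫ s in a..t, M.forwardProp (t - s) (source (w s)) X‖ₑ ≤
      ∫⁻ s in Ioo a t, M.absProp (t - s) (fun Z => ‖source (w s) Z‖ₑ) X := by
  rw [intervalIntegral.integral_of_le ha.2, setIntegral_congr_set Ioo_ae_eq_Ioc.symm]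
  refine (enorm_integral_le_lintegral_enorm _).trans ?_
  refine setLIntegral_mono' measurableSet_Ioo fun s hs => ?_
  exact MasterEquation.enorm_forwardProp_le hD
    ⟨by linarith [hs.2], by linarith [hs.1, ha.1, ht.2]⟩ _ X

/-- Tonelli moves the propagator and the momentum convolution from the source to the test function,
which gives the Duhamel inequality required by the Gronwall argument. -/
theorem lintegral_duhamel_mul_le (hw : StateCurve T w) (hD : ∀ t ∈ Ioc 0 T, 0 < M.disc t)
    {a t : ℝ} (ht : t ∈ Ioc 0 T) (ha : a ∈ Icc 0 t) {g : Phase → ℝ≥0∞} (hg : Measurable g) :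
    ∫⁻ X, (∫⁻ s in Ioo a t, M.absProp (t - s) (fun Z => ‖source (w s) Z‖ₑ) X) * g X ≤
      ∫⁻ s in Ioo a t, ∫⁻ X, ‖w s X‖ₑ *
        momentumConv (kernelBound (density (w s))) (M.backProp (t - s) g) X := by
  have hm := hw.measurable_absProp_indicator hD ht
  set Φ : ℝ × Phase → ℝ≥0∞ := fun p => (Ioo 0 t).indicator
      (fun s => M.absProp (t - s) (fun Z => ‖source (w s) Z‖ₑ) p.2) p.1 with hΦ
  have hsub : Ioo a t ⊆ Ioo 0 t := Ioo_subset_Ioo_left ha.1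
  have h1 : ∀ X, (∫⁻ s in Ioo a t, M.absProp (t - s) (fun Z => ‖source (w s) Z‖ₑ) X) * g X =
      ∫⁻ s in Ioo a t, Φ (s, X) * g X := by
    intro X
    have hmX : Measurable fun s => Φ (s, X) := hm.comp measurable_prodMk_right
    rw [lintegral_mul_const _ hmX]
    congr 1
    refine setLIntegral_congr_fun measurableSet_Ioo fun s hs => ?_
    simp only [hΦ, indicator_of_mem (hsub hs)]
  simp_rw [h1]
  rw [lintegral_lintegral_swap (f := fun (X : Phase) (s : ℝ) => Φ (s, X) * g X)
    ((hm.comp measurable_swap).mul (hg.comp measurable_fst)).aemeasurable]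
  refine setLIntegral_mono' measurableSet_Ioo fun s hs => ?_
  have h2 : ∀ X, Φ (s, X) * g X =
      M.absProp (t - s) (fun Z => ‖source (w s) Z‖ₑ) X * g X := fun X => by
    simp only [hΦ, indicator_of_mem (hsub hs)]
  simp_rw [h2]
  rw [MasterEquation.lintegral_absProp_mul M _
    (measurable_source (hw.measurable s) (hw.finite s)).enorm hg]
  exact hw.lintegral_source_mul_le s (M.measurable_backProp _ hg)

/-- A state curve solving the Duhamel formula is bounded, away from the initial time, in the dual
of the amalgam seminorm. -/
theorem exists_dualBound (hw : StateCurve T w) (hT : 0 < T)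
    (hD : ∀ t ∈ Ioc 0 T, 0 < M.disc t) (heq : Solves M T w) {τ : ℝ} (hτ : 0 < τ) :
    ∃ B : ℝ, 0 < B ∧ ∀ t ∈ Icc τ T, DualBound B fun X => ‖w t X‖ₑ := by
  obtain ⟨m, hm, hb⟩ := hw.exists_bound
  set κ := (2 * symbolConst * ENNReal.ofReal m).toReal + 1 with hκ
  have hC := symbolConst_ne_top
  refine MasterEquation.exists_lintegral_mul_le hT hD (u := fun t X => ‖w t X‖ₑ)
    (u₀ := fun X => ‖w 0 X‖ₑ) (K := fun s => kernelBound (density (w s))) (κ := κ) hm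
    (by rw [hκ]; linarith [ENNReal.toReal_nonneg (a := 2 * symbolConst * ENNReal.ofReal m)])
    (fun t _ => (hw.measurable t).enorm.aemeasurable)
    (fun t ht => (lintegral_enorm_le_stateNorm (hw.measurable t)).trans (hb t ⟨ht.1.le, ht.2⟩))
    (hw.measurable 0).enorm.aemeasurable
    ((lintegral_enorm_le_stateNorm (hw.measurable 0)).trans (hb 0 ⟨le_rfl, hT.le⟩))
    (fun s _ => measurable_kernelBound
      (integrable_density_state (hw.measurable s) (hw.finite s)))
    (fun s hs => ?_) (fun t ht g hg => ?_) hτ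
  · refine (lintegral_kernelBound_state_le (hw.measurable s) (hw.finite s)).trans ?_
    calc 2 * symbolConst * stateNorm (w s) ≤ 2 * symbolConst * ENNReal.ofReal m := by
          gcongr; exact hb s ⟨hs.1.le, hs.2⟩
      _ ≤ _ := by
          rw [ENNReal.le_ofReal_iff_toReal_le (by finiteness) (by positivity), hκ]
          linarith
  · calc ∫⁻ X, ‖w t X‖ₑ * g X
        ≤ ∫⁻ X, (M.absProp t (fun Z => ‖w 0 Z‖ₑ) X * g X +
            (∫⁻ s in Ioo 0 t, M.absProp (t - s) (fun Z => ‖source (w s) Z‖ₑ) X) * g X) := by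
          refine lintegral_mono_ae ((heq t ht).mono fun X hX => ?_)
          rw [hX, ← add_mul]
          gcongr
          exact enorm_sub_le.trans (add_le_add (MasterEquation.enorm_forwardProp_le hD ht _ X)
            (enorm_duhamel_le hD ht ⟨le_rfl, ht.1.le⟩ X))
      _ = (∫⁻ X, M.absProp t (fun Z => ‖w 0 Z‖ₑ) X * g X) +
            ∫⁻ X, (∫⁻ s in Ioo 0 t, M.absProp (t - s) (fun Z => ‖source (w s) Z‖ₑ) X) * g X :=
          lintegral_add_left ((M.measurable_absProp _ (hw.measurable 0).enorm).mul hg) _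
      _ ≤ _ := by
          rw [MasterEquation.lintegral_absProp_mul M t (hw.measurable 0).enorm hg]
          exact add_le_add le_rfl (hw.lintegral_duhamel_mul_le hD ht ⟨le_rfl, ht.1.le⟩ hg)

end StateCurve

end WignerPoisson

namespace WignerPoisson

/-- The kernel bound does not depend on position and is integrable in momentum, so convolution with
it preserves essential bounds. -/
theorem ae_enorm_source_le {f : Phase → ℝ} (hf : Measurable f) (hfin : stateNorm f < ∞)
    {c : ℝ≥0∞} (hc : ∀ᵐ X, ‖f X‖ₑ ≤ c) :
    ∀ᵐ X, ‖source f X‖ₑ ≤ 2 * symbolConst * stateNorm f * c := by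
  have h1 : ∀ᵐ x : E3, ∀ᵐ ξ : E3, ‖f (x, ξ)‖ₑ ≤ c := Measure.ae_ae_of_ae_prod hc
  have h2 : ∀ᵐ X : Phase, ∀ᵐ ξ : E3, ‖f (X.1, ξ)‖ₑ ≤ c :=
    Measure.quasiMeasurePreserving_fst.ae h1
  have hK := measurable_kernelBound (integrable_density_state hf hfin)
  have hKs : ∀ y, Measurable fun ξ' : E3 => kernelBound (density f) (y - ξ') := fun y =>
    hK.comp (by fun_prop)
  filter_upwards [h2] with X hX
  calc ‖source f X‖ₑ
      ≤ ∫⁻ ξ' : E3, kernelBound (density f) (X.2 - ξ') * ‖f (X.1, ξ')‖ₑ :=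
        enorm_coulombTheta_le _ f X
    _ ≤ ∫⁻ ξ' : E3, kernelBound (density f) (X.2 - ξ') * c :=
        lintegral_mono_ae (hX.mono fun ξ' h => mul_le_mul_right h _)
    _ = (∫⁻ ζ, kernelBound (density f) ζ) * c := by
        rw [lintegral_mul_const _ (hKs _),
          lintegral_sub_left_eq_self (kernelBound (density f))]
    _ ≤ _ := mul_le_mul_left (lintegral_kernelBound_state_le hf hfin) _

namespace MasterEquation

variable {M : MasterEquation} {T : ℝ}

/-! ### Lipschitz bounds for the propagator away from the initial time -/

/-- Positivity of the discriminant gives `B² < 4AC ≤ (A + C)²`. -/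
theorem abs_coeffB_le (hD : ∀ t ∈ Ioc 0 T, 0 < M.disc t) {t : ℝ} (ht : t ∈ Ioc 0 T) :
    |M.coeffB t| ≤ M.coeffA t + M.coeffC t := by
  have h1 := hD t ht
  have h2 := coeffA_pos hD ht
  have h3 := coeffC_pos hD ht
  simp only [disc] at h1
  refine abs_le_of_sq_le_sq ?_ (by linarith)
  nlinarith [sq_nonneg (M.coeffA t - M.coeffC t)]

theorem quadratic_sub_le {A B C K : ℝ} (hA : 0 ≤ A) (hC : 0 ≤ C) (hB : |B| ≤ K) (hAC : A + C ≤ K)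
    (Y Y' : Phase) :
    (C * ‖Y'.1‖ ^ 2 - B * inner ℝ Y'.1 Y'.2 + A * ‖Y'.2‖ ^ 2) -
      (C * ‖Y.1‖ ^ 2 - B * inner ℝ Y.1 Y.2 + A * ‖Y.2‖ ^ 2) ≤
      2 * K * (‖Y - Y'‖ * (‖Y‖ + ‖Y'‖)) := by
  have hsq : ∀ y y' : E3, ‖y - y'‖ ≤ ‖Y - Y'‖ → ‖y‖ ≤ ‖Y‖ → ‖y'‖ ≤ ‖Y'‖ →
      ‖y'‖ ^ 2 - ‖y‖ ^ 2 ≤ ‖Y - Y'‖ * (‖Y‖ + ‖Y'‖) := by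
    intro y y' h h1 h2
    calc ‖y'‖ ^ 2 - ‖y‖ ^ 2 = (‖y'‖ - ‖y‖) * (‖y‖ + ‖y'‖) := by ring
      _ ≤ ‖Y - Y'‖ * (‖y‖ + ‖y'‖) := by
          gcongr
          have := norm_sub_norm_le y' y
          rw [norm_sub_rev] at this
          exact this.trans h
      _ ≤ _ := by gcongr
  have h1 : ‖Y.1 - Y'.1‖ ≤ ‖Y - Y'‖ := norm_fst_le (Y - Y')
  have h2 : ‖Y.2 - Y'.2‖ ≤ ‖Y - Y'‖ := norm_snd_le (Y - Y')
  have e1 := hsq _ _ h1 (norm_fst_le Y) (norm_fst_le Y')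
  have e2 := hsq _ _ h2 (norm_snd_le Y) (norm_snd_le Y')
  have e3 : |inner ℝ Y.1 Y.2 - inner ℝ Y'.1 Y'.2| ≤ ‖Y - Y'‖ * (‖Y‖ + ‖Y'‖) := by
    have : inner ℝ Y.1 Y.2 - inner ℝ Y'.1 Y'.2 =
        inner ℝ Y.1 (Y.2 - Y'.2) + inner ℝ (Y.1 - Y'.1) Y'.2 := by
      rw [inner_sub_right, inner_sub_left]
      ring
    rw [this]
    calc _ ≤ |inner ℝ Y.1 (Y.2 - Y'.2)| + |inner ℝ (Y.1 - Y'.1) Y'.2| := abs_add_le _ _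
      _ ≤ ‖Y.1‖ * ‖Y.2 - Y'.2‖ + ‖Y.1 - Y'.1‖ * ‖Y'.2‖ :=
          add_le_add (abs_real_inner_le_norm _ _) (abs_real_inner_le_norm _ _)
      _ ≤ ‖Y‖ * ‖Y - Y'‖ + ‖Y - Y'‖ * ‖Y'‖ := by
          gcongr
          exacts [norm_fst_le Y, norm_snd_le Y']
      _ = _ := by ring
  set R := ‖Y - Y'‖ * (‖Y‖ + ‖Y'‖)
  have hR : 0 ≤ R := by positivity
  have e4 : B * (inner ℝ Y.1 Y.2 - inner ℝ Y'.1 Y'.2) ≤ K * R :=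
    (le_abs_self _).trans (by rw [abs_mul]; gcongr; exact (abs_nonneg _).trans hB)
  have e5 := mul_le_mul_of_nonneg_left e1 hC
  have e6 := mul_le_mul_of_nonneg_left e2 hA
  have e7 := mul_le_mul_of_nonneg_right hAC hR
  linarith

theorem add_mul_exp_neg_le {k y : ℝ} (hk : 0 < k) :
    (2 * y + 1) * Real.exp (-(k * y ^ 2)) ≤ 2 + 1 / k := by
  have h1 : 1 + k * y ^ 2 ≤ Real.exp (k * y ^ 2) := by
    linarith [Real.add_one_le_exp (k * y ^ 2)]
  have h2 : 0 < 1 + k * y ^ 2 := by positivity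
  rw [Real.exp_neg, ← div_eq_mul_inv, div_le_iff₀ (Real.exp_pos _)]
  have h3 : 2 * y + 1 ≤ (2 + 1 / k) * (1 + k * y ^ 2) := by
    have : (2 + 1 / k) * (1 + k * y ^ 2) = 2 + 1 / k + 2 * (k * y ^ 2) + y ^ 2 := by
      field_simp
      ring
    rw [this]
    have h4 : 0 < 1 / k := by positivity
    nlinarith [sq_nonneg (y - 1), mul_nonneg hk.le (sq_nonneg y)]
  exact h3.trans (by gcongr)

/-- On `[η, T]` the discriminant is bounded below. The exponent varies by at most a multiple of `‖Y
- Y'‖ (2‖Y‖ + 1)`, and the Gaussian decay at `Y` absorbs the linear growth. The inequality `1 + z ≤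
eᶻ` gives a one-sided estimate, and exchanging `Y` and `Y'` gives the other side. -/
theorem exists_gauss_sub_le (hD : ∀ t ∈ Ioc 0 T, 0 < M.disc t) {η : ℝ} (hη : 0 < η)
    (hηT : η ≤ T) :
    ∃ L : ℝ, 0 < L ∧ ∀ r ∈ Icc η T, ∀ Y Y' : Phase, ‖Y - Y'‖ ≤ 1 →
      |M.gauss r Y - M.gauss r Y'| ≤ L * ‖Y - Y'‖ := by
  have hT : 0 < T := hη.trans_le hηT
  obtain ⟨K, hK0, hK⟩ := exists_coeff_add_le hD
  obtain ⟨n, c, hc, hcD⟩ := exists_pow_le_disc hT hD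
  set D₀ := c * η ^ n with hD₀
  have hD₀pos : 0 < D₀ := by positivity
  set G := 1 + (D₀ ^ 2)⁻¹ with hG
  set k := 1 / (4 * K) with hk
  have hkpos : 0 < k := by positivity
  set L := G * (1 / D₀ * (2 * K)) * (2 + 1 / k) with hL
  have key : ∀ r ∈ Icc η T, ∀ Y Y' : Phase, ‖Y - Y'‖ ≤ 1 →
      M.gauss r Y - M.gauss r Y' ≤ L * ‖Y - Y'‖ := by
    intro r hr Y Y' hYY
    have hr' : r ∈ Ioc 0 T := ⟨hη.trans_le hr.1, hr.2⟩
    have hdr := hD r hr'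
    have hdr0 : D₀ ≤ M.disc r := 
      (mul_le_mul_of_nonneg_left (pow_le_pow_left₀ hη.le hr.1 n) hc.le).trans (hcD r hr')
    have hgD : M.gaussD r ≤ G := (gaussD_le hdr).trans (by rw [hG]; gcongr)
    have hgD0 := (gaussD_pos hdr).le
    set q : Phase → ℝ := fun Y => 1 / M.disc r * (M.coeffC r * ‖Y.1‖ ^ 2 -
      M.coeffB r * inner ℝ Y.1 Y.2 + M.coeffA r * ‖Y.2‖ ^ 2) with hq
    have hgq : ∀ Y, M.gauss r Y = M.gaussD r * Real.exp (-q Y) := fun Y => by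
      rw [gauss, gaussian_eq hdr]
    have hY' : ‖Y'‖ ≤ ‖Y‖ + 1 := by
      have := norm_sub_norm_le Y' Y
      rw [norm_sub_rev] at this
      linarith
    have h1 : q Y' - q Y ≤ 1 / D₀ * (2 * K) * (‖Y - Y'‖ * (2 * ‖Y‖ + 1)) := by
      have h2 := quadratic_sub_le (coeffA_pos hD hr').le (coeffC_pos hD hr').le
        ((abs_coeffB_le hD hr').trans (hK r hr')) (hK r hr') Y Y'
      calc q Y' - q Y = 1 / M.disc r * ((M.coeffC r * ‖Y'.1‖ ^ 2 -
            M.coeffB r * inner ℝ Y'.1 Y'.2 + M.coeffA r * ‖Y'.2‖ ^ 2) -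
            (M.coeffC r * ‖Y.1‖ ^ 2 - M.coeffB r * inner ℝ Y.1 Y.2 +
              M.coeffA r * ‖Y.2‖ ^ 2)) := by rw [hq]; ring
        _ ≤ 1 / M.disc r * (2 * K * (‖Y - Y'‖ * (‖Y‖ + ‖Y'‖))) := by gcongr
        _ ≤ 1 / D₀ * (2 * K * (‖Y - Y'‖ * (2 * ‖Y‖ + 1))) := by
            have : ‖Y‖ + ‖Y'‖ ≤ 2 * ‖Y‖ + 1 := by linarith
            gcongr
        _ = _ := by ring
    have h3 : Real.exp (-q Y) - Real.exp (-q Y') ≤ Real.exp (-q Y) * (q Y' - q Y) := by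
      have h4 : Real.exp (-q Y') = Real.exp (-q Y) * Real.exp (q Y - q Y') := by
        rw [← Real.exp_add]; congr 1; ring
      have h5 := Real.add_one_le_exp (q Y - q Y')
      have h6 := mul_le_mul_of_nonneg_left h5 (Real.exp_pos (-q Y)).le
      rw [h4]
      linarith
    have h7 : M.gaussD r * Real.exp (-q Y) ≤ G * Real.exp (-(k * ‖Y‖ ^ 2)) := by
      rw [← hgq]
      exact (gauss_le_exp hD hr' hK0 (hK r hr') Y).trans (by gcongr)
    have h8 := add_mul_exp_neg_le (y := ‖Y‖) hkpos
    rw [hgq, hgq, ← mul_sub]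
    calc M.gaussD r * (Real.exp (-q Y) - Real.exp (-q Y'))
        ≤ M.gaussD r * (Real.exp (-q Y) * (q Y' - q Y)) := by gcongr
      _ ≤ M.gaussD r * (Real.exp (-q Y) *
            (1 / D₀ * (2 * K) * (‖Y - Y'‖ * (2 * ‖Y‖ + 1)))) := by gcongr
      _ = (M.gaussD r * Real.exp (-q Y)) *
            (1 / D₀ * (2 * K) * (‖Y - Y'‖ * (2 * ‖Y‖ + 1))) := by ring
      _ ≤ (G * Real.exp (-(k * ‖Y‖ ^ 2))) *
            (1 / D₀ * (2 * K) * (‖Y - Y'‖ * (2 * ‖Y‖ + 1))) := by gcongr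
      _ = G * (1 / D₀ * (2 * K)) * ‖Y - Y'‖ *
            ((2 * ‖Y‖ + 1) * Real.exp (-(k * ‖Y‖ ^ 2))) := by ring
      _ ≤ G * (1 / D₀ * (2 * K)) * ‖Y - Y'‖ * (2 + 1 / k) := by gcongr
      _ = _ := by ring
  refine ⟨L, by positivity, fun r hr Y Y' h => abs_le.2 ⟨?_, key r hr Y Y' h⟩⟩
  have := key r hr Y' Y (by rwa [norm_sub_rev])
  rw [norm_sub_rev] at this
  linarith

theorem enorm_forwardProp_sub_le (hD : ∀ t ∈ Ioc 0 T, 0 < M.disc t) {r : ℝ} (hr : r ∈ Ioc 0 T)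
    {f : Phase → ℝ} (hf : Integrable f) {X Y : Phase} {l : ℝ}
    (h : ∀ Z, |M.propagator r X Z - M.propagator r Y Z| ≤ l) :
    ‖M.forwardProp r f X - M.forwardProp r f Y‖ₑ ≤ ENNReal.ofReal l * ∫⁻ Z, ‖f Z‖ₑ := by
  unfold forwardProp
  rw [← integral_sub (integrable_propagator_mul hD hr hf X) (integrable_propagator_mul hD hr hf Y),
    ← lintegral_const_mul' _ _ ENNReal.ofReal_ne_top]
  refine (enorm_integral_le_lintegral_enorm _).trans (lintegral_mono fun Z => ?_)
  dsimp only
  rw [← sub_mul, enorm_mul]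
  gcongr
  rw [Real.enorm_eq_ofReal_abs]
  exact ENNReal.ofReal_le_ofReal (h Z)

theorem absProp_le_of_ae_le (hD : ∀ t ∈ Ioc 0 T, 0 < M.disc t) {r : ℝ} (hr : r ∈ Ioc 0 T)
    (hdet : 1 / 2 ≤ |(M.flow r).det|) {v : Phase → ℝ≥0∞} {b : ℝ≥0∞} (hv : ∀ᵐ Z, v Z ≤ b)
    (X : Phase) : M.absProp r v X ≤ 2 * b := by
  calc M.absProp r v X ≤ ∫⁻ Z, ENNReal.ofReal (M.propagator r X Z) * b :=
        lintegral_mono_ae (hv.mono fun Z hZ => mul_le_mul_right hZ _)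
    _ = (∫⁻ Z, ENNReal.ofReal (M.propagator r X Z)) * b :=
        lintegral_mul_const _ ((M.measurable_propagator_prod r).comp
          measurable_prodMk_left).ennreal_ofReal
    _ ≤ 2 * b := mul_le_mul_left (lintegral_propagator_right hD hr hdet X) _

end MasterEquation

end WignerPoisson

namespace WignerPoisson

/-! ### Equicontinuity in phase space and continuity in time -/

namespace StateCurve

variable {M : MasterEquation} {T : ℝ} {w : ℝ → Phase → ℝ}

/-- Its double integral over phase space and time is finite, since the propagator preserves mass and
the source is bounded in `L¹`. This makes the Duhamel integral at a generic point absolutely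
convergent, so that two such integrals can be subtracted. -/
theorem ae_lintegral_absProp_lt_top (hw : StateCurve T w) (hD : ∀ t ∈ Ioc 0 T, 0 < M.disc t)
    {t : ℝ} (ht : t ∈ Ioc 0 T) :
    ∀ᵐ X, ∫⁻ s in Ioo 0 t, M.absProp (t - s) (fun Z => ‖source (w s) Z‖ₑ) X < ∞ := by
  obtain ⟨m, hm, hb⟩ := hw.exists_bound
  have hC := symbolConst_ne_top
  set Φ : ℝ × Phase → ℝ≥0∞ := fun p => (Ioo 0 t).indicator
    (fun s => M.absProp (t - s) (fun Z => ‖source (w s) Z‖ₑ) p.2) p.1 with hΦ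
  have hΦm : Measurable Φ := hw.measurable_absProp_indicator hD ht
  have hΦe : ∀ X, ∫⁻ s in Ioo 0 t, M.absProp (t - s) (fun Z => ‖source (w s) Z‖ₑ) X =
      ∫⁻ s in Ioo 0 t, Φ (s, X) := fun X =>
    setLIntegral_congr_fun measurableSet_Ioo fun s hs => by simp only [hΦ, indicator_of_mem hs]
  have h1 : ∫⁻ X, ∫⁻ s in Ioo 0 t, Φ (s, X) ≠ ∞ := by
    rw [lintegral_lintegral_swap (f := fun (X : Phase) (s : ℝ) => Φ (s, X))
      (hΦm.comp measurable_swap).aemeasurable]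
    refine ne_of_lt (lt_of_le_of_lt (setLIntegral_mono' (g := fun _ => 2 * symbolConst *
      ENNReal.ofReal m * ENNReal.ofReal m) measurableSet_Ioo fun s hs => ?_) ?_)
    · have hr : t - s ∈ Ioc 0 T := ⟨by linarith [hs.2], by linarith [hs.1, ht.2]⟩
      have hms := (measurable_source (hw.measurable s) (hw.finite s)).enorm
      have h2 := MasterEquation.lintegral_absProp_mul M (t - s) hms
        (g := fun _ => 1) measurable_const
      simp only [mul_one] at h2
      have h3 : ∫⁻ X, Φ (s, X) = ∫⁻ X, M.absProp (t - s) (fun Z => ‖source (w s) Z‖ₑ) X :=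
        lintegral_congr fun X => by simp only [hΦ, indicator_of_mem hs]
      rw [h3, h2]
      have hbs := hb s ⟨hs.1.le, hs.2.le.trans ht.2⟩
      calc ∫⁻ Z, ‖source (w s) Z‖ₑ * M.backProp (t - s) (fun _ => 1) Z
          ≤ ∫⁻ Z, ‖source (w s) Z‖ₑ := lintegral_mono fun Z => mul_le_of_le_one_right'
            (MasterEquation.backProp_le_of_le hD hr (fun _ => le_rfl) Z)
        _ ≤ _ := (lintegral_source_le (hw.measurable s) (hw.finite s)).trans (by gcongr)
    · rw [setLIntegral_const]
      simp only [Real.volume_Ioo]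
      finiteness
  have h4 : Measurable fun X => ∫⁻ s in Ioo 0 t, Φ (s, X) :=
    Measurable.lintegral_prod_right' (f := fun p : Phase × ℝ => Φ (p.2, p.1))
      (hΦm.comp measurable_swap)
  filter_upwards [ae_lt_top h4 h1] with X hX
  rwa [hΦe]

theorem integrableOn_forwardProp (hw : StateCurve T w) (hD : ∀ t ∈ Ioc 0 T, 0 < M.disc t)
    {t : ℝ} (ht : t ∈ Ioc 0 T) {X : Phase}
    (hX : ∫⁻ s in Ioo 0 t, M.absProp (t - s) (fun Z => ‖source (w s) Z‖ₑ) X < ∞) :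
    IntegrableOn (fun s => M.forwardProp (t - s) (source (w s)) X) (Ioo 0 t) := by
  have hm := MasterEquation.measurable_forwardProp_indicator hD ht (F := fun s => source (w s))
    (fun s => measurable_source (hw.measurable s) (hw.finite s))
    (fun s => integrable_source (hw.measurable s) (hw.finite s))
    (fun s hs => hw.tendsto_source hs)
  have hmX : Measurable ((Ioo 0 t).indicator
      fun s => M.forwardProp (t - s) (source (w s)) X) := hm.comp measurable_prodMk_right
  refine ⟨?_, lt_of_le_of_lt (setLIntegral_mono' measurableSet_Ioo fun s hs =>
    MasterEquation.enorm_forwardProp_le hD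
      ⟨by linarith [hs.2], by linarith [hs.1, ht.2]⟩ _ X) hX⟩
  exact (aestronglyMeasurable_indicator_iff measurableSet_Ioo).1 hmX.aestronglyMeasurable

/-- Solutions are, up to null sets, uniformly equicontinuous away from the initial time. -/
theorem exists_modulus (hw : StateCurve T w) (hT : 0 < T)
    (hD : ∀ t ∈ Ioc 0 T, 0 < M.disc t) (heq : Solves M T w) {τ : ℝ} (hτ : 0 < τ) (hτT : τ ≤ T)
    {ε : ℝ} (hε : 0 < ε) :
    ∃ δ : ℝ, 0 < δ ∧ ∀ t ∈ Icc τ T, ∀ᵐ X : Phase, ∀ᵐ Y : Phase, ‖X - Y‖ ≤ δ →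
      ‖w t X - w t Y‖ₑ ≤ ENNReal.ofReal ε := by
  obtain ⟨m, hm, hb⟩ := hw.exists_bound
  obtain ⟨B, hB0, hB⟩ := hw.exists_dualBound hT hD heq (half_pos hτ)
  obtain ⟨r₀, hr₀, hflow⟩ := M.exists_flow_near_id
  have hC := symbolConst_ne_top
  set b := (2 * symbolConst * ENNReal.ofReal m * ENNReal.ofReal B).toReal with hb'
  have hb0 : 0 ≤ b := ENNReal.toReal_nonneg
  have hbe : ENNReal.ofReal b = 2 * symbolConst * ENNReal.ofReal m * ENNReal.ofReal B :=
    ENNReal.ofReal_toReal (by finiteness)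
  set q := (2 * symbolConst * ENNReal.ofReal m * ENNReal.ofReal m).toReal with hq'
  have hq0 : 0 ≤ q := ENNReal.toReal_nonneg
  have hqe : ENNReal.ofReal q = 2 * symbolConst * ENNReal.ofReal m * ENNReal.ofReal m :=
    ENNReal.ofReal_toReal (by finiteness)
  -- For the last `η` units of time before `t` three things are needed: the Jacobian bound (`η ≤
  -- r₀`), times at least `τ/2` where the sup bound holds, and a contribution `4 b η ≤ ε/2`.
  set η := min (min r₀ (τ / 2)) (ε / (8 * (b + 1))) with hη'
  have hη : 0 < η := by positivity
  have hη1 : η ≤ r₀ := (min_le_left _ _).trans (min_le_left _ _)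
  have hη2 : η ≤ τ / 2 := (min_le_left _ _).trans (min_le_right _ _)
  have hη3 : 4 * b * η ≤ ε / 2 := by
    have h1 : η ≤ ε / (8 * (b + 1)) := min_le_right _ _
    rw [le_div_iff₀ (by positivity)] at h1
    nlinarith
  obtain ⟨L, hL, hLip⟩ := MasterEquation.exists_gauss_sub_le hD hη (by linarith)
  -- The initial datum and the older part of the source see a Lipschitz kernel and contribute at
  -- most `L δ (m + T q) ≤ ε/2`; the bound `δ ≤ 1` is the range of the Lipschitz estimate.
  set δ := min 1 (ε / (2 * L * (m + T * q))) with hδ'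
  have hmq : 0 < m + T * q := by positivity
  have hδ : 0 < δ := by positivity
  have hδ1 : δ ≤ 1 := min_le_left _ _
  have hδ2 : L * δ * (m + T * q) ≤ ε / 2 := by
    have h1 : δ ≤ ε / (2 * L * (m + T * q)) := min_le_right _ _
    rw [le_div_iff₀ (by positivity)] at h1
    linarith
  have hsrc : ∀ s ∈ Icc 0 T, ∫⁻ Z, ‖source (w s) Z‖ₑ ≤ ENNReal.ofReal q := fun s hs => by
    have := hb s hs
    rw [hqe]
    exact (lintegral_source_le (hw.measurable s) (hw.finite s)).trans (by gcongr)
  have hsup : ∀ s ∈ Icc (τ / 2) T, ∀ᵐ Z, ‖source (w s) Z‖ₑ ≤ ENNReal.ofReal b := fun s hs => by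
    have h1 := hb s ⟨by linarith [hs.1], hs.2⟩
    filter_upwards [ae_enorm_source_le (hw.measurable s) (hw.finite s)
      ((hB s hs).ae_le hB0.le (hw.measurable s).enorm.aemeasurable)] with Z hZ
    rw [hbe]
    exact hZ.trans (by gcongr)
  refine ⟨δ, hδ, fun t ht => ?_⟩
  have ht' : t ∈ Ioc 0 T := ⟨hτ.trans_le ht.1, ht.2⟩
  have hgood := (heq t ht').and (hw.ae_lintegral_absProp_lt_top hD ht')
  filter_upwards [hgood] with X hX
  filter_upwards [hgood] with Y hY hXY
  have hprop : ∀ r ∈ Icc η T, ∀ Z,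
      |M.propagator r X Z - M.propagator r Y Z| ≤ L * δ := by
    intro r hr Z
    rw [MasterEquation.propagator_eq, MasterEquation.propagator_eq]
    have h1 : (X - M.flow r Z) - (Y - M.flow r Z) = X - Y := by abel
    have h2 := hLip r hr (X - M.flow r Z) (Y - M.flow r Z) (by rw [h1]; exact hXY.trans hδ1)
    rw [h1] at h2
    exact h2.trans (by gcongr)
  have hstep : ∀ s ∈ Ioo 0 t, ‖M.forwardProp (t - s) (source (w s)) X -
      M.forwardProp (t - s) (source (w s)) Y‖ₑ ≤ ENNReal.ofReal (L * δ * q) +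
        (Ioo (t - η) t).indicator (fun _ => ENNReal.ofReal (4 * b)) s := by
    intro s hs
    have hr : t - s ∈ Ioc 0 T := ⟨by linarith [hs.2], by linarith [hs.1, ht.2]⟩
    -- For recent `s` no regularity of the kernel is used: each value is at most `2b`, the kernel
    -- having mass at most two in its source variable, so the difference is at most `4b`.
    by_cases hsη : s ∈ Ioo (t - η) t
    · rw [indicator_of_mem hsη]
      have hs2 := hsup s ⟨by linarith [hsη.1, ht.1], by linarith [hs.2, ht.2]⟩
      have hdet := (hflow (t - s) ⟨hr.1.le, by linarith [hsη.1]⟩).2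
      have h1 : ∀ X, ‖M.forwardProp (t - s) (source (w s)) X‖ₑ ≤ 2 * ENNReal.ofReal b := fun X =>
        (MasterEquation.enorm_forwardProp_le hD hr _ X).trans
          (MasterEquation.absProp_le_of_ae_le hD hr hdet hs2 X)
      refine le_trans ?_ le_add_self
      calc _ ≤ 2 * ENNReal.ofReal b + 2 * ENNReal.ofReal b :=
            enorm_sub_le.trans (add_le_add (h1 X) (h1 Y))
        _ = ENNReal.ofReal (4 * b) := by
            rw [ENNReal.ofReal_mul (by norm_num), ENNReal.ofReal_ofNat]
            ring
    · have hsη' : s ≤ t - η := by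
        by_contra! h
        exact hsη ⟨h, hs.2⟩
      refine le_trans ?_ le_self_add
      refine (MasterEquation.enorm_forwardProp_sub_le hD hr
        (integrable_source (hw.measurable s) (hw.finite s))
        (hprop (t - s) ⟨by linarith, hr.2⟩)).trans ?_
      rw [ENNReal.ofReal_mul (p := L * δ) (by positivity)]
      gcongr
      exact hsrc s ⟨hs.1.le, by linarith [hs.2, ht.2]⟩
  have hfirst : ‖M.forwardProp t (w 0) X - M.forwardProp t (w 0) Y‖ₑ ≤
      ENNReal.ofReal (L * δ * m) := by
    refine (MasterEquation.enorm_forwardProp_sub_le hD ht'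
      (integrable_state (hw.measurable 0) (hw.finite 0))
      (hprop t ⟨by linarith [ht.1], ht.2⟩)).trans ?_
    rw [ENNReal.ofReal_mul (p := L * δ) (by positivity)]
    gcongr
    exact (lintegral_enorm_le_stateNorm (hw.measurable 0)).trans (hb 0 ⟨le_rfl, hT.le⟩)
  have hint : ∀ X, ∫ s in (0 : ℝ)..t, M.forwardProp (t - s) (source (w s)) X =
      ∫ s in Ioo 0 t, M.forwardProp (t - s) (source (w s)) X := fun X => by
    rw [intervalIntegral.integral_of_le ht'.1.le, setIntegral_congr_set Ioo_ae_eq_Ioc.symm]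
  have hsecond : ‖(∫ s in (0 : ℝ)..t, M.forwardProp (t - s) (source (w s)) X) -
      ∫ s in (0 : ℝ)..t, M.forwardProp (t - s) (source (w s)) Y‖ₑ ≤
      ENNReal.ofReal (T * (L * δ * q)) + ENNReal.ofReal (4 * b * η) := by
    rw [hint, hint, ← integral_sub (hw.integrableOn_forwardProp hD ht' hX.2)
      (hw.integrableOn_forwardProp hD ht' hY.2)]
    refine (enorm_integral_le_lintegral_enorm _).trans
      ((setLIntegral_mono' measurableSet_Ioo hstep).trans ?_)
    rw [lintegral_add_left measurable_const, setLIntegral_const, Real.volume_Ioo, sub_zero]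
    refine add_le_add ?_ ?_
    · rw [mul_comm, ← ENNReal.ofReal_mul ht'.1.le]
      refine ENNReal.ofReal_le_ofReal ?_
      gcongr
      exact ht.2
    · refine (setLIntegral_le_lintegral _ _).trans ?_
      rw [lintegral_indicator measurableSet_Ioo, setLIntegral_const, Real.volume_Ioo,
        ← ENNReal.ofReal_mul (by positivity), sub_sub_cancel]
  calc ‖w t X - w t Y‖ₑ
      = ‖(M.forwardProp t (w 0) X - M.forwardProp t (w 0) Y) -
          ((∫ s in (0 : ℝ)..t, M.forwardProp (t - s) (source (w s)) X) -
            ∫ s in (0 : ℝ)..t, M.forwardProp (t - s) (source (w s)) Y)‖ₑ := by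
        rw [hX.1, hY.1]
        congr 1
        ring
    _ ≤ ENNReal.ofReal (L * δ * m) +
          (ENNReal.ofReal (T * (L * δ * q)) + ENNReal.ofReal (4 * b * η)) :=
        enorm_sub_le.trans (add_le_add hfirst hsecond)
    _ = ENNReal.ofReal (L * δ * m + (T * (L * δ * q) + 4 * b * η)) := by
        rw [← ENNReal.ofReal_add (by positivity) (by positivity),
          ← ENNReal.ofReal_add (by positivity) (by positivity)]
    _ ≤ ENNReal.ofReal ε := by
        apply ENNReal.ofReal_le_ofReal
        have : L * δ * m + (T * (L * δ * q) + 4 * b * η) =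
          L * δ * (m + T * q) + 4 * b * η := by ring
        rw [this]
        linarith

/-- A function with small oscillation at scale `δ` is bounded by its mass. -/
theorem ae_enorm_le_of_modulus {f : Phase → ℝ} {δ : ℝ} (hδ : 0 < δ) {e : ℝ≥0∞}
    (h : ∀ᵐ X : Phase, ∀ᵐ Y : Phase, ‖X - Y‖ ≤ δ → ‖f X - f Y‖ₑ ≤ e) :
    ∀ᵐ X, ‖f X‖ₑ ≤ e + (volume (Metric.closedBall (0 : Phase) δ))⁻¹ * ∫⁻ Y, ‖f Y‖ₑ := by
  filter_upwards [h] with X hX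
  have hv : volume (Metric.closedBall X δ) = volume (Metric.closedBall (0 : Phase) δ) :=
    Measure.addHaar_closedBall_center volume X δ
  have hv0 : volume (Metric.closedBall (0 : Phase) δ) ≠ 0 :=
    (Metric.measure_closedBall_pos volume _ hδ).ne'
  have hvt : volume (Metric.closedBall (0 : Phase) δ) ≠ ∞ := measure_closedBall_lt_top.ne
  have h1 : ‖f X‖ₑ * volume (Metric.closedBall (0 : Phase) δ) ≤
      e * volume (Metric.closedBall (0 : Phase) δ) + ∫⁻ Y, ‖f Y‖ₑ := by
    rw [← hv, ← setLIntegral_const, ← setLIntegral_const]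
    calc ∫⁻ _ in Metric.closedBall X δ, ‖f X‖ₑ
        ≤ ∫⁻ Y in Metric.closedBall X δ, (e + ‖f Y‖ₑ) := by
          refine setLIntegral_mono_ae' Metric.isClosed_closedBall.measurableSet ?_
          filter_upwards [hX] with Y hY hYb
          have h2 : ‖X - Y‖ ≤ δ := by
            rw [← dist_eq_norm, dist_comm]
            exact hYb
          calc ‖f X‖ₑ = ‖(f X - f Y) + f Y‖ₑ := by rw [sub_add_cancel]
            _ ≤ _ := (enorm_add_le _ _).trans (add_le_add (hY h2) le_rfl)
      _ ≤ _ := by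
          rw [lintegral_add_left measurable_const]
          exact add_le_add le_rfl (setLIntegral_le_lintegral _ _)
  calc ‖f X‖ₑ = (‖f X‖ₑ * volume (Metric.closedBall (0 : Phase) δ)) *
        (volume (Metric.closedBall (0 : Phase) δ))⁻¹ := by
        rw [mul_assoc, ENNReal.mul_inv_cancel hv0 hvt, mul_one]
    _ ≤ (e * volume (Metric.closedBall (0 : Phase) δ) + ∫⁻ Y, ‖f Y‖ₑ) *
        (volume (Metric.closedBall (0 : Phase) δ))⁻¹ := by gcongr
    _ = _ := by
        rw [add_mul, mul_assoc, ENNReal.mul_inv_cancel hv0 hvt, mul_one, mul_comm (∫⁻ Y, ‖f Y‖ₑ)]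

/-- The difference `w s - w t` has small oscillation at a scale `δ` common to all times near `t`, so
averaging over a ball of that radius bounds it by `2ε` plus a multiple of its `L¹` norm, which tends
to zero. -/
theorem continuousInMixed_top (hw : StateCurve T w) (hT : 0 < T)
    (hD : ∀ t ∈ Ioc 0 T, 0 < M.disc t) (heq : Solves M T w) :
    ContinuousInMixed ∞ ∞ (Ioo 0 T) w := by
  intro t ht
  refine ⟨⟨(hw.measurable t).aestronglyMeasurable, ?_⟩, ?_⟩
  · obtain ⟨B, hB0, hB⟩ := hw.exists_dualBound hT hD heq ht.1
    exact (mixedNorm_top_top_le ((hB t ⟨le_rfl, ht.2.le⟩).ae_le hB0.le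
      (hw.measurable t).enorm.aemeasurable)).trans_lt ENNReal.ofReal_lt_top
  have hlim : Tendsto (fun s => stateNorm (fun X => w s X - w t X)) (𝓝[Ioo 0 T] t) (𝓝 0) :=
    (hw.tendsto t ⟨ht.1.le, ht.2.le⟩).mono_left (nhdsWithin_mono _ Ioo_subset_Icc_self)
  refine ENNReal.tendsto_nhds_zero.2 fun e he => ?_
  obtain ⟨ε, hε, hεe⟩ : ∃ ε : ℝ, 0 < ε ∧ 3 * ENNReal.ofReal ε ≤ e := by
    rcases eq_or_ne e ∞ with rfl | hfin
    · exact ⟨1, one_pos, le_top⟩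
    · refine ⟨e.toReal / 3, by have := ENNReal.toReal_pos he.ne' hfin; positivity, ?_⟩
      rw [show (3 : ℝ≥0∞) = ENNReal.ofReal 3 by norm_num, ← ENNReal.ofReal_mul (by norm_num),
        mul_div_cancel₀ _ (by norm_num), ENNReal.ofReal_toReal hfin]
  obtain ⟨δ, hδ, hmod⟩ := hw.exists_modulus hT hD heq (half_pos ht.1)
    (by linarith [ht.1, ht.2]) hε
  set V := volume (Metric.closedBall (0 : Phase) δ) with hV
  have hV0 : V ≠ 0 := (Metric.measure_closedBall_pos volume _ hδ).ne'
  have hlim2 : Tendsto (fun s => V⁻¹ * stateNorm (fun X => w s X - w t X)) (𝓝[Ioo 0 T] t)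
      (𝓝 0) := by
    simpa using ENNReal.Tendsto.const_mul hlim (Or.inr (ENNReal.inv_ne_top.2 hV0))
  have hnear : ∀ᶠ s in 𝓝[Ioo 0 T] t, t / 2 < s :=
    (lt_mem_nhds (by linarith [ht.1])).filter_mono nhdsWithin_le_nhds
  filter_upwards [ENNReal.tendsto_nhds_zero.1 hlim2 (ENNReal.ofReal ε) (by simpa using hε),
    hnear, self_mem_nhdsWithin] with s hs hst hsT
  have hd : Measurable fun X => w s X - w t X := (hw.measurable s).sub (hw.measurable t)
  have hosc : ∀ᵐ X : Phase, ∀ᵐ Y : Phase, ‖X - Y‖ ≤ δ →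
      ‖(w s X - w t X) - (w s Y - w t Y)‖ₑ ≤ 2 * ENNReal.ofReal ε := by
    filter_upwards [hmod s ⟨hst.le, hsT.2.le⟩, hmod t ⟨by linarith [ht.1], ht.2.le⟩] with X h1 h2
    filter_upwards [h1, h2] with Y h3 h4 hXY
    calc ‖(w s X - w t X) - (w s Y - w t Y)‖ₑ
        = ‖(w s X - w s Y) - (w t X - w t Y)‖ₑ := by congr 1; ring
      _ ≤ ENNReal.ofReal ε + ENNReal.ofReal ε :=
          enorm_sub_le.trans (add_le_add (h3 hXY) (h4 hXY))
      _ = _ := (two_mul _).symm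
  refine (mixedNorm_top_top_le ?_).trans hεe
  filter_upwards [ae_enorm_le_of_modulus hδ hosc] with X hX
  refine hX.trans ?_
  calc 2 * ENNReal.ofReal ε + V⁻¹ * ∫⁻ Y, ‖w s Y - w t Y‖ₑ
      ≤ 2 * ENNReal.ofReal ε + V⁻¹ * stateNorm (fun X => w s X - w t X) := by
        gcongr
        exact lintegral_enorm_le_stateNorm hd
    _ ≤ 2 * ENNReal.ofReal ε + ENNReal.ofReal ε := by gcongr
    _ = _ := by ring

/-- Interpolation: the `L^{1,1}` norm of `w s - w t` tends to zero with a positive exponent, while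
the `L^{1,2p-1}` norms stay bounded near `t` by the dual bound. -/
theorem continuousInMixed_one (hw : StateCurve T w) (hT : 0 < T)
    (hD : ∀ t ∈ Ioc 0 T, 0 < M.disc t) (heq : Solves M T w) {p : ℝ≥0∞} (hp1 : 1 < p)
    (hp : p < ∞) : ContinuousInMixed 1 p (Ioo 0 T) w := by
  intro t ht
  obtain ⟨B, hB0, hB⟩ := hw.exists_dualBound hT hD heq (half_pos ht.1)
  have hd1 := lintegral_decay_lt_top
  have hpr : 1 < p.toReal := by
    rw [← ENNReal.toReal_one]
    exact (ENNReal.toReal_lt_toReal ENNReal.one_ne_top hp.ne).2 hp1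
  have hbound : ∀ a : ℝ, 1 < a → ∃ c : ℝ≥0∞, c ≠ ∞ ∧ ∀ s ∈ Icc (t / 2) T,
      ∫⁻ ξ : E3, (∫⁻ x : E3, ‖w s (x, ξ)‖ₑ ^ a) ^ (1 / a) ≤ c := fun a ha =>
    ⟨ENNReal.ofReal B * ((∫⁻ y : E3, decay y) * (∫⁻ y : E3, decay y) ^ (1 / a)),
      by have : 0 ≤ 1 / a := by positivity
         finiteness,
      fun s hs => (hB s hs).lintegral_rpow_le hB0.le (hw.measurable s).enorm
        ((lintegral_enorm_le_stateNorm (hw.measurable s)).trans_lt (hw.finite s)).ne ha⟩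
  have hp0 : p ≠ 0 := (zero_lt_one.trans hp1).ne'
  refine ⟨⟨(hw.measurable t).aestronglyMeasurable, ?_⟩, ?_⟩
  · obtain ⟨c, hc, h⟩ := hbound _ hpr
    rw [mixedNorm_one_eq hp0 hp.ne]
    exact (h t ⟨by linarith [ht.1], ht.2.le⟩).trans_lt hc.lt_top
  have hlim : Tendsto (fun s => stateNorm (fun X => w s X - w t X)) (𝓝[Ioo 0 T] t) (𝓝 0) :=
    (hw.tendsto t ⟨ht.1.le, ht.2.le⟩).mono_left (nhdsWithin_mono _ Ioo_subset_Icc_self)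
  set a := 2 * p.toReal - 1 with ha
  have ha1 : 1 < a := by linarith
  obtain ⟨c, hc, hca⟩ := hbound a ha1
  have hlim2 : Tendsto (fun s => stateNorm (fun X => w s X - w t X) ^ (1 / (2 * p.toReal)) *
      (c + c) ^ (a / (2 * p.toReal))) (𝓝[Ioo 0 T] t) (𝓝 0) := by
    have h1 := hlim.ennrpow_const (1 / (2 * p.toReal))
    rw [ENNReal.zero_rpow_of_pos (by positivity)] at h1
    have h2 : (c + c) ^ (a / (2 * p.toReal)) ≠ ∞ :=
      ENNReal.rpow_ne_top_of_nonneg (by positivity) (by finiteness)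
    simpa using ENNReal.Tendsto.mul_const h1 (Or.inr h2)
  have hnear : ∀ᶠ s in 𝓝[Ioo 0 T] t, t / 2 < s :=
    (lt_mem_nhds (by linarith [ht.1])).filter_mono nhdsWithin_le_nhds
  refine tendsto_of_tendsto_of_tendsto_of_le_of_le' tendsto_const_nhds hlim2
    (Eventually.of_forall fun _ => zero_le) ?_
  filter_upwards [hnear, self_mem_nhdsWithin] with s hst hsT
  have hd : Measurable fun X => w s X - w t X := (hw.measurable s).sub (hw.measurable t)
  rw [mixedNorm_one_eq hp0 hp.ne]
  refine (lintegral_rpow_interpolation hd.enorm hpr.le).trans ?_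
  refine mul_le_mul' (ENNReal.rpow_le_rpow ?_ (by positivity))
    (ENNReal.rpow_le_rpow ?_ (by positivity))
  · refine le_trans (le_of_eq ?_) (lintegral_enorm_le_stateNorm hd)
    rw [Measure.volume_eq_prod, lintegral_prod_symm _ hd.enorm.aemeasurable]
  · have h1 : ENNReal.ofReal a ≠ 0 := by simpa using (by linarith : 0 < a)
    have h2 := mixedNorm_one_add_le (p := ENNReal.ofReal a) (by simpa using ha1.le)
      ENNReal.ofReal_ne_top (hw.measurable s) (hw.measurable t).neg
    simp only [Pi.neg_apply, ← sub_eq_add_neg] at h2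
    rw [mixedNorm_one_eq h1 ENNReal.ofReal_ne_top, mixedNorm_one_eq h1 ENNReal.ofReal_ne_top,
      mixedNorm_one_eq h1 ENNReal.ofReal_ne_top, ENNReal.toReal_ofReal (by linarith)] at h2
    simp only [Pi.neg_apply, enorm_neg] at h2
    exact h2.trans (add_le_add (hca s ⟨hst.le, hsT.2.le⟩)
      (hca t ⟨by linarith [ht.1], ht.2.le⟩))

end StateCurve

end WignerPoisson

namespace WignerPoisson

/-! ### The regularised Coulomb kernel -/

/-- The regularised distance `√(‖z‖² + ε²)`. -/
noncomputable def softNorm (ε : ℝ) (z : E3) : ℝ := √(‖z‖ ^ 2 + ε ^ 2)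

section softNorm

variable {ε : ℝ}

theorem softNorm_pos (hε : 0 < ε) (z : E3) : 0 < softNorm ε z := Real.sqrt_pos.2 (by positivity)

theorem le_softNorm (ε : ℝ) (z : E3) : ε ≤ softNorm ε z :=
  Real.le_sqrt_of_sq_le (by nlinarith [sq_nonneg ‖z‖])

theorem norm_le_softNorm (ε : ℝ) (z : E3) : ‖z‖ ≤ softNorm ε z :=
  Real.le_sqrt_of_sq_le (by nlinarith [sq_nonneg ε])

theorem softNorm_le (hε : 0 < ε) (z : E3) : softNorm ε z ≤ ‖z‖ + ε := by
  refine Real.sqrt_le_iff.2 ⟨by positivity, ?_⟩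
  nlinarith [mul_nonneg (norm_nonneg z) hε.le]

theorem continuous_softNorm (ε : ℝ) : Continuous (softNorm ε) := by
  unfold softNorm
  fun_prop

theorem hasFDerivAt_inv_softNorm (hε : 0 < ε) (z : E3) :
    HasFDerivAt (fun z => (softNorm ε z)⁻¹) (-((softNorm ε z ^ 3)⁻¹ • innerSL ℝ z)) z := by
  have hp : 0 < ‖z‖ ^ 2 + ε ^ 2 := by positivity
  have h1 : HasFDerivAt (fun z : E3 => ‖z‖ ^ 2 + ε ^ 2) (2 • innerSL ℝ z) z :=
    (hasStrictFDerivAt_norm_sq z).hasFDerivAt.add_const _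
  have h2 := h1.sqrt hp.ne'
  have h3 := (hasDerivAt_inv (softNorm_pos hε z).ne').comp_hasFDerivAt z h2
  refine h3.congr_fderiv ?_
  ext v
  have hs := (softNorm_pos hε z).ne'
  change _ = -((softNorm ε z ^ 3)⁻¹ * inner ℝ z v)
  change -(softNorm ε z ^ 2)⁻¹ * (1 / (2 * softNorm ε z) * (2 • inner ℝ z v)) = _
  rw [nsmul_eq_mul]
  push_cast
  field_simp

theorem inv_norm_sub_inv_softNorm_le (hε : 0 < ε) {z : E3} (hz : z ≠ 0) :
    |(softNorm ε z)⁻¹ - ‖z‖⁻¹| ≤ ε * (‖z‖ ^ 2)⁻¹ := by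
  have h0 := norm_pos_iff.2 hz
  have hs := softNorm_pos hε z
  have h1 := norm_le_softNorm ε z
  have h2 := softNorm_le hε z
  have h3 : (softNorm ε z)⁻¹ ≤ ‖z‖⁻¹ := inv_anti₀ h0 h1
  rw [abs_sub_comm, abs_of_nonneg (by linarith), inv_sub_inv h0.ne' hs.ne', ← div_eq_mul_inv]
  gcongr
  · linarith
  · rw [pow_two]
    gcongr

/-- The first bound is independent of `ε` and serves as the integrable majorant near the origin. The
second tends to zero with `ε`, uniformly outside the unit ball. -/
theorem norm_mul_inv_cube_sub_le (hε : 0 < ε) {z : E3} (hz : z ≠ 0) :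
    ‖z‖ * |(softNorm ε z ^ 3)⁻¹ - (‖z‖ ^ 3)⁻¹| ≤ (‖z‖ ^ 2)⁻¹ ∧
    ‖z‖ * |(softNorm ε z ^ 3)⁻¹ - (‖z‖ ^ 3)⁻¹| ≤ 3 * ε * (‖z‖ ^ 3)⁻¹ := by
  have h0 := norm_pos_iff.2 hz
  have hs := softNorm_pos hε z
  have h1 := norm_le_softNorm ε z
  have h2 := softNorm_le hε z
  have h3 : (softNorm ε z ^ 3)⁻¹ ≤ (‖z‖ ^ 3)⁻¹ := inv_anti₀ (by positivity) (by gcongr)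
  set a := ‖z‖
  set s := softNorm ε z
  rw [abs_sub_comm, abs_of_nonneg (by linarith)]
  constructor
  · calc a * ((a ^ 3)⁻¹ - (s ^ 3)⁻¹) ≤ a * (a ^ 3)⁻¹ := by
          gcongr
          have : 0 < (s ^ 3)⁻¹ := by positivity
          linarith
      _ = _ := by field_simp
  · have h4 : a * ((a ^ 3)⁻¹ - (s ^ 3)⁻¹) = (s ^ 3 - a ^ 3) / (a ^ 2 * s ^ 3) := by
      field_simp
    rw [h4, ← div_eq_mul_inv, div_le_div_iff₀ (by positivity) (by positivity)]
    have h5 : s ^ 3 - a ^ 3 ≤ 3 * ε * s ^ 2 := by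
      have h6 : s ^ 3 - a ^ 3 = (s - a) * (s ^ 2 + s * a + a ^ 2) := by ring
      have h7 : s ^ 2 + s * a + a ^ 2 ≤ 3 * s ^ 2 := by nlinarith
      rw [h6]
      calc (s - a) * (s ^ 2 + s * a + a ^ 2) ≤ ε * (3 * s ^ 2) := by
            gcongr
            linarith
        _ = _ := by ring
    calc (s ^ 3 - a ^ 3) * a ^ 3 ≤ 3 * ε * s ^ 2 * a ^ 3 := by gcongr
      _ = 3 * ε * (a ^ 2 * (s ^ 2 * a)) := by ring
      _ ≤ 3 * ε * (a ^ 2 * (s ^ 2 * s)) := by gcongr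
      _ = _ := by ring

end softNorm

/-- A kernel bounded outside the unit ball acts on bounded integrable functions. -/
theorem lintegral_kernel_sub_mul_le {k v : E3 → ℝ≥0∞} (hk : Measurable k) (hv : AEMeasurable v)
    {b c : ℝ≥0∞} (hb : ∀ᵐ x, v x ≤ b) (hc : ∀ z ∉ Metric.ball (0 : E3) 1, k z ≤ c) (x : E3) :
    ∫⁻ y : E3, k (x - y) * v y ≤
      (∫⁻ z in Metric.ball (0 : E3) 1, k z) * b + c * ∫⁻ y, v y := by
  have h1 : ∀ z : E3, k z ≤ (Metric.ball (0 : E3) 1).indicator k z + c := by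
    intro z
    by_cases h : z ∈ Metric.ball (0 : E3) 1
    · rw [indicator_of_mem h]; exact le_self_add
    · rw [indicator_of_notMem h, zero_add]; exact hc z h
  have hki : Measurable ((Metric.ball (0 : E3) 1).indicator k) :=
    hk.indicator Metric.isOpen_ball.measurableSet
  have hm : Measurable fun y : E3 => (Metric.ball (0 : E3) 1).indicator k (x - y) :=
    hki.comp (by fun_prop)
  calc ∫⁻ y : E3, k (x - y) * v y
      ≤ ∫⁻ y : E3, ((Metric.ball (0 : E3) 1).indicator k (x - y) * b + c * v y) := by
        refine lintegral_mono_ae (hb.mono fun y hy => ?_)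
        calc _ ≤ ((Metric.ball (0 : E3) 1).indicator k (x - y) + c) * v y := by
              gcongr; exact h1 _
          _ ≤ _ := by rw [add_mul]; gcongr
    _ = _ := by
        rw [lintegral_add_left (hm.mul_const b), lintegral_mul_const _ hm,
          lintegral_const_mul'' _ hv, lintegral_sub_left_eq_self
          (fun z : E3 => (Metric.ball (0 : E3) 1).indicator k z) x, lintegral_indicator
            Metric.isOpen_ball.measurableSet]

/-- The field kernel `-z/‖z‖³` and its regularisations, as linear forms. -/
noncomputable def fieldKernel (r : E3 → ℝ) (z : E3) : E3 →L[ℝ] ℝ := -((r z ^ 3)⁻¹ • innerSL ℝ z)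

theorem norm_fieldKernel_sub (r r' : E3 → ℝ) (z : E3) :
    ‖fieldKernel r z - fieldKernel r' z‖ = ‖z‖ * |(r z ^ 3)⁻¹ - (r' z ^ 3)⁻¹| := by
  have : fieldKernel r z - fieldKernel r' z =
      -(((r z ^ 3)⁻¹ - (r' z ^ 3)⁻¹) • innerSL ℝ z) := by
    unfold fieldKernel
    rw [sub_smul]
    abel
  rw [this, norm_neg, norm_smul, innerSL_apply_norm, Real.norm_eq_abs, mul_comm]

theorem norm_fieldKernel_norm (z : E3) :
    ‖fieldKernel (fun z => ‖z‖) z‖ = (‖z‖ ^ 2)⁻¹ := by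
  unfold fieldKernel
  rw [norm_neg, norm_smul, innerSL_apply_norm, Real.norm_of_nonneg (by positivity)]
  rcases eq_or_ne ‖z‖ 0 with h | h
  · simp [h]
  · field_simp

theorem norm_fieldKernel_softNorm_le {ε : ℝ} (hε : 0 < ε) (z : E3) :
    ‖fieldKernel (softNorm ε) z‖ ≤ (ε ^ 2)⁻¹ := by
  unfold fieldKernel
  have hs := softNorm_pos hε z
  rw [norm_neg, norm_smul, innerSL_apply_norm, Real.norm_of_nonneg (by positivity)]
  calc (softNorm ε z ^ 3)⁻¹ * ‖z‖ ≤ (softNorm ε z ^ 3)⁻¹ * softNorm ε z := by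
        gcongr
        exact norm_le_softNorm ε z
    _ = (softNorm ε z ^ 2)⁻¹ := by field_simp
    _ ≤ _ := by
        gcongr
        exact le_softNorm ε z

theorem measurable_fieldKernel {r : E3 → ℝ} (hr : Measurable r) : Measurable (fieldKernel r) := by
  have h : Measurable fun z : E3 => innerSL ℝ z := (innerSL ℝ).continuous.measurable
  unfold fieldKernel
  exact (((hr.pow_const 3).inv).smul h).neg

/-- For `ε > 0` the kernel and its derivative are bounded, so differentiation under the integral is
dominated by a multiple of `|n|`. -/
theorem hasFDerivAt_softNorm_conv {n : E3 → ℝ} (hn : Integrable n) {ε : ℝ} (hε : 0 < ε) (x : E3) :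
    HasFDerivAt (fun x => ∫ y, (softNorm ε (x - y))⁻¹ * n y)
      (∫ y, n y • fieldKernel (softNorm ε) (x - y)) x := by
  have hc := continuous_softNorm ε
  have hm := measurable_fieldKernel hc.measurable
  have hmeas : ∀ x, AEStronglyMeasurable (fun y => (softNorm ε (x - y))⁻¹ * n y) volume := fun x =>
    ((hc.measurable.comp (by fun_prop)).inv.aestronglyMeasurable).mul hn.1
  refine hasFDerivAt_integral_of_dominated_of_fderiv_le (𝕜 := ℝ) (s := univ)
    (F := fun x y => (softNorm ε (x - y))⁻¹ * n y)
    (F' := fun x y => n y • fieldKernel (softNorm ε) (x - y)) (x₀ := x)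
    (bound := fun y => ‖n y‖ * (ε ^ 2)⁻¹) univ_mem (Eventually.of_forall hmeas) ?_ ?_ ?_ ?_ ?_
  · refine (hn.norm.const_mul ε⁻¹).mono' (hmeas x) (Eventually.of_forall fun y => ?_)
    rw [norm_mul, norm_inv, Real.norm_of_nonneg (softNorm_pos hε _).le]
    gcongr
    exact le_softNorm ε _
  · exact hn.1.smul (hm.comp (by fun_prop)).aestronglyMeasurable
  · refine Eventually.of_forall fun y z _ => ?_
    rw [norm_smul]
    gcongr
    exact norm_fieldKernel_softNorm_le hε _
  · exact hn.norm.mul_const _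
  · refine Eventually.of_forall fun y z _ => ?_
    have h := (hasFDerivAt_inv_softNorm hε (z - y)).comp z ((hasFDerivAt_id z).sub_const y)
    have h2 := h.mul_const (n y)
    refine h2.congr_fderiv ?_
    ext v
    simp [fieldKernel]

theorem integrable_fieldKernel_conv {n : E3 → ℝ} (hn : Integrable n) {b : ℝ≥0∞} (hb : b ≠ ∞)
    (hnb : ∀ᵐ x, ‖n x‖ₑ ≤ b) (x : E3) :
    Integrable fun y => n y • fieldKernel (fun z => ‖z‖) (x - y) := by
  have hm := measurable_fieldKernel (r := fun z : E3 => ‖z‖) measurable_norm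
  refine ⟨hn.1.smul (hm.comp (by fun_prop)).aestronglyMeasurable, ?_⟩
  have h1 : ∫⁻ y, ‖n y‖ₑ < ∞ := hn.2
  have h2 := ballMass_ne_top
  refine lt_of_le_of_lt (le_trans (le_of_eq (lintegral_congr fun y => ?_))
    (lintegral_inv_norm_sq_mul_le hn.1.enorm hnb x)) (by finiteness)
  dsimp only
  rw [enorm_smul, ← ofReal_norm (fieldKernel _ _), norm_fieldKernel_norm, mul_comm]

end WignerPoisson

namespace WignerPoisson

/-! ### Differentiability of the Coulomb potential -/

/-- The regularisation parameter `1 / (k + 1)`. -/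
noncomputable def epsSeq (k : ℕ) : ℝ := 1 / ((k : ℝ) + 1)

theorem epsSeq_pos (k : ℕ) : 0 < epsSeq k := by unfold epsSeq; positivity

theorem tendsto_epsSeq : Tendsto epsSeq atTop (𝓝 0) := tendsto_one_div_add_atTop_nhds_zero_nat

theorem tendsto_lintegral_fieldKernel_sub :
    Tendsto (fun k => ∫⁻ z in Metric.ball (0 : E3) 1,
      ‖fieldKernel (softNorm (epsSeq k)) z - fieldKernel (fun z => ‖z‖) z‖ₑ) atTop (𝓝 0) := by
  have hm : ∀ k, Measurable fun z =>
      ‖fieldKernel (softNorm (epsSeq k)) z - fieldKernel (fun z => ‖z‖) z‖ₑ := fun k =>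
    ((measurable_fieldKernel (continuous_softNorm _).measurable).sub
      (measurable_fieldKernel measurable_norm)).enorm
  have hne : ∀ᵐ z : E3 ∂(volume.restrict (Metric.ball (0 : E3) 1)), z ≠ 0 :=
    ae_restrict_of_ae (ae_ne_point 0)
  have h := tendsto_lintegral_of_dominated_convergence
    (μ := volume.restrict (Metric.ball (0 : E3) 1))
    (F := fun k z => ‖fieldKernel (softNorm (epsSeq k)) z - fieldKernel (fun z => ‖z‖) z‖ₑ)
    (f := fun _ => 0) (fun z : E3 => ENNReal.ofReal (‖z‖ ^ 2)⁻¹) hm ?_ ballMass_ne_top ?_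
  · simpa using h
  · intro k
    filter_upwards [hne] with z hz
    rw [← ofReal_norm, norm_fieldKernel_sub]
    exact ENNReal.ofReal_le_ofReal (norm_mul_inv_cube_sub_le (epsSeq_pos k) hz).1
  · filter_upwards [hne] with z hz
    have h1 : Tendsto (fun k => ENNReal.ofReal (3 * epsSeq k * (‖z‖ ^ 3)⁻¹)) atTop (𝓝 0) := by
      have := ENNReal.tendsto_ofReal ((tendsto_epsSeq.const_mul 3).mul_const (‖z‖ ^ 3)⁻¹)
      rwa [mul_zero, zero_mul, ENNReal.ofReal_zero] at this
    refine tendsto_of_tendsto_of_tendsto_of_le_of_le tendsto_const_nhds h1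
      (fun _ => zero_le) fun k => ?_
    dsimp only
    rw [← ofReal_norm, norm_fieldKernel_sub]
    exact ENNReal.ofReal_le_ofReal (norm_mul_inv_cube_sub_le (epsSeq_pos k) hz).2

section Coulomb

variable {n : E3 → ℝ} {b : ℝ≥0∞}

theorem integrable_inv_norm_sub_mul (hn : Integrable n) (hb : b ≠ ∞) (hnb : ∀ᵐ x, ‖n x‖ₑ ≤ b)
    (x : E3) : Integrable fun y => ‖x - y‖⁻¹ * n y := by
  have hm : Measurable fun y : E3 => ‖x - y‖⁻¹ := by fun_prop
  refine ⟨hm.aestronglyMeasurable.mul hn.1, ?_⟩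
  have h1 : ∫⁻ y, ‖n y‖ₑ < ∞ := hn.2
  have h2 := ballMass_ne_top
  refine lt_of_le_of_lt (le_trans (le_of_eq (lintegral_congr fun y => ?_))
    (lintegral_inv_norm_mul_le hn.1.enorm hnb x)) (by finiteness)
  dsimp only
  rw [enorm_mul, Real.enorm_of_nonneg (by positivity)]

/-- The field of the density `n`, up to the factor `(4π)⁻¹`. -/
noncomputable def field (n : E3 → ℝ) (x : E3) : E3 →L[ℝ] ℝ :=
  ∫ y, n y • fieldKernel (fun z => ‖z‖) (x - y)

theorem enorm_field_le (n : E3 → ℝ) (x : E3) :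
    ‖field n x‖ₑ ≤ ∫⁻ y, ENNReal.ofReal (‖x - y‖ ^ 2)⁻¹ * ‖n y‖ₑ := by
  refine (enorm_integral_le_lintegral_enorm _).trans (le_of_eq (lintegral_congr fun y => ?_))
  rw [enorm_smul, ← ofReal_norm (fieldKernel _ _), norm_fieldKernel_norm, mul_comm]

/-- Inside the unit ball the kernels converge in `L¹` and the density is bounded; outside, they
differ by at most `3ε` and the density is integrable. Neither estimate depends on `x`. -/
theorem tendstoUniformly_field (hn : Integrable n) (hb : b ≠ ∞) (hnb : ∀ᵐ x, ‖n x‖ₑ ≤ b) :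
    TendstoUniformly (fun k x => ∫ y, n y • fieldKernel (softNorm (epsSeq k)) (x - y))
      (field n) atTop := by
  have h1 : ∫⁻ y, ‖n y‖ₑ < ∞ := hn.2
  have hlim : Tendsto (fun k => (∫⁻ z in Metric.ball (0 : E3) 1,
      ‖fieldKernel (softNorm (epsSeq k)) z - fieldKernel (fun z => ‖z‖) z‖ₑ) * b +
      ENNReal.ofReal (3 * epsSeq k) * ∫⁻ y, ‖n y‖ₑ) atTop (𝓝 0) := by
    have ha := ENNReal.Tendsto.mul_const (b := b) tendsto_lintegral_fieldKernel_sub (Or.inr hb)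
    have hc : Tendsto (fun k => ENNReal.ofReal (3 * epsSeq k)) atTop (𝓝 0) := by
      have := ENNReal.tendsto_ofReal (tendsto_epsSeq.const_mul 3)
      rwa [mul_zero, ENNReal.ofReal_zero] at this
    have hd := ENNReal.Tendsto.mul_const (b := ∫⁻ y, ‖n y‖ₑ) hc (Or.inr h1.ne)
    simpa using ha.add hd
  refine EMetric.tendstoUniformly_iff.2 fun e he => ?_
  filter_upwards [hlim.eventually (gt_mem_nhds he)] with k hk x
  refine lt_of_le_of_lt ?_ hk
  rw [edist_comm, edist_eq_enorm_sub]
  have hms := measurable_fieldKernel (continuous_softNorm (epsSeq k)).measurable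
  have hmn := measurable_fieldKernel (r := fun z : E3 => ‖z‖) measurable_norm
  have hint : Integrable fun y => n y • fieldKernel (softNorm (epsSeq k)) (x - y) := by
    refine (hn.norm.mul_const ((epsSeq k) ^ 2)⁻¹).mono'
      (hn.1.smul (hms.comp (by fun_prop)).aestronglyMeasurable) (Eventually.of_forall fun y => ?_)
    rw [norm_smul]
    gcongr
    exact norm_fieldKernel_softNorm_le (epsSeq_pos k) _
  rw [field, ← integral_sub hint (integrable_fieldKernel_conv hn hb hnb x)]
  refine (enorm_integral_le_lintegral_enorm _).trans (le_trans (le_of_eq (lintegral_congr fun y =>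
    ?_)) (lintegral_kernel_sub_mul_le (hms.sub hmn).enorm hn.1.enorm hnb (fun z hz => ?_) x))
  · rw [mul_comm, ← enorm_smul, Pi.sub_apply]
    exact congrArg enorm (smul_sub _ _ _).symm
  · have hz1 : 1 ≤ ‖z‖ := by simpa using hz
    have hz0 : z ≠ 0 := norm_pos_iff.1 (by linarith)
    simp only [Pi.sub_apply]
    rw [← ofReal_norm, norm_fieldKernel_sub]
    refine ENNReal.ofReal_le_ofReal ((norm_mul_inv_cube_sub_le (epsSeq_pos k) hz0).2.trans ?_)
    exact mul_le_of_le_one_right (by have := epsSeq_pos k; positivity)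
      (inv_le_one_of_one_le₀ (one_le_pow₀ hz1))

theorem tendsto_softNorm_conv (hn : Integrable n) (hb : b ≠ ∞) (hnb : ∀ᵐ x, ‖n x‖ₑ ≤ b) (x : E3) :
    Tendsto (fun k => ∫ y, (softNorm (epsSeq k) (x - y))⁻¹ * n y) atTop
      (𝓝 (∫ y, ‖x - y‖⁻¹ * n y)) := by
  have h1 : ∫⁻ y, ‖n y‖ₑ < ∞ := hn.2
  have h2 := ballMass_ne_top
  have hm : ∀ k, Measurable fun y => (softNorm (epsSeq k) (x - y))⁻¹ := fun k =>
    ((continuous_softNorm _).measurable.comp (by fun_prop)).inv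
  refine tendsto_integral_of_L1 _ (integrable_inv_norm_sub_mul hn hb hnb x).1
    (Eventually.of_forall fun k => ?_) ?_
  · refine (hn.norm.const_mul (epsSeq k)⁻¹).mono' ((hm k).aestronglyMeasurable.mul hn.1)
      (Eventually.of_forall fun y => ?_)
    have := epsSeq_pos k
    rw [norm_mul, norm_inv, Real.norm_of_nonneg (softNorm_pos (epsSeq_pos k) _).le]
    gcongr
    exact le_softNorm _ _
  · have hlim : Tendsto (fun k => ENNReal.ofReal (epsSeq k) * (ballMass * b + ∫⁻ y, ‖n y‖ₑ))
        atTop (𝓝 0) := by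
      have hc : Tendsto (fun k => ENNReal.ofReal (epsSeq k)) atTop (𝓝 0) := by
        have := ENNReal.tendsto_ofReal tendsto_epsSeq
        rwa [ENNReal.ofReal_zero] at this
      simpa using ENNReal.Tendsto.mul_const (b := ballMass * b + ∫⁻ y, ‖n y‖ₑ) hc
        (Or.inr (by finiteness))
    refine tendsto_of_tendsto_of_tendsto_of_le_of_le tendsto_const_nhds hlim
      (fun _ => zero_le) fun k => ?_
    dsimp only
    calc ∫⁻ y, ‖(softNorm (epsSeq k) (x - y))⁻¹ * n y - ‖x - y‖⁻¹ * n y‖ₑ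
        ≤ ∫⁻ y, ENNReal.ofReal (epsSeq k) * (ENNReal.ofReal (‖x - y‖ ^ 2)⁻¹ * ‖n y‖ₑ) := by
          refine lintegral_mono_ae ((ae_ne_point x).mono fun y hy => ?_)
          rw [← sub_mul, enorm_mul, ← mul_assoc, ← ENNReal.ofReal_mul (epsSeq_pos k).le,
            Real.enorm_eq_ofReal_abs]
          gcongr
          exact inv_norm_sub_inv_softNorm_le (epsSeq_pos k) (sub_ne_zero.2 hy.symm)
      _ = ENNReal.ofReal (epsSeq k) * ∫⁻ y, ENNReal.ofReal (‖x - y‖ ^ 2)⁻¹ * ‖n y‖ₑ :=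
          lintegral_const_mul' _ _ ENNReal.ofReal_ne_top
      _ ≤ _ := by
          gcongr
          exact lintegral_inv_norm_sq_mul_le hn.1.enorm hnb x

/-- The regularised potentials converge pointwise and their derivatives uniformly, so the limit is
differentiable with the limiting derivative. -/
theorem hasFDerivAt_coulomb (hn : Integrable n) (hb : b ≠ ∞) (hnb : ∀ᵐ x, ‖n x‖ₑ ≤ b) (x : E3) :
    HasFDerivAt (coulomb n) ((4 * Real.pi)⁻¹ • field n x) x := by
  have h1 := hasFDerivAt_of_tendstoUniformly (tendstoUniformly_field hn hb hnb)
    (fun k x => hasFDerivAt_softNorm_conv hn (epsSeq_pos k) x)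
    (fun x => tendsto_softNorm_conv hn hb hnb x) x
  have h2 : coulomb n = fun x => (4 * Real.pi)⁻¹ * ∫ y, ‖x - y‖⁻¹ * n y := by
    funext x
    rw [coulomb, ← integral_const_mul]
    congr 1 with y
    rw [one_div, mul_inv]
    ring
  rw [h2]
  exact h1.const_mul _

theorem enorm_gradient_coulomb_le (hn : Integrable n) (hb : b ≠ ∞) (hnb : ∀ᵐ x, ‖n x‖ₑ ≤ b)
    (x : E3) :
    ‖gradient (coulomb n) x‖ₑ ≤ ∫⁻ y, ENNReal.ofReal (‖x - y‖ ^ 2)⁻¹ * ‖n y‖ₑ := by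
  refine le_trans ?_ (enorm_field_le n x)
  rw [enorm_le_iff_norm_le, gradient, LinearIsometryEquiv.norm_map,
    (hasFDerivAt_coulomb hn hb hnb x).fderiv, norm_smul]
  refine mul_le_of_le_one_left (norm_nonneg _) ?_
  rw [Real.norm_of_nonneg (by positivity)]
  exact inv_le_one_of_one_le₀ (by linarith [Real.pi_gt_three])

theorem measurable_gradient (V : E3 → ℝ) : Measurable (gradient V) :=
  (InnerProductSpace.toDual ℝ E3).symm.continuous.measurable.comp (measurable_fderiv ℝ V)

theorem memLp_gradient_coulomb_top (hn : Integrable n) (hb : b ≠ ∞) (hnb : ∀ᵐ x, ‖n x‖ₑ ≤ b) :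
    MemLp (gradient (coulomb n)) ∞ volume := by
  refine ⟨(measurable_gradient _).aestronglyMeasurable, ?_⟩
  have h1 : ∫⁻ y, ‖n y‖ₑ < ∞ := hn.2
  have h2 := ballMass_ne_top
  rw [eLpNorm_exponent_top]
  refine lt_of_le_of_lt (essSup_le_of_ae_le (ballMass * b + ∫⁻ y, ‖n y‖ₑ)
    (Eventually.of_forall fun x => ?_)) (by finiteness)
  exact (enorm_gradient_coulomb_le hn hb hnb x).trans
    (lintegral_inv_norm_sq_mul_le hn.1.enorm hnb x)

/-- Young's inequality `L¹ * L² ⊆ L²`. -/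
theorem lintegral_conv_sq_le {k v : E3 → ℝ≥0∞} (hk : Measurable k) (hv : Measurable v) :
    ∫⁻ x, (∫⁻ y, k y * v (x - y)) ^ (2 : ℝ) ≤ (∫⁻ y, k y) ^ (2 : ℝ) * ∫⁻ x, v x ^ (2 : ℝ) := by
  refine (lintegral_sq_lintegral_le (v := fun X : Phase => k X.2 * v (X.1 - X.2))
    (by fun_prop)).trans (le_of_eq ?_)
  have h1 : ∀ y : E3, (∫⁻ x : E3, (k y * v (x - y)) ^ (2 : ℝ)) ^ (1 / 2 : ℝ) =
      k y * (∫⁻ x, v x ^ (2 : ℝ)) ^ (1 / 2 : ℝ) := by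
    intro y
    simp_rw [ENNReal.mul_rpow_of_nonneg _ _ (show (0 : ℝ) ≤ 2 by norm_num)]
    rw [lintegral_const_mul _ (by fun_prop),
      lintegral_sub_right_eq_self (fun x => v x ^ (2 : ℝ)) y,
      ENNReal.mul_rpow_of_nonneg _ _ (by norm_num), ← ENNReal.rpow_mul]
    norm_num
  simp only [h1]
  rw [lintegral_mul_const _ hk, ENNReal.mul_rpow_of_nonneg _ _ (by norm_num), ← ENNReal.rpow_mul]
  norm_num

/-- The kernel `‖z‖⁻²` is in neither `L¹` nor `L²`. Its part near the origin is in `L¹` and is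
paired with `n ∈ L²`; its tail is in `L²` and is paired with `n ∈ L¹`. Young's inequality handles
both. -/
theorem memLp_gradient_coulomb_two (hnm : Measurable n) (hn : Integrable n) (hn2 : MemLp n 2)
    (hb : b ≠ ∞) (hnb : ∀ᵐ x, ‖n x‖ₑ ≤ b) : MemLp (gradient (coulomb n)) 2 volume := by
  refine ⟨(measurable_gradient _).aestronglyMeasurable, ?_⟩
  have h1 : ∫⁻ y, ‖n y‖ₑ < ∞ := hn.2
  have h2 : ∫⁻ y, ‖n y‖ₑ ^ (2 : ℝ) < ∞ := by
    have := (eLpNorm_lt_top_iff_lintegral_rpow_enorm_lt_top (by norm_num) (by norm_num)).1 hn2.2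
    simpa only [ENNReal.toReal_ofNat] using this
  have hball := (Metric.isOpen_ball (x := (0 : E3)) (ε := 1)).measurableSet
  set k : E3 → ℝ≥0∞ := fun z => ENNReal.ofReal (‖z‖ ^ 2)⁻¹ with hk
  have hkm : Measurable k := by fun_prop
  set k₁ := (Metric.ball (0 : E3) 1).indicator k with hk₁
  set k₂ := (Metric.ball (0 : E3) 1)ᶜ.indicator k with hk₂
  have hk₁m : Measurable k₁ := hkm.indicator hball
  have hk₂m : Measurable k₂ := hkm.indicator hball.compl
  have hk₁i : ∫⁻ z, k₁ z ≠ ∞ := by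
    rw [hk₁, lintegral_indicator hball]
    exact ballMass_ne_top
  have hk₂i : ∫⁻ z, k₂ z ^ (2 : ℝ) ≠ ∞ := by
    have h3 : ∀ z, k₂ z ^ (2 : ℝ) =
        (Metric.ball (0 : E3) 1)ᶜ.indicator (fun z => ENNReal.ofReal (‖z‖ ^ 4)⁻¹) z := by
      intro z
      by_cases hz : z ∈ (Metric.ball (0 : E3) 1)ᶜ
      · rw [hk₂, indicator_of_mem hz, indicator_of_mem hz, hk,
          ENNReal.ofReal_rpow_of_nonneg (by positivity) (by norm_num)]
        congr 1
        norm_cast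
        rw [← inv_pow, ← inv_pow, ← pow_mul]
      · rw [hk₂, indicator_of_notMem hz, indicator_of_notMem hz,
          ENNReal.zero_rpow_of_pos (by norm_num)]
    simp_rw [h3]
    rw [lintegral_indicator hball.compl]
    exact tailMass_ne_top
  have hsplit : ∀ x, ∫⁻ y, k (x - y) * ‖n y‖ₑ =
      (∫⁻ y, k₁ y * ‖n (x - y)‖ₑ) + ∫⁻ y, ‖n y‖ₑ * k₂ (x - y) := by
    intro x
    have h3 : ∫⁻ y, k₁ y * ‖n (x - y)‖ₑ = ∫⁻ y, k₁ (x - y) * ‖n y‖ₑ := by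
      rw [← lintegral_sub_left_eq_self (fun y => k₁ y * ‖n (x - y)‖ₑ) x]
      simp only [sub_sub_cancel]
    rw [h3, ← lintegral_add_left (by fun_prop)]
    refine lintegral_congr fun y => ?_
    have h4 : k (x - y) = k₁ (x - y) + k₂ (x - y) :=
      (indicator_self_add_compl_apply (Metric.ball (0 : E3) 1) k (x - y)).symm
    rw [h4]
    ring
  rw [eLpNorm_lt_top_iff_lintegral_rpow_enorm_lt_top (by norm_num) (by norm_num)]
  simp only [ENNReal.toReal_ofNat]
  have hnem : Measurable fun y => ‖n y‖ₑ := hnm.enorm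
  have hc1 := lintegral_conv_sq_le hk₁m hnem
  have hc2 := lintegral_conv_sq_le hnem hk₂m
  have hm1 : Measurable fun x => ∫⁻ y, k₁ y * ‖n (x - y)‖ₑ :=
    Measurable.lintegral_prod_right' (f := fun p : E3 × E3 => k₁ p.2 * ‖n (p.1 - p.2)‖ₑ)
      (by fun_prop)
  calc ∫⁻ x, ‖gradient (coulomb n) x‖ₑ ^ (2 : ℝ)
      ≤ ∫⁻ x, (2 ^ ((2 : ℝ) - 1) * (∫⁻ y, k₁ y * ‖n (x - y)‖ₑ) ^ (2 : ℝ) +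
          2 ^ ((2 : ℝ) - 1) * (∫⁻ y, ‖n y‖ₑ * k₂ (x - y)) ^ (2 : ℝ)) := by
        refine lintegral_mono fun x => ?_
        rw [← mul_add]
        refine le_trans ?_ (ENNReal.rpow_add_le_mul_rpow_add_rpow _ _ (by norm_num))
        rw [← hsplit]
        gcongr
        exact enorm_gradient_coulomb_le hn hb hnb x
    _ = 2 ^ ((2 : ℝ) - 1) * (∫⁻ x, (∫⁻ y, k₁ y * ‖n (x - y)‖ₑ) ^ (2 : ℝ)) +
          2 ^ ((2 : ℝ) - 1) * ∫⁻ x, (∫⁻ y, ‖n y‖ₑ * k₂ (x - y)) ^ (2 : ℝ) := by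
        rw [lintegral_add_left (by fun_prop), lintegral_const_mul' _ _ (by norm_num),
          lintegral_const_mul' _ _ (by norm_num)]
    _ ≤ 2 ^ ((2 : ℝ) - 1) * ((∫⁻ z, k₁ z) ^ (2 : ℝ) * ∫⁻ y, ‖n y‖ₑ ^ (2 : ℝ)) +
          2 ^ ((2 : ℝ) - 1) * ((∫⁻ y, ‖n y‖ₑ) ^ (2 : ℝ) * ∫⁻ z, k₂ z ^ (2 : ℝ)) := by gcongr
    _ < ∞ := by finiteness

end Coulomb

end WignerPoisson

namespace WignerPoisson

/-! ### Mild solutions as measurable state curves -/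

theorem ContinuousInMixed.congr_ae {q p : ℝ≥0∞} {I : Set ℝ} {w w' : ℝ → Phase → ℝ}
    (hw : ContinuousInMixed q p I w) (h : ∀ s ∈ I, w s =ᵐ[volume] w' s) :
    ContinuousInMixed q p I w' := by
  intro t ht
  obtain ⟨⟨h1, h2⟩, h3⟩ := hw t ht
  refine ⟨⟨h1.congr (h t ht), (mixedNorm_congr_ae (h t ht)).symm.trans_lt h2⟩, h3.congr' ?_⟩
  filter_upwards [self_mem_nhdsWithin] with s hs
  refine mixedNorm_congr_ae ?_
  filter_upwards [h s hs, h t ht] with X h4 h5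
  rw [h4, h5]

theorem stateNorm_zero : stateNorm (fun _ => 0) = 0 := by
  simp [stateNorm, mixedNorm]

namespace IsMildSolution

variable {M : MasterEquation} {w₀ : Phase → ℝ} {T : ℝ} {w : ℝ → Phase → ℝ}

/-- Strictly measurable representatives are chosen on `[0, T]`, with zero elsewhere. Densities,
potentials and the integrals against the propagator depend only on almost everywhere classes, so the
Duhamel formula survives, now with the explicit Poisson symbol in place of `V̌`. -/
theorem exists_stateCurve (hT : 0 < T) (hw : IsMildSolution M w₀ T w) :
    ∃ w' : ℝ → Phase → ℝ, (∀ s ∈ Icc 0 T, w' s =ᵐ[volume] w s) ∧ StateCurve T w' ∧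
      StateCurve.Solves M T w' := by
  classical
  set w' : ℝ → Phase → ℝ := fun s =>
    if h : s ∈ Icc 0 T then (hw.continuous_one_one s h).1.1.mk (w s) else fun _ => 0 with hw'
  have hae : ∀ s ∈ Icc 0 T, w' s =ᵐ[volume] w s := fun s hs => by
    simp only [hw', dif_pos hs]
    exact (hw.continuous_one_one s hs).1.1.ae_eq_mk.symm
  have hsymm : ∀ s ∈ Icc 0 T, w s =ᵐ[volume] w' s := fun s hs => (hae s hs).symm
  have h11 := hw.continuous_one_one.congr_ae hsymm
  have h12 := hw.continuous_one_two.congr_ae hsymm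
  have hcurve : StateCurve T w' := by
    refine ⟨fun s => ?_, fun s => ?_, fun s hs => ?_⟩
    · by_cases hs : s ∈ Icc 0 T
      · simp only [hw', dif_pos hs]
        exact (hw.continuous_one_one s hs).1.1.measurable_mk
      · simp only [hw', dif_neg hs]
        exact measurable_const
    · by_cases hs : s ∈ Icc 0 T
      · exact ENNReal.add_lt_top.2 ⟨(h11 s hs).1.2, (h12 s hs).1.2⟩
      · simp only [hw', dif_neg hs]
        rw [stateNorm_zero]
        exact ENNReal.zero_lt_top
    · simpa [stateNorm] using (h11 s hs).2.add (h12 s hs).2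
  refine ⟨w', hae, hcurve, fun t ht => ?_⟩
  have htI : t ∈ Icc 0 T := ⟨ht.1.le, ht.2⟩
  filter_upwards [hae t htI, hw.integral_equation t ht] with X h1 h2
  rw [h1, h2]
  congr 1
  · refine integral_congr_ae ?_
    filter_upwards [hae 0 ⟨le_rfl, hT.le⟩, hw.initial] with Z h3 h4
    rw [h3, h4]
  · refine intervalIntegral.integral_congr fun s hs => ?_
    rw [uIcc_of_le ht.1.le] at hs
    have hsI : s ∈ Icc 0 T := ⟨hs.1, hs.2.trans ht.2⟩
    have h5 : theta (potential (w s)) (w s) =ᵐ[volume] source (w' s) := by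
      rw [source, ← theta_potential_eq
        (integrable_density_state (hcurve.measurable s) (hcurve.finite s))
        (memLp_density_state (hcurve.measurable s) (hcurve.finite s)),
        potential_congr_ae (hae s hsI)]
      exact theta_congr_ae _ (hsymm s hsI)
    refine integral_congr_ae ?_
    filter_upwards [h5] with Z h6
    rw [h6]

end IsMildSolution

/-- The density of a solution is bounded at positive times. -/
theorem StateCurve.exists_density_bound {M : MasterEquation} {T : ℝ} {w : ℝ → Phase → ℝ}
    (hw : StateCurve T w) (hT : 0 < T) (hD : ∀ t ∈ Ioc 0 T, 0 < M.disc t)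
    (heq : StateCurve.Solves M T w) {t : ℝ} (ht : t ∈ Ioc 0 T) :
    ∃ b : ℝ≥0∞, b ≠ ∞ ∧ ∀ᵐ x, ‖density (w t) x‖ₑ ≤ b := by
  obtain ⟨B, hB0, hB⟩ := hw.exists_dualBound hT hD heq ht.1
  have hd := lintegral_decay_lt_top
  refine ⟨ENNReal.ofReal B * ∫⁻ y, decay y, by finiteness, ?_⟩
  filter_upwards [(hB t ⟨le_rfl, ht.2⟩).ae_lintegral_le hB0.le (hw.measurable t).enorm] with x hx
  exact (enorm_density_le _ x).trans hx

end WignerPoisson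

/-! ### Conclusion for mild solutions -/

theorem mainTheorem6 (M : WignerPoisson.MasterEquation) (w₀ : WignerPoisson.Phase → ℝ)
    (hw₀ : WignerPoisson.MemMixed 1 1 w₀ ∧ WignerPoisson.MemMixed 1 2 w₀)
    (T : ℝ) (hT : 0 < T) (hT_max : ENNReal.ofReal T < WignerPoisson.maximalTime M w₀)
    (w : ℝ → WignerPoisson.Phase → ℝ) (hw : WignerPoisson.IsMildSolution M w₀ T w) :
    WignerPoisson.ContinuousInMixed ∞ ∞ (Ioo 0 T) w ∧
    (∀ p : ℝ≥0∞, 1 ≤ p → p < ∞ → WignerPoisson.ContinuousInMixed 1 p (Ioo 0 T) w) ∧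
    ∀ t ∈ Ioo 0 T,
      Differentiable ℝ (WignerPoisson.potential (w t)) ∧
      MemLp (gradient (WignerPoisson.potential (w t))) 2 volume ∧
      MemLp (gradient (WignerPoisson.potential (w t))) ∞ volume := by
  have hD := hw.propagator_defined
  obtain ⟨w', hae, hcurve, heq⟩ := hw.exists_stateCurve hT
  have hae' : ∀ s ∈ Ioo 0 T, w' s =ᵐ[volume] w s := fun s hs => hae s (Ioo_subset_Icc_self hs)
  refine ⟨(hcurve.continuousInMixed_top hT hD heq).congr_ae hae', fun p hp1 hp => ?_,
    fun t ht => ?_⟩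
  -- The case `p = 1` is part of the definition of a mild solution; interpolation covers `p > 1`.
  · rcases hp1.eq_or_lt with rfl | hp1
    · intro t ht
      obtain ⟨h1, h2⟩ := hw.continuous_one_one t (Ioo_subset_Icc_self ht)
      exact ⟨h1, h2.mono_left (nhdsWithin_mono _ Ioo_subset_Icc_self)⟩
    · exact (hcurve.continuousInMixed_one hT hD heq hp1 hp).congr_ae hae'
  · have hm := hcurve.measurable t
    have hfin := hcurve.finite t
    obtain ⟨b, hb, hnb⟩ := hcurve.exists_density_bound hT hD heq ⟨ht.1, ht.2.le⟩
    have hn := WignerPoisson.integrable_density_state hm hfin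
    rw [← WignerPoisson.potential_congr_ae (hae' t ht), WignerPoisson.potential_eq_coulomb]
    exact ⟨fun x => (WignerPoisson.hasFDerivAt_coulomb hn hb hnb x).differentiableAt,
      WignerPoisson.memLp_gradient_coulomb_two (WignerPoisson.measurable_density hm) hn
        (WignerPoisson.memLp_density_state hm hfin) hb hnb,
      WignerPoisson.memLp_gradient_coulomb_top hn hb hnb⟩
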